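/- Let $M$ be a smooth (Hausdorff) manifold of dimension $n\ge 2$ and let $\nabla$ be a smooth torsion-free connection on $TM$ which is special, i.e. there is a smooth nowhere vanishing $n$-form $\epsilon$ on $M$ with $\nabla\epsilon=0$. Define the curvature by $(\nabla_a\nabla_b-\nabla_b\nabla_a)X^c=R_{ab}{}^c{}_dX^d$, the Ricci tensor by $R_{bd}=R_{ab}{}^a{}_d$, the Schouten tensor by $(n-1)\mathrm{P}_{ab}=R_{ab}$, the Weyl tensor $W_{ab}{}^c{}_d$ by $$R_{ab}{}^c{}_d=W_{ab}{}^c{}_d+\delta_a{}^c\mathrm{P}_{bd}-\delta_b{}^c\mathrm{P}_{ad},$$ and the Cotton–York tensor by $Y_{abc}=\tfrac12(\nabla_a\mathrm{P}_{bc}-\nabla_b\mathrm{P}_{ac})$. Let $\mathcal{T}=\bigodot^2TM\oplus TM\oplus\mathbb{R}$, where $\mathbb{R}$ denotes the trivial line bundle. Then $$\begin{pmatrix}\sigma^{bc}\\ \mu^b\\ \rho\end{pmatrix}\longmapsto\begin{pmatrix}\nabla_a\sigma^{bc}-\delta_a{}^b\mu^c-\delta_a{}^c\mu^b\\ \nabla_a\mu^b-\delta_a{}^b\rho+\mathrm{P}_{ac}\sigma^{bc}-\frac1nW_{ac}{}^b{}_d\sigma^{cd}\\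 \nabla_a\rho+2\mathrm{P}_{ab}\mu^b-\frac4nY_{abc}\sigma^{bc}\end{pmatrix}$$ is a connection on $\mathcal{T}$, and $(\sigma^{bc},\mu^b,\rho)\mapsto\sigma^{bc}$ is a bijection from the set of covariant constant smooth sections of $\mathcal{T}$ (those sent to $0$ by this connection) onto the set of smooth symmetric contravariant $2$-tensor fields $\sigma^{bc}$ on $M$ for which there is a smooth vector field $\mu^a$ with $$\nabla_a\sigma^{bc}=\delta_a{}^b\mu^c+\delta_a{}^c\mu^b.$$ -/

import Mathlib

open scoped Manifold ContDiff Bundle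

set_option maxSynthPendingDepth 3

noncomputable section

namespace ProjectiveMetric

/-- The model space of an `n`-dimensional manifold. -/
abbrev Model (n : ℕ) : Type := EuclideanSpace ℝ (Fin n)

section Basic

variable {n : ℕ} {M : Type*} [TopologicalSpace M] [ChartedSpace (Model n) M]

/-- The tangent space at `x`. -/
abbrev TanAt (n : ℕ) {M : Type*} [TopologicalSpace M] [ChartedSpace (Model n) M] (x : M) : Type :=
  TangentSpace (𝓡 n) x

/-- The cotangent space at `x`. -/
abbrev CotAt (n : ℕ) {M : Type*} [TopologicalSpace M] [ChartedSpace (Model n) M] (x : M) : Type :=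
  TanAt n x →L[ℝ] ℝ

/-- Contravariant `2`-tensors at `x`, as bilinear forms on the cotangent space. -/
abbrev BivAt (n : ℕ) {M : Type*} [TopologicalSpace M] [ChartedSpace (Model n) M] (x : M) : Type :=
  CotAt n x →L[ℝ] CotAt n x →L[ℝ] ℝ

/-- A basis `e_i` of the tangent space at `x`. -/
def frame (x : M) (i : Fin n) : TanAt n x := (EuclideanSpace.single i (1 : ℝ) : Model n)

/-- The dual basis `e^i` of the cotangent space at `x`. -/
def coframe (x : M) (i : Fin n) : CotAt n x := (EuclideanSpace.proj i : Model n →L[ℝ] ℝ)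

lemma coframe_frame (x : M) (i j : Fin n) :
    coframe x i (frame x j) = if i = j then 1 else 0 := by
  change (EuclideanSpace.single j (1 : ℝ) : Model n) i = _
  simp

lemma sum_coframe_smul_frame (x : M) (v : TanAt n x) : ∑ i, coframe x i v • frame x i = v := by
  change ∑ i, (show Model n from v) i • (EuclideanSpace.single i (1 : ℝ) : Model n) = _
  ext j
  simp [Pi.single_apply]

end Basic

section Smooth

variable {n : ℕ} {M : Type*} [TopologicalSpace M] [ChartedSpace (Model n) M]
  [IsManifold (𝓡 n) ∞ M]

/-- A vector field with value `v` at `x` which is smooth near `x`. -/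
def extVec {x : M} (v : TanAt n x) (y : M) : TanAt n y := FiberBundle.extend (Model n) v y

/-- A `1`-form with value `α` at `x` which is smooth near `x`. -/
def extCov {x : M} (α : CotAt n x) (y : M) : CotAt n y :=
  FiberBundle.extend (Model n →L[ℝ] ℝ) (E := fun y : M => CotAt n y) α y

/-- Smooth vector fields. -/
abbrev VectorField (n : ℕ) (M : Type*) [TopologicalSpace M] [ChartedSpace (Model n) M]
    [IsManifold (𝓡 n) ∞ M] :=
  ContMDiffSection (𝓡 n) (Model n) ∞ (fun x : M => TanAt n x)

/-- Smooth contravariant `2`-tensor fields. -/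
abbrev BivectorField (n : ℕ) (M : Type*) [TopologicalSpace M] [ChartedSpace (Model n) M]
    [IsManifold (𝓡 n) ∞ M] :=
  ContMDiffSection (𝓡 n) ((Model n →L[ℝ] ℝ) →L[ℝ] (Model n →L[ℝ] ℝ) →L[ℝ] ℝ) ∞
    (fun x : M => BivAt n x)

/-- Smooth symmetric contravariant `2`-tensor fields, i.e. smooth sections `σ^{bc}` of `⊙²TM`. -/
abbrev SymBivectorField (n : ℕ) (M : Type*) [TopologicalSpace M] [ChartedSpace (Model n) M]
    [IsManifold (𝓡 n) ∞ M] :=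
  {σ : BivectorField n M // ∀ (x : M) (α β : CotAt n x), σ x α β = σ x β α}

/-- Connections on the tangent bundle; `D Y x (X x)` is `∇_X Y` at `x`. -/
abbrev Connection (n : ℕ) (M : Type*) [TopologicalSpace M] [ChartedSpace (Model n) M]
    [IsManifold (𝓡 n) ∞ M] :=
  CovariantDerivative (𝓡 n) (Model n) (fun x : M => TanAt n x)

/-- The differential of a function `f` at `x` in the direction `u`. -/
def dir (f : M → ℝ) (x : M) (u : TanAt n x) : ℝ := mvfderiv (𝓡 n) f x u

variable (D : Connection n M)

/-- The curvature `R(u,v)w = R_{ab}{}^c{}_d u^a v^b w^d`, where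
`(∇_a ∇_b - ∇_b ∇_a) X^c = R_{ab}{}^c{}_d X^d` for torsion-free `∇`. -/
def curvature (x : M) (u v w : TanAt n x) : TanAt n x :=
  D (fun y => D (extVec w) y (extVec v y)) x u
    - D (fun y => D (extVec w) y (extVec u y)) x v
    - D (extVec w) x (VectorField.mlieBracket (𝓡 n) (extVec u) (extVec v) x)

/-- The Ricci tensor `R_{bd} = R_{ab}{}^a{}_d`. -/
def ricci (x : M) (v w : TanAt n x) : ℝ :=
  ∑ i, coframe x i (curvature D x (frame x i) v w)

/-- The Schouten tensor: `(n - 1) P_{ab} = R_{ab}`. -/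
def schouten (x : M) (v w : TanAt n x) : ℝ := ricci D x v w / ((n : ℝ) - 1)

/-- The Weyl tensor `W(u,v)w = W_{ab}{}^c{}_d u^a v^b w^d`:
`R_{ab}{}^c{}_d = W_{ab}{}^c{}_d + δ_a{}^c P_{bd} - δ_b{}^c P_{ad}`. -/
def weyl (x : M) (u v w : TanAt n x) : TanAt n x :=
  curvature D x u v w - schouten D x v w • u + schouten D x u w • v

/-- The covariant derivative `u^a v^b w^c ∇_a P_{bc}` of the Schouten tensor. -/
def schoutenDeriv (x : M) (u v w : TanAt n x) : ℝ :=
  dir (fun y => schouten D y (extVec v y) (extVec w y)) x u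
    - schouten D x (D (extVec v) x u) w - schouten D x v (D (extVec w) x u)

/-- The Cotton-York tensor `Y_{abc} = (∇_a P_{bc} - ∇_b P_{ac}) / 2`. -/
def cottonYork (x : M) (u v w : TanAt n x) : ℝ :=
  (schoutenDeriv D x u v w - schoutenDeriv D x v u w) / 2

/-- The covariant derivative of a `1`-form: its `i`-th component is
`u(α(e_i)) - α(∇_u e_i)`. -/
def covectorDeriv (α : ∀ y : M, CotAt n y) (x : M) (u : TanAt n x) : CotAt n x :=
  ∑ i, (dir (fun y => α y (extVec (frame x i) y)) x u
    - α x (D (extVec (frame x i)) x u)) • coframe x i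

/-- The covariant derivative `u^a α_b β_c ∇_a σ^{bc}` of a contravariant `2`-tensor. -/
def bivectorDeriv (σ : ∀ y : M, BivAt n y) (x : M) (u : TanAt n x) (α β : CotAt n x) : ℝ :=
  dir (fun y => σ y (extCov α y) (extCov β y)) x u
    - σ x (covectorDeriv D (extCov α) x u) β - σ x α (covectorDeriv D (extCov β) x u)

/-- The connection is special: some smooth nowhere vanishing `n`-form `ε` is parallel. -/
def IsSpecial : Prop :=
  ∃ ε : ∀ x : M, TanAt n x [⋀^Fin n]→ₗ[ℝ] ℝ,
    (∀ X : Fin n → VectorField n M,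
      ContMDiff (𝓡 n) 𝓘(ℝ, ℝ) ∞ (fun x => ε x (fun i => X i x))) ∧
    (∀ x, ε x ≠ 0) ∧
    ∀ (x : M) (u : TanAt n x) (v : Fin n → TanAt n x),
      dir (fun y => ε y (fun i => extVec (v i) y)) x u
        = ∑ i, ε x (Function.update v i (D (extVec (v i)) x u))

/-- The equation `∇_a σ^{bc} = δ_a{}^b μ^c + δ_a{}^c μ^b` for some smooth vector field `μ`. -/
def IsSolution (σ : SymBivectorField n M) : Prop :=
  ∃ μ : VectorField n M, ∀ (x : M) (u : TanAt n x) (α β : CotAt n x),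
    bivectorDeriv D σ.1 x u α β = α u * β (μ x) + β u * α (μ x)

/-- Smooth sections `(σ^{bc}, μ^b, ρ)` of `⊙²TM ⊕ TM ⊕ ℝ`. -/
@[ext]
structure ProlongedSection (n : ℕ) (M : Type*) [TopologicalSpace M] [ChartedSpace (Model n) M]
    [IsManifold (𝓡 n) ∞ M] where
  /-- the component in `⊙²TM` -/
  sigma : SymBivectorField n M
  /-- the component in `TM` -/
  mu : VectorField n M
  /-- the component in the trivial line bundle -/
  rho : ContMDiffMap (𝓡 n) 𝓘(ℝ, ℝ) M ℝ ∞

/-- A vector space in which the fibre at `x` of `⊙²TM ⊕ TM ⊕ ℝ` sits: the first component is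
written as a function of two covectors. -/
abbrev PreFibre (n : ℕ) {M : Type*} [TopologicalSpace M] [ChartedSpace (Model n) M] (x : M) :
    Type :=
  (CotAt n x → CotAt n x → ℝ) × TanAt n x × ℝ

/-- The value of a section at a point. -/
def ProlongedSection.val (s : ProlongedSection n M) (x : M) : PreFibre n x :=
  (fun α β => s.sigma.1 x α β, s.mu x, s.rho x)

/-- The connection on `⊙²TM ⊕ TM ⊕ ℝ` taking `(σ^{bc}, μ^b, ρ)` to the triple with entries
`∇_a σ^{bc} - δ_a{}^b μ^c - δ_a{}^c μ^b`,
`∇_a μ^b - δ_a{}^b ρ + P_{ac} σ^{bc} - (1/n) W_{ac}{}^b{}_d σ^{cd}`,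
`∇_a ρ + 2 P_{ab} μ^b - (4/n) Y_{abc} σ^{bc}`, evaluated at `x` in the direction `u`. -/
def prolongedDeriv (s : ProlongedSection n M) (x : M) (u : TanAt n x) : PreFibre n x :=
  (fun α β => bivectorDeriv D s.sigma.1 x u α β - α u * β (s.mu x) - β u * α (s.mu x),
   D s.mu x u - s.rho x • u
     + ∑ b, ∑ c, (schouten D x u (frame x c) * s.sigma.1 x (coframe x b) (coframe x c)) •
         frame x b
     - (1 / (n : ℝ)) • ∑ c, ∑ d, s.sigma.1 x (coframe x c) (coframe x d) •
         weyl D x u (frame x c) (frame x d),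
   dir s.rho x u + 2 * schouten D x u (s.mu x)
     - (4 / (n : ℝ)) * ∑ b, ∑ c, cottonYork D x u (frame x b) (frame x c) *
         s.sigma.1 x (coframe x b) (coframe x c))

/-- An operator on smooth sections of `⊙²TM ⊕ TM ⊕ ℝ` is a connection: it is linear in the
direction, it takes smooth sections to smooth sections (along smooth vector fields), it is additive
and it satisfies the Leibniz rule. -/
structure IsConnection
    (N : ProlongedSection n M → ∀ x : M, TanAt n x → PreFibre n x) : Prop where
  linear : ∀ s x, IsLinearMap ℝ (N s x)
  smooth : ∀ s (X : VectorField n M), ∃ t : ProlongedSection n M, ∀ x, t.val x = N s x (X x)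
  add : ∀ s t r : ProlongedSection n M, (∀ x, r.val x = s.val x + t.val x) →
    ∀ x u, N r x u = N s x u + N t x u
  leibniz : ∀ (f : ContMDiffMap (𝓡 n) 𝓘(ℝ, ℝ) M ℝ ∞) (s r : ProlongedSection n M),
    (∀ x, r.val x = f x • s.val x) →
      ∀ x u, N r x u = f x • N s x u + dir f x u • s.val x

/-- A section is covariant constant if its derivative vanishes identically. -/
def IsCovariantConstant
    (N : ProlongedSection n M → ∀ x : M, TanAt n x → PreFibre n x)
    (s : ProlongedSection n M) : Prop :=
  ∀ (x : M) (u : TanAt n x), N s x u = 0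

end Smooth

end ProjectiveMetric

end

/-!
Prolongation of the equation `∇_a σ^{bc} = δ_a{}^b μ^c + δ_a{}^c μ^b`.

Commuting derivatives in the equation and taking a trace expresses `∇_a μ^b` through `σ`, the
curvature and one unknown scalar, `n ρ = ∇_a μ^a + P_{ab} σ^{ab}`: this is the second entry of the
prolonged connection (`integrability_sigma`, `dvec_eq_of_dbiv_eq`). Commuting derivatives of `μ`
and taking a trace then gives `∇_a ρ`, the third entry (`integrability_mu`, `derivation_rhoOf`). The
Weyl tensor enters this last step through its divergence, which the contracted differential Bianchi
identity turns into the Cotton-York tensor (`divCurv_wey`). So each solution `σ` extends to a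
parallel section (`exists_isCovariantConstant`). Conversely a parallel section is determined by `σ`,
because `μ` is a trace of `∇σ` and `ρ` a trace of the second equation
(`IsCovariantConstant.eq_of_sigma_eq`). Specialness is used only through the symmetry of the
Schouten tensor: a parallel volume form has logarithmic derivative `Γ^k_{ak}` in coordinates, so
that the trace `R_{ab}{}^k{}_k` vanishes (`trace_riem_eq_zero`).

The tensor calculus is carried out in an arbitrary commutative `ℝ`-algebra with commuting
derivations `d a` and Christoffel symbols `G a c b = Γ^c_{ab}`. It is applied to the algebra
`chartRing n c` of smooth functions on the domain of the chart at `c`, with the partial derivatives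
`pdDer c` and the Christoffel symbols `chrisRing` of the connection. The invariant definitions
extend tensors from a point `y` by the trivialization at `y`, whereas components refer to the frame
of the fixed chart at `c`; the comparison at all `y` near `c` is a matter of tensoriality
(`bivectorDeriv_eq_sum`, `curvature_eq_sum`, `schoutenDeriv_eq_sum`) and of the independence of
contractions from the frame (`sum_frame_coframe`). In components the prolonged connection is given
by `prolSigma`, `prolMu`, `prolRho`, whose coefficients are smooth; linearity, the Leibniz rule and
smoothness follow (`isConnection_prolongedDeriv`).
-/

noncomputable section

namespace ProjectiveMetric
/-! ### Curvature of a torsion-free connection in a differential ring -/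

section Algebra

open Matrix

variable {n : ℕ} {A : Type*} [CommRing A] [Algebra ℝ A]
  (d : Fin n → Derivation ℝ A A) (G : Fin n → Matrix (Fin n) (Fin n) A)

/-- The curvature `R_{ab}`, an endomorphism-valued `2`-form, of the connection with Christoffel
symbols `Γ^c_{ab} = G a c b`. -/
def riem (a b : Fin n) : Matrix (Fin n) (Fin n) A :=
  (G b).map (d a) - (G a).map (d b) + G a * G b - G b * G a

/-- The Ricci tensor `R_{bd} = R_{ab}{}^a{}_d`. -/
def ric (b e : Fin n) : A := ∑ a, riem d G a b a e

/-- The Schouten tensor `P_{be}`, with `(n - 1) P_{be} = R_{be}`. -/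
def schou (b e : Fin n) : A := algebraMap ℝ A (1 / ((n : ℝ) - 1)) * ric d G b e

/-- The Weyl tensor `W_{ab}{}^c{}_e`. -/
def wey (a b c e : Fin n) : A :=
  riem d G a b c e - (if a = c then schou d G b e else 0) + if b = c then schou d G a e else 0

/-- The covariant derivative `∇_a P_{bc}` of the Schouten tensor. -/
def dschou (a b c : Fin n) : A :=
  d a (schou d G b c) - ∑ e, G a e b * schou d G e c - ∑ e, G a e c * schou d G b e

/-- The Cotton-York tensor `Y_{abc} = (∇_a P_{bc} - ∇_b P_{ac}) / 2`. -/
def cott (a b c : Fin n) : A :=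
  algebraMap ℝ A (1 / 2) * (dschou d G a b c - dschou d G b a c)

variable {d G}

lemma map_derivation_mul (D : Derivation ℝ A A) (X Y : Matrix (Fin n) (Fin n) A) :
    (X * Y).map D = X.map D * Y + X * Y.map D := by
  ext i j
  simp only [Matrix.map_apply, Matrix.mul_apply, Matrix.add_apply, map_sum, Derivation.leibniz,
    smul_eq_mul, Finset.sum_add_distrib]
  rw [add_comm]
  congr 1
  exact Finset.sum_congr rfl fun k _ => mul_comm _ _

lemma map_derivation_add (D : Derivation ℝ A A) (X Y : Matrix (Fin n) (Fin n) A) :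
    (X + Y).map D = X.map D + Y.map D := by ext; simp

lemma map_derivation_sub (D : Derivation ℝ A A) (X Y : Matrix (Fin n) (Fin n) A) :
    (X - Y).map D = X.map D - Y.map D := by ext; simp

lemma map_derivation_comm (hd : ∀ a b f, d a (d b f) = d b (d a f)) (a b : Fin n)
    (X : Matrix (Fin n) (Fin n) A) : (X.map (d a)).map (d b) = (X.map (d b)).map (d a) := by
  ext; simp [hd a b]

lemma riem_antisymm (a b : Fin n) : riem d G a b = -riem d G b a := by
  simp only [riem]; abel

lemma riem_apply (a b c e : Fin n) : riem d G a b c e =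
    d a (G b c e) - d b (G a c e) + ∑ f, G a c f * G b f e - ∑ f, G b c f * G a f e := by
  simp [riem, Matrix.mul_apply]

/-- The algebraic Bianchi identity. -/
lemma bianchi_first (hG : ∀ a b c, G a c b = G b c a) (a b c e : Fin n) :
    riem d G a b c e + riem d G b e c a + riem d G e a c b = 0 := by
  simp only [riem_apply, hG b a, hG e a, hG e b]
  ring

/-- The differential Bianchi identity, as an identity of endomorphism-valued `3`-forms. The
Christoffel symbols acting on the form indices are absent: they cancel as the connection is
torsion-free. -/
lemma bianchi_second (hd : ∀ a b f, d a (d b f) = d b (d a f)) (a b c : Fin n) :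
    ((riem d G b c).map (d a) + G a * riem d G b c - riem d G b c * G a)
    + ((riem d G c a).map (d b) + G b * riem d G c a - riem d G c a * G b)
    + ((riem d G a b).map (d c) + G c * riem d G a b - riem d G a b * G c) = 0 := by
  simp only [riem, map_derivation_add, map_derivation_sub, map_derivation_mul]
  rw [map_derivation_comm hd b a, map_derivation_comm hd c a, map_derivation_comm hd c b]
  noncomm_ring

/-- The trace of the curvature on its endomorphism indices measures the skew part of the Ricci
tensor. -/
lemma ric_symm (hG : ∀ a b c, G a c b = G b c a) (htr : ∀ a b, ∑ c, riem d G a b c c = 0)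
    (a b : Fin n) : ric d G a b = ric d G b a := by
  have h : ∑ c, (riem d G a b c c + riem d G b c c a + riem d G c a c b) = 0 :=
    Finset.sum_eq_zero fun c _ => bianchi_first hG a b c c
  simp only [Finset.sum_add_distrib, htr, zero_add] at h
  have h2 : ∑ c, riem d G b c c a = -ric d G b a := by
    rw [ric, ← Finset.sum_neg_distrib]
    exact Finset.sum_congr rfl fun c _ => by rw [riem_antisymm]; rfl
  rw [h2] at h
  change -ric d G b a + ric d G a b = 0 at h
  linear_combination h

lemma schou_symm (hG : ∀ a b c, G a c b = G b c a) (htr : ∀ a b, ∑ c, riem d G a b c c = 0)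
    (a b : Fin n) : schou d G a b = schou d G b a := by
  rw [schou, schou, ric_symm hG htr]

lemma ric_eq_schou (hn : 2 ≤ n) (b e : Fin n) : ric d G b e = ((n : A) - 1) * schou d G b e := by
  have h : ((n : A) - 1) * algebraMap ℝ A (1 / ((n : ℝ) - 1)) = 1 := by
    have h1 : ((n : A) - 1) = algebraMap ℝ A ((n : ℝ) - 1) := by simp
    have h2 : ((n : ℝ) - 1) ≠ 0 := by
      have : (2 : ℝ) ≤ n := by exact_mod_cast hn
      linarith
    rw [h1, ← map_mul, mul_one_div_cancel h2, map_one]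
  rw [schou, ← mul_assoc, h, one_mul]

/-- The Ricci identity for a contravariant `2`-tensor `s` with derivatives `S a = ∇_a s`, in matrix
form. The terms with Christoffel symbols on the index of the derivative are symmetric and left
out. -/
lemma ricci_identity_biv (hd : ∀ a b f, d a (d b f) = d b (d a f))
    (s : Matrix (Fin n) (Fin n) A) (a b : Fin n)
    (S : Fin n → Matrix (Fin n) (Fin n) A)
    (hS : ∀ a, s.map (d a) + G a * s + s * (G a)ᵀ = S a) :
    ((S b).map (d a) + G a * S b + S b * (G a)ᵀ) - ((S a).map (d b) + G b * S a + S a * (G b)ᵀ)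
      = riem d G a b * s + s * (riem d G a b)ᵀ := by
  simp only [← hS, riem, map_derivation_add, map_derivation_mul, Matrix.transpose_add,
    Matrix.transpose_sub, Matrix.transpose_mul, ← Matrix.transpose_map]
  rw [map_derivation_comm hd b a]
  noncomm_ring

/-! ### The first two integrability conditions -/

/-- The covariant derivative `∇_a μ^c`. -/
def dvec (d : Fin n → Derivation ℝ A A) (G : Fin n → Matrix (Fin n) (Fin n) A)
    (mu : Fin n → A) (a c : Fin n) : A :=
  d a (mu c) + ∑ e, G a c e * mu e

/-- The covariant derivative `∇_a σ^{bc}`. -/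
def dbiv (d : Fin n → Derivation ℝ A A) (G : Fin n → Matrix (Fin n) (Fin n) A)
    (s : Fin n → Fin n → A) (a b c : Fin n) : A :=
  d a (s b c) + ∑ e, G a b e * s e c + ∑ e, G a c e * s b e

/-- The integrability condition obtained by commuting derivatives in
`∇_a σ^{bc} = δ_a{}^b μ^c + δ_a{}^c μ^b`. -/
lemma integrability_sigma (hd : ∀ a b f, d a (d b f) = d b (d a f))
    (hG : ∀ a b c, G a c b = G b c a) {s : Fin n → Fin n → A} {mu : Fin n → A}
    (h : ∀ a b c, dbiv d G s a b c = (if a = b then mu c else 0) + if a = c then mu b else 0)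
    (a b c e : Fin n) :
    ∑ f, riem d G a b c f * s f e + ∑ f, riem d G a b e f * s c f =
      (if b = c then dvec d G mu a e else 0) + (if b = e then dvec d G mu a c else 0)
      - (if a = c then dvec d G mu b e else 0) - (if a = e then dvec d G mu b c else 0) := by
  have key := ricci_identity_biv hd (Matrix.of s) a b
    (fun a => Matrix.of fun b c => (if a = b then mu c else 0) + if a = c then mu b else 0) (by
      intro a
      ext b c
      have := h a b c
      simp only [dbiv] at this
      simp only [Matrix.add_apply, Matrix.map_apply, Matrix.mul_apply, Matrix.transpose_apply,
        Matrix.of_apply]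
      rw [← this]
      congr 1
      exact Finset.sum_congr rfl fun k _ => mul_comm _ _)
  have key := congrFun (congrFun key c) e
  have aux (a b c e : Fin n) : (((Matrix.of fun c e =>
      (if b = c then mu e else 0) + if b = e then mu c else 0).map (d a)
        + G a * (Matrix.of fun c e => (if b = c then mu e else 0) + if b = e then mu c else 0)
        + (Matrix.of fun c e => (if b = c then mu e else 0) + if b = e then mu c else 0)
          * (G a)ᵀ : Matrix _ _ A)) c e =
      (if b = c then dvec d G mu a e else 0) + (if b = e then dvec d G mu a c else 0)
        + G a c b * mu e + G a e b * mu c := by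
    simp only [Matrix.add_apply, Matrix.map_apply, Matrix.mul_apply, Matrix.transpose_apply,
        Matrix.of_apply, mul_add, add_mul, Finset.sum_add_distrib, mul_ite, ite_mul, mul_zero,
        zero_mul, Finset.sum_ite_eq, Finset.mem_univ, if_true, map_add, apply_ite (d a), map_zero,
        dvec, Finset.sum_ite_irrel, Finset.sum_const_zero, mul_comm (mu _)]
    split_ifs <;> ring
  rw [Matrix.sub_apply, aux, aux] at key
  rw [hG a b c, hG a b e] at key
  have h1 : ∑ f, riem d G a b e f * s c f = ∑ f, s c f * riem d G a b e f :=
    Finset.sum_congr rfl fun k _ => mul_comm _ _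
  rw [h1]
  simp only [Matrix.add_apply, Matrix.mul_apply, Matrix.transpose_apply, Matrix.of_apply] at key
  rw [← key]
  ring

lemma sum_wey_mul (a b : Fin n) (s : Fin n → Fin n → A) :
    ∑ c, ∑ e, wey d G a c b e * s c e = ∑ c, ∑ e, riem d G a c b e * s c e
      - (if a = b then ∑ c, ∑ e, schou d G c e * s c e else 0) + ∑ e, schou d G a e * s b e := by
  simp only [wey, sub_mul, add_mul, ite_mul, zero_mul, Finset.sum_add_distrib,
    Finset.sum_sub_distrib, Finset.sum_ite_irrel, Finset.sum_const_zero, Finset.sum_ite_eq',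
    Finset.mem_univ, if_true]

/-- The scalar `ρ` determined by a solution `(σ, μ)`:
`n ρ = ∇_a μ^a + P_{ab} σ^{ab}`. -/
def rhoOf (d : Fin n → Derivation ℝ A A) (G : Fin n → Matrix (Fin n) (Fin n) A)
    (s : Fin n → Fin n → A) (mu : Fin n → A) : A :=
  algebraMap ℝ A (1 / (n : ℝ)) * (∑ a, dvec d G mu a a + ∑ b, ∑ c, schou d G b c * s b c)

lemma inv_natCast_mul (hn : 2 ≤ n) : algebraMap ℝ A (1 / (n : ℝ)) * (n : A) = 1 := by
  have h1 : (n : A) = algebraMap ℝ A (n : ℝ) := by simp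
  have h2 : (n : ℝ) ≠ 0 := by positivity
  rw [h1, ← map_mul, one_div_mul_cancel h2, map_one]

/-- The second prolonged equation
`∇_a μ^b = δ_a{}^b ρ - P_{ac} σ^{bc} + (1/n) W_{ac}{}^b{}_d σ^{cd}`: the trace of
`integrability_sigma`. -/
lemma dvec_eq_of_dbiv_eq (hn : 2 ≤ n) (hd : ∀ a b f, d a (d b f) = d b (d a f))
    (hG : ∀ a b c, G a c b = G b c a) {s : Fin n → Fin n → A} {mu : Fin n → A}
    (hs : ∀ b c, s b c = s c b)
    (h : ∀ a b c, dbiv d G s a b c = (if a = b then mu c else 0) + if a = c then mu b else 0)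
    (a b : Fin n) :
    dvec d G mu a b = (if a = b then rhoOf d G s mu else 0) - ∑ c, schou d G a c * s b c
      + algebraMap ℝ A (1 / (n : ℝ)) * ∑ c, ∑ e, wey d G a c b e * s c e := by
  have tr : ∑ k, (∑ f, riem d G a k k f * s f b + ∑ f, riem d G a k b f * s k f) =
      ∑ k, ((if k = k then dvec d G mu a b else 0) + (if k = b then dvec d G mu a k else 0)
      - (if a = k then dvec d G mu k b else 0) - (if a = b then dvec d G mu k k else 0)) :=
    Finset.sum_congr rfl fun k _ => integrability_sigma hd hG h a k k b
  simp only [Finset.sum_add_distrib, Finset.sum_sub_distrib, if_true, Finset.sum_const,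
    Finset.card_univ, Fintype.card_fin, nsmul_eq_mul, Finset.sum_ite_eq, Finset.sum_ite_eq',
    Finset.mem_univ, Finset.sum_ite_irrel] at tr
  have h1 : ∑ k, ∑ f, riem d G a k k f * s f b = -(((n : A) - 1) * ∑ c, schou d G a c * s b c) := by
    rw [Finset.sum_comm, Finset.mul_sum, ← Finset.sum_neg_distrib]
    refine Finset.sum_congr rfl fun f _ => ?_
    rw [← Finset.sum_mul, ← mul_assoc, ← ric_eq_schou hn, ric, hs b f, ← neg_mul,
      ← Finset.sum_neg_distrib]
    congr 1
    exact Finset.sum_congr rfl fun k _ => by rw [riem_antisymm]; rfl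
  have hi := inv_natCast_mul (A := A) hn
  rw [h1] at tr
  rw [sum_wey_mul a b s, rhoOf]
  set i := algebraMap ℝ A (1 / (n : ℝ))
  split_ifs at tr ⊢ <;>
    linear_combination (-i) * tr - (dvec d G mu a b + ∑ c, schou d G a c * s b c) * hi

/-! ### The contracted Bianchi identity -/

/-- The Ricci identity for a vector `μ`. Christoffel symbols on the index of the derivative are left
out, as they cancel. -/
lemma integrability_mu (hd : ∀ a b f, d a (d b f) = d b (d a f)) (mu : Fin n → A)
    (a b c : Fin n) :
    (d a (dvec d G mu b c) + ∑ e, G a c e * dvec d G mu b e)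
      - (d b (dvec d G mu a c) + ∑ e, G b c e * dvec d G mu a e)
      = ∑ e, riem d G a b c e * mu e := by
  -- the vector is encoded as a square matrix with equal columns, so that ring normalization applies
  let X : Matrix (Fin n) (Fin n) A := Matrix.of fun c _ => mu c
  have h : ((X.map (d b) + G b * X).map (d a) + G a * (X.map (d b) + G b * X))
      - ((X.map (d a) + G a * X).map (d b) + G b * (X.map (d a) + G a * X))
      = riem d G a b * X := by
    simp only [riem, map_derivation_add, map_derivation_mul]
    rw [map_derivation_comm hd b a]
    noncomm_ring
  have h := congrFun (congrFun h c) c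
  simpa [X, Matrix.mul_apply, dvec] using h

/-- The Leibniz rule for the contraction `X_{ef} σ^{ef}`. -/
lemma derivation_contraction (s X : Fin n → Fin n → A) (a : Fin n) :
    d a (∑ e, ∑ f, X e f * s e f) =
      ∑ e, ∑ f, (d a (X e f) - ∑ g, G a g e * X g f - ∑ g, G a g f * X e g) * s e f
      + ∑ e, ∑ f, X e f * dbiv d G s a e f := by
  simp only [dbiv, map_sum, Derivation.leibniz, smul_eq_mul, mul_add, sub_mul, Finset.sum_mul,
    Finset.mul_sum, Finset.sum_add_distrib, Finset.sum_sub_distrib]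
  have h1 : ∑ e, ∑ f, ∑ g, G a g e * X g f * s e f = ∑ e, ∑ f, ∑ g, X e f * (G a e g * s g f) := by
    calc _ = ∑ e, ∑ g, ∑ f, G a g e * X g f * s e f :=
          Finset.sum_congr rfl fun e _ => Finset.sum_comm
      _ = ∑ g, ∑ e, ∑ f, G a g e * X g f * s e f := Finset.sum_comm
      _ = ∑ g, ∑ f, ∑ e, G a g e * X g f * s e f :=
          Finset.sum_congr rfl fun e _ => Finset.sum_comm
      _ = _ := Finset.sum_congr rfl fun e _ => Finset.sum_congr rfl fun f _ =>
          Finset.sum_congr rfl fun g _ => by ring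
  have h2 : ∑ e, ∑ f, ∑ g, G a g f * X e g * s e f = ∑ e, ∑ f, ∑ g, X e f * (G a f g * s e g) := by
    refine Finset.sum_congr rfl fun e _ => ?_
    rw [Finset.sum_comm]
    exact Finset.sum_congr rfl fun f _ => Finset.sum_congr rfl fun g _ => by ring
  have h3 : ∑ e, ∑ f, s e f * d a (X e f) = ∑ e, ∑ f, d a (X e f) * s e f :=
    Finset.sum_congr rfl fun e _ => Finset.sum_congr rfl fun f _ => mul_comm _ _
  rw [h1, h2, h3]
  ring

/-- The divergence `∇_b Q_a{}^b`. -/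
def divg (d : Fin n → Derivation ℝ A A) (G : Fin n → Matrix (Fin n) (Fin n) A)
    (Q : Fin n → Fin n → A) (a : Fin n) : A :=
  ∑ b, (d b (Q a b) + ∑ e, G b b e * Q a e - ∑ e, G b e a * Q e b)

/-- The trace of the skew part of the derivative of `Q`: the Christoffel symbols missing on the
left are those which cancel in a torsion-free skew derivative. -/
lemma trace_skew_eq (hG : ∀ a b c, G a c b = G b c a) (Q : Fin n → Fin n → A) (a : Fin n) :
    ∑ b, ((d a (Q b b) + ∑ e, G a b e * Q b e) - (d b (Q a b) + ∑ e, G b b e * Q a e)) =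
      d a (∑ b, Q b b) - divg d G Q a := by
  have h : ∑ b, ∑ e, G a b e * Q b e = ∑ b, ∑ e, G b e a * Q e b := by
    rw [Finset.sum_comm]
    exact Finset.sum_congr rfl fun e _ => Finset.sum_congr rfl fun b _ => by rw [hG a e b]
  simp only [divg, Finset.sum_sub_distrib, Finset.sum_add_distrib, map_sum]
  rw [h]
  ring

/-- The contraction `∇_k T_{ac}{}^k{}_f` of the covariant derivative of a tensor
`T_{ac}{}^b{}_f`. -/
def divCurv (d : Fin n → Derivation ℝ A A) (G : Fin n → Matrix (Fin n) (Fin n) A)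
    (T : Fin n → Fin n → Fin n → Fin n → A) (a c f : Fin n) : A :=
  ∑ k, (d k (T a c k f) + ∑ g, G k k g * T a c g f - ∑ g, G k g a * T g c k f
    - ∑ g, G k g c * T a g k f - ∑ g, G k g f * T a c k g)

/-- The trace of the differential Bianchi identity. -/
lemma divCurv_riem (hn : 2 ≤ n) (hd : ∀ a b f, d a (d b f) = d b (d a f))
    (hG : ∀ a b c, G a c b = G b c a) (a c f : Fin n) :
    divCurv d G (fun a b c e => riem d G a b c e) a c f =
      ((n : A) - 1) * (dschou d G a c f - dschou d G c a f) := by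
  have hB : ∑ k, ((((riem d G a c).map (d k) + G k * riem d G a c - riem d G a c * G k)
    + ((riem d G c k).map (d a) + G a * riem d G c k - riem d G c k * G a)
    + ((riem d G k a).map (d c) + G c * riem d G k a - riem d G k a * G c)) k f) = 0 :=
    Finset.sum_eq_zero fun k _ => by rw [bianchi_second hd]; rfl
  have e1 : ∑ k, ∑ g, G k g a * riem d G g c k f = ∑ k, ∑ g, G a k g * riem d G k c g f := by
    rw [Finset.sum_comm]
    exact Finset.sum_congr rfl fun k _ => Finset.sum_congr rfl fun g _ => by rw [hG g a k]
  have e2 : ∑ k, ∑ g, G k g c * riem d G a g k f = -∑ k, ∑ g, G c k g * riem d G k a g f := by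
    rw [Finset.sum_comm, ← Finset.sum_neg_distrib]
    refine Finset.sum_congr rfl fun k _ => ?_
    rw [← Finset.sum_neg_distrib]
    exact Finset.sum_congr rfl fun g _ => by
      rw [hG g c k, riem_antisymm a k, Matrix.neg_apply, mul_neg]
  have e3 (a c : Fin n) : ∑ k, ∑ g, riem d G k a k g * G c g f
      = ∑ g, G c g f * ric d G a g := by
    rw [Finset.sum_comm]
    exact Finset.sum_congr rfl fun g _ => by rw [ric, ← Finset.sum_mul, mul_comm]
  have e4 : ∑ k, ∑ g, riem d G a c k g * G k g f = ∑ k, ∑ g, G k g f * riem d G a c k g :=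
    Finset.sum_congr rfl fun k _ => Finset.sum_congr rfl fun g _ => mul_comm _ _
  have e5 (a c : Fin n) : ∑ k, d c (riem d G k a k f) = d c (ric d G a f) := by
    rw [ric, map_sum]
  have e6 (a c f : Fin n) : ((n : A) - 1) * dschou d G a c f =
      d a (ric d G c f) - ∑ e, G a e c * ric d G e f - ∑ e, G a e f * ric d G c e := by
    simp only [ric_eq_schou hn, Derivation.leibniz, smul_eq_mul, map_sub, Derivation.map_natCast,
      Derivation.map_one_eq_zero, mul_left_comm _ ((n : A) - 1), ← Finset.mul_sum, dschou]
    ring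
  have e7 : ∑ e, G c e a * ric d G e f = ∑ e, G a e c * ric d G e f :=
    Finset.sum_congr rfl fun e _ => by rw [hG c a e]
  simp only [riem_antisymm c, Matrix.add_apply, Matrix.sub_apply, Matrix.map_apply,
    Matrix.mul_apply, Matrix.neg_apply, map_neg, mul_neg, neg_mul, Finset.sum_add_distrib,
    Finset.sum_sub_distrib, Finset.sum_neg_distrib, e3, e4, e5] at hB
  simp only [divCurv, Finset.sum_add_distrib, Finset.sum_sub_distrib, e1, e2]
  rw [mul_sub, e6, e6, e7]
  linear_combination hB

lemma divCurv_delta (a c f : Fin n) (P : Fin n → Fin n → A) :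
    divCurv d G (fun a b c e => if a = c then P b e else 0) a c f =
      d a (P c f) - ∑ e, G a e c * P e f - ∑ e, G a e f * P c e := by
  simp only [divCurv, apply_ite (d _), map_zero, mul_ite, mul_zero, Finset.sum_sub_distrib,
    Finset.sum_add_distrib, Finset.sum_ite_eq, Finset.sum_ite_eq', Finset.mem_univ, if_true,
    Finset.sum_ite_irrel, Finset.sum_const_zero]
  ring

/-- The contracted Bianchi identity `∇_k W_{ac}{}^k{}_f = 2 (n - 2) Y_{acf}`. -/
lemma divCurv_wey (hn : 2 ≤ n) (hd : ∀ a b f, d a (d b f) = d b (d a f))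
    (hG : ∀ a b c, G a c b = G b c a) (a c f : Fin n) :
    divCurv d G (wey d G) a c f = 2 * ((n : A) - 2) * cott d G a c f := by
  have hadd : divCurv d G (wey d G) a c f =
      divCurv d G (fun a b c e => riem d G a b c e) a c f
      - divCurv d G (fun a b c e => if a = c then schou d G b e else 0) a c f
      + divCurv d G (fun a b c e => if a = c then schou d G b e else 0) c a f := by
    simp only [divCurv, wey, map_add, map_sub, mul_add, mul_sub, Finset.sum_add_distrib,
      Finset.sum_sub_distrib]
    ring
  rw [hadd, divCurv_riem hn hd hG, divCurv_delta, divCurv_delta]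
  change _ - dschou d G a c f + dschou d G c a f = _
  have h2 : (2 : A) * algebraMap ℝ A (1 / 2) = 1 := by
    rw [← map_ofNat (algebraMap ℝ A) 2, ← map_mul, mul_one_div_cancel two_ne_zero, map_one]
  rw [cott]
  linear_combination (-((n : A) - 2) * (dschou d G a c f - dschou d G c a f)) * h2

/-! ### The derivative of the scalar component -/

lemma wey_trace_left (hn : 2 ≤ n) (e f : Fin n) : ∑ b, wey d G b e b f = 0 := by
  simp only [wey, Finset.sum_add_distrib, Finset.sum_sub_distrib, if_true, Finset.sum_const,
    Finset.card_univ, Fintype.card_fin, nsmul_eq_mul, Finset.sum_ite_eq, Finset.mem_univ]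
  change ric d G e f - _ + _ = _
  rw [ric_eq_schou hn]
  ring

lemma wey_trace_middle (hn : 2 ≤ n) (a f : Fin n) : ∑ b, wey d G a b b f = 0 := by
  have h : ∑ b, riem d G a b b f = -ric d G a f := by
    rw [ric, ← Finset.sum_neg_distrib]
    exact Finset.sum_congr rfl fun k _ => by rw [riem_antisymm]; rfl
  simp only [wey, Finset.sum_add_distrib, Finset.sum_sub_distrib, if_true, Finset.sum_const,
    Finset.card_univ, Fintype.card_fin, nsmul_eq_mul, Finset.sum_ite_eq, Finset.mem_univ]
  rw [h, ric_eq_schou hn]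
  ring

lemma wey_trace_right (hG : ∀ a b c, G a c b = G b c a)
    (htr : ∀ a b, ∑ c, riem d G a b c c = 0) (a b : Fin n) : ∑ c, wey d G a b c c = 0 := by
  simp only [wey, Finset.sum_add_distrib, Finset.sum_sub_distrib, Finset.sum_ite_eq,
    Finset.mem_univ, if_true, htr]
  rw [schou_symm hG htr a b]
  ring

/-- The divergence of `W_{ae}{}^b{}_f σ^{ef}`: by trace-freeness of the Weyl tensor only the
derivative of the Weyl tensor contributes, and that is given by the contracted Bianchi identity. -/
lemma divg_wey (hn : 2 ≤ n) (hd : ∀ a b f, d a (d b f) = d b (d a f))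
    (hG : ∀ a b c, G a c b = G b c a) (htr : ∀ a b, ∑ c, riem d G a b c c = 0)
    {s : Fin n → Fin n → A} {mu : Fin n → A}
    (h : ∀ a b c, dbiv d G s a b c = (if a = b then mu c else 0) + if a = c then mu b else 0)
    (a : Fin n) :
    divg d G (fun b c => ∑ e, ∑ f, wey d G b e c f * s e f) a =
      2 * ((n : A) - 2) * ∑ e, ∑ f, cott d G a e f * s e f := by
  have h1 : ∑ b, ∑ e, ∑ f, wey d G a e b f * dbiv d G s b e f = 0 := by
    simp only [h, mul_add, mul_ite, mul_zero, Finset.sum_add_distrib, Finset.sum_ite_eq,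
      Finset.mem_univ, if_true, Finset.sum_ite_irrel, Finset.sum_const_zero]
    have z1 : ∑ b, ∑ f, wey d G a b b f * mu f = 0 := by
      rw [Finset.sum_comm]
      exact Finset.sum_eq_zero fun f _ => by rw [← Finset.sum_mul, wey_trace_middle hn, zero_mul]
    have z2 : ∑ b, ∑ e, wey d G a e b b * mu e = 0 := by
      rw [Finset.sum_comm]
      exact Finset.sum_eq_zero fun f _ => by
        rw [← Finset.sum_mul, wey_trace_right hG htr, zero_mul]
    rw [z1, z2, add_zero]
  have h2 : ∑ e, ∑ f, divCurv d G (wey d G) a e f * s e f =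
      ∑ b, ∑ e, ∑ f, (d b (wey d G a e b f) + ∑ g, G b b g * wey d G a e g f
        - ∑ g, G b g a * wey d G g e b f
        - ∑ g, G b g e * wey d G a g b f - ∑ g, G b g f * wey d G a e b g) * s e f := by
    simp only [divCurv, Finset.sum_mul]
    rw [Finset.sum_comm' (t' := Finset.univ) (s' := fun _ => Finset.univ) (by simp)]
    calc _ = ∑ f, ∑ b, ∑ e, (d b (wey d G a e b f) + ∑ g, G b b g * wey d G a e g f
        - ∑ g, G b g a * wey d G g e b f
        - ∑ g, G b g e * wey d G a g b f - ∑ g, G b g f * wey d G a e b g) * s e f :=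
          Finset.sum_congr rfl fun f _ => Finset.sum_comm
      _ = ∑ b, ∑ f, ∑ e, (d b (wey d G a e b f) + ∑ g, G b b g * wey d G a e g f
        - ∑ g, G b g a * wey d G g e b f
        - ∑ g, G b g e * wey d G a g b f - ∑ g, G b g f * wey d G a e b g) * s e f :=
          Finset.sum_comm
      _ = _ := Finset.sum_congr rfl fun b _ => Finset.sum_comm
  have h3 (b : Fin n) (T : Fin n → A) (W : Fin n → Fin n → Fin n → A) :
      ∑ g, T g * ∑ e, ∑ f, W g e f * s e f = ∑ e, ∑ f, (∑ g, T g * W g e f) * s e f := by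
    simp only [Finset.mul_sum, Finset.sum_mul]
    rw [Finset.sum_comm]
    refine Finset.sum_congr rfl fun e _ => ?_
    rw [Finset.sum_comm]
    exact Finset.sum_congr rfl fun f _ => Finset.sum_congr rfl fun g _ => by ring
  calc divg d G (fun b c => ∑ e, ∑ f, wey d G b e c f * s e f) a
      = ∑ e, ∑ f, divCurv d G (wey d G) a e f * s e f
        + ∑ b, ∑ e, ∑ f, wey d G a e b f * dbiv d G s b e f := by
        rw [h2, divg, ← Finset.sum_add_distrib]
        refine Finset.sum_congr rfl fun b _ => ?_
        rw [derivation_contraction, h3 b, h3 b (fun g => G b g a)]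
        simp only [sub_mul, add_mul, Finset.sum_add_distrib, Finset.sum_sub_distrib]
        ring
    _ = _ := by
        simp only [h1, add_zero, divCurv_wey hn hd hG, Finset.mul_sum]
        exact Finset.sum_congr rfl fun e _ => Finset.sum_congr rfl fun f _ => by ring

/-- The divergence of `P_{af} σ^{bf}`. -/
lemma divg_schou {s : Fin n → Fin n → A} {mu : Fin n → A}
    (h : ∀ a b c, dbiv d G s a b c = (if a = b then mu c else 0) + if a = c then mu b else 0)
    (a : Fin n) :
    divg d G (fun b c => ∑ f, schou d G b f * s c f) a =
      ∑ b, ∑ f, dschou d G b a f * s b f + ((n : A) + 1) * ∑ f, schou d G a f * mu f := by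
  have h1 : ∑ b, ∑ f, schou d G a f * dbiv d G s b b f
      = ((n : A) + 1) * ∑ f, schou d G a f * mu f := by
    simp only [h, mul_add, mul_ite, mul_zero, Finset.sum_add_distrib, Finset.sum_ite_eq,
      Finset.mem_univ, if_true, Finset.sum_const, Finset.card_univ, Fintype.card_fin,
      nsmul_eq_mul]
    ring
  rw [← h1, divg, ← Finset.sum_add_distrib]
  refine Finset.sum_congr rfl fun b _ => ?_
  simp only [dschou, dbiv, map_sum, Derivation.leibniz, smul_eq_mul, mul_add, sub_mul,
    Finset.sum_mul, Finset.mul_sum, Finset.sum_add_distrib, Finset.sum_sub_distrib]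
  have e1 : ∑ f, ∑ e, G b e a * schou d G e f * s b f
      = ∑ e, ∑ f, G b e a * (schou d G e f * s b f) := by
    rw [Finset.sum_comm]
    exact Finset.sum_congr rfl fun f _ => Finset.sum_congr rfl fun g _ => by ring
  have e2 : ∑ f, ∑ e, G b e f * schou d G a e * s b f
      = ∑ e, ∑ f, schou d G a e * (G b e f * s b f) := by
    rw [Finset.sum_comm]
    exact Finset.sum_congr rfl fun f _ => Finset.sum_congr rfl fun g _ => by ring
  have e3 : ∑ e, ∑ f, G b b e * (schou d G a f * s e f)
      = ∑ f, ∑ e, schou d G a f * (G b b e * s e f) := by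
    rw [Finset.sum_comm]
    exact Finset.sum_congr rfl fun f _ => Finset.sum_congr rfl fun g _ => by ring
  have e4 : ∑ f, s b f * d b (schou d G a f) = ∑ f, d b (schou d G a f) * s b f :=
    Finset.sum_congr rfl fun f _ => mul_comm _ _
  rw [e1, e2, e3, e4]
  ring

/-- The third prolonged equation `∇_a ρ = -2 P_{ab} μ^b + (4/n) Y_{abc} σ^{bc}`. -/
lemma derivation_rhoOf (hn : 2 ≤ n) (hd : ∀ a b f, d a (d b f) = d b (d a f))
    (hG : ∀ a b c, G a c b = G b c a) (htr : ∀ a b, ∑ c, riem d G a b c c = 0)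
    {s : Fin n → Fin n → A} {mu : Fin n → A} (hs : ∀ b c, s b c = s c b)
    (h : ∀ a b c, dbiv d G s a b c = (if a = b then mu c else 0) + if a = c then mu b else 0)
    (a : Fin n) :
    d a (rhoOf d G s mu) = -(2 * ∑ b, schou d G a b * mu b)
      + 4 * algebraMap ℝ A (1 / (n : ℝ)) * ∑ b, ∑ c, cott d G a b c * s b c := by
  have hmu : ∑ b, ((d a (dvec d G mu b b) + ∑ e, G a b e * dvec d G mu b e)
      - (d b (dvec d G mu a b) + ∑ e, G b b e * dvec d G mu a e))
      = -(((n : A) - 1) * ∑ e, schou d G a e * mu e) := by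
    simp only [integrability_mu hd]
    rw [Finset.sum_comm, Finset.mul_sum, ← Finset.sum_neg_distrib]
    refine Finset.sum_congr rfl fun e _ => ?_
    rw [← Finset.sum_mul, ← mul_assoc, ← ric_eq_schou hn, ric, ← neg_mul,
      ← Finset.sum_neg_distrib]
    congr 1
    exact Finset.sum_congr rfl fun k _ => by rw [riem_antisymm]; rfl
  rw [trace_skew_eq hG] at hmu
  have hQ := dvec_eq_of_dbiv_eq hn hd hG hs h
  set r := rhoOf d G s mu
  set i := algebraMap ℝ A (1 / (n : ℝ)) with hi
  have hdiv (Q₁ Q₂ : Fin n → Fin n → A)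
      (hQ : ∀ a b, dvec d G mu a b = (if a = b then r else 0) - Q₁ a b + i * Q₂ a b) :
      divg d G (dvec d G mu) a = d a r - divg d G Q₁ a + i * divg d G Q₂ a := by
    have hdi (b : Fin n) (x : A) : d b (i * x) = i * d b x := by
      rw [hi, ← Algebra.smul_def, Derivation.map_smul, Algebra.smul_def]
    simp only [divg, hQ, map_add, map_sub, hdi, mul_add, mul_sub, Finset.sum_add_distrib,
      Finset.sum_sub_distrib, mul_ite, mul_zero, apply_ite (d _), map_zero, Finset.sum_ite_eq,
      Finset.sum_ite_eq', Finset.mem_univ, if_true, Finset.mul_sum, mul_left_comm i]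
    ring
  have htrace : ∑ b, dvec d G mu b b = n * r - ∑ b, ∑ f, schou d G b f * s b f := by
    simp only [hQ, if_true, Finset.sum_add_distrib, Finset.sum_sub_distrib, Finset.sum_const,
      Finset.card_univ, Fintype.card_fin, nsmul_eq_mul, ← Finset.mul_sum]
    have z : ∑ b, ∑ e, ∑ f, wey d G b e b f * s e f = 0 := by
      rw [Finset.sum_comm]
      refine Finset.sum_eq_zero fun e _ => ?_
      rw [Finset.sum_comm]
      exact Finset.sum_eq_zero fun f _ => by rw [← Finset.sum_mul, wey_trace_left hn, zero_mul]
    rw [z]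
    ring
  have hP : d a (∑ b, ∑ f, schou d G b f * s b f) =
      ∑ b, ∑ f, dschou d G a b f * s b f + 2 * ∑ f, schou d G a f * mu f := by
    refine (derivation_contraction (G := G) s (schou d G) a).trans ?_
    simp only [h, mul_add, mul_ite, mul_zero, Finset.sum_add_distrib, Finset.sum_ite_eq,
      Finset.mem_univ, if_true, Finset.sum_ite_irrel, Finset.sum_const_zero]
    have e : ∑ e, schou d G e a * mu e = ∑ e, schou d G a e * mu e :=
      Finset.sum_congr rfl fun e _ => by rw [schou_symm hG htr]
    rw [e]
    change ∑ b, ∑ f, dschou d G a b f * s b f + _ = _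
    ring
  have hY : ∑ b, ∑ f, dschou d G a b f * s b f - ∑ b, ∑ f, dschou d G b a f * s b f
      = 2 * ∑ b, ∑ f, cott d G a b f * s b f := by
    have h2 : (2 : A) * algebraMap ℝ A (1 / 2) = 1 := by
      rw [← map_ofNat (algebraMap ℝ A) 2, ← map_mul, mul_one_div_cancel two_ne_zero, map_one]
    simp only [← Finset.sum_sub_distrib, Finset.mul_sum, cott]
    refine Finset.sum_congr rfl fun b _ => Finset.sum_congr rfl fun f _ => ?_
    linear_combination (-(dschou d G a b f - dschou d G b a f) * s b f) * h2
  rw [htrace, hdiv _ _ hQ, map_sub, hP, divg_schou h, divg_wey hn hd hG htr h, Derivation.leibniz,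
    Derivation.map_natCast] at hmu
  simp only [smul_eq_mul, mul_zero, add_zero] at hmu
  have hin := inv_natCast_mul (A := A) hn
  have hk : algebraMap ℝ A (1 / ((n : ℝ) - 1)) * ((n : A) - 1) = 1 := by
    have h1 : ((n : A) - 1) = algebraMap ℝ A ((n : ℝ) - 1) := by simp
    have h2 : ((n : ℝ) - 1) ≠ 0 := by
      have : (2 : ℝ) ≤ n := by exact_mod_cast hn
      linarith
    rw [h1, ← map_mul, one_div_mul_cancel h2, map_one]
  set k := algebraMap ℝ A (1 / ((n : ℝ) - 1))
  set Z := ∑ b, ∑ c, cott d G a b c * s b c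
  set Pm := ∑ b, schou d G a b * mu b
  linear_combination k * hmu + k * hY + (4 * i * Z - 2 * Pm - d a r) * hk - 2 * k * Z * hin

end Algebra

open Bundle FiberBundle Filter
open scoped Topology

/-! ### Frames near a point -/

section

section Extend

variable {B : Type*} {F₁ F₂ : Type*} {E₁ E₂ : B → Type*} [TopologicalSpace B]
  [∀ x, AddCommGroup (E₁ x)] [∀ x, Module ℝ (E₁ x)] [NormedAddCommGroup F₁] [NormedSpace ℝ F₁]
  [TopologicalSpace (TotalSpace F₁ E₁)] [∀ x, TopologicalSpace (E₁ x)]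
  [∀ x, AddCommGroup (E₂ x)]
  [∀ x, Module ℝ (E₂ x)] [NormedAddCommGroup F₂] [NormedSpace ℝ F₂]
  [TopologicalSpace (TotalSpace F₂ E₂)] [∀ x, TopologicalSpace (E₂ x)]
  [FiberBundle F₁ E₁] [VectorBundle ℝ F₁ E₁] [FiberBundle F₂ E₂] [VectorBundle ℝ F₂ E₂]

lemma extend_eq_symmL {c y : B} (v : E₁ c) (hy : y ∈ (trivializationAt F₁ E₁ c).baseSet) :
    extend F₁ v y = (trivializationAt F₁ E₁ c).symmL ℝ y
      ((trivializationAt F₁ E₁ c).continuousLinearMapAt ℝ c v) := by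
  have := FiberBundle.mem_baseSet_trivializationAt' (F := F₁) (E := E₁) c
  simp [extend, Trivialization.symmL_apply, hy, this, Trivialization.coe_linearMapAt_of_mem]

/-- Extension of vectors by local triviality commutes with the evaluation of homomorphisms. -/
lemma extend_clm_apply [∀ x, IsTopologicalAddGroup (E₂ x)] [∀ x, ContinuousSMul ℝ (E₂ x)]
    {c y : B} (φ : E₁ c →L[ℝ] E₂ c) (v : E₁ c)
    (h₁ : y ∈ (trivializationAt F₁ E₁ c).baseSet) (h₂ : y ∈ (trivializationAt F₂ E₂ c).baseSet) :
    extend (F₁ →L[ℝ] F₂) (E := fun x => E₁ x →L[ℝ] E₂ x) φ y (extend F₁ v y)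
      = extend F₂ (φ v) y := by
  have hc₁ := FiberBundle.mem_baseSet_trivializationAt' (F := F₁) (E := E₁) c
  have hc₂ := FiberBundle.mem_baseSet_trivializationAt' (F := F₂) (E := E₂) c
  rw [extend_eq_symmL v h₁, extend_eq_symmL (φ v) h₂]
  have : extend (F₁ →L[ℝ] F₂) (E := fun x => E₁ x →L[ℝ] E₂ x) φ y =
      ((trivializationAt F₂ E₂ c).symmL ℝ y).comp
        (((trivializationAt F₂ E₂ c).continuousLinearMapAt ℝ c).comp
          (φ.comp ((trivializationAt F₁ E₁ c).symmL ℝ c)) |>.comp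
            ((trivializationAt F₁ E₁ c).continuousLinearMapAt ℝ y)) := by
    rw [extend]
    exact Pretrivialization.continuousLinearMap_symm_apply' (RingHom.id ℝ) _ _ ⟨h₁, h₂⟩ _
  rw [this]
  simp [h₁, hc₁, hc₂, h₂]

lemma extend_trivial {c y : B} (r : ℝ) : extend ℝ (E := Bundle.Trivial B ℝ) (x := c) r y = r := by
  rw [extend_eq_symmL] <;> simp

end Extend

/-- The extension of a vector by local triviality is smooth on the whole domain of the
trivialization, not only near the base point. -/
lemma contMDiffAt_extend_of_mem {n : ℕ} {M : Type*} [TopologicalSpace M]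
    [ChartedSpace (Model n) M] {F : Type*} [NormedAddCommGroup F] [NormedSpace ℝ F]
    {V : M → Type*} [TopologicalSpace (TotalSpace F V)] [∀ x, AddCommGroup (V x)]
    [∀ x, Module ℝ (V x)] [∀ x, TopologicalSpace (V x)] [FiberBundle F V] [VectorBundle ℝ F V]
    [ContMDiffVectorBundle ∞ F V (𝓡 n)] {c y : M} (v : V c)
    (hy : y ∈ (trivializationAt F V c).baseSet) :
    ContMDiffAt (𝓡 n) ((𝓡 n).prod 𝓘(ℝ, F)) ∞ (fun z => TotalSpace.mk' F z (extend F v z)) y := by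
  set t := trivializationAt F V c
  rw [t.contMDiffAt_section_iff hy]
  have : ContMDiffAt (𝓡 n) 𝓘(ℝ, F) ∞ (fun _ : M => (t ⟨c, v⟩).2) y := contMDiffAt_const
  refine this.congr_of_eventuallyEq ?_
  filter_upwards [t.open_baseSet.mem_nhds hy] with z hz
  simp [extend, t, hz]

variable {n : ℕ} {M : Type*} [TopologicalSpace M] [ChartedSpace (Model n) M]
  [IsManifold (𝓡 n) ∞ M]

section Frames

variable {c y : M}

lemma extCov_extVec (hy : y ∈ (chartAt (Model n) c).source) (α : CotAt n c) (v : TanAt n c) :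
    extCov α y (extVec v y) = α v := by
  have h := extend_clm_apply (F₁ := Model n) (F₂ := ℝ) (E₁ := fun x : M => TanAt n x)
    (E₂ := Bundle.Trivial M ℝ) (c := c) (y := y) α v (by simpa using hy) (by simp)
  rw [extend_trivial] at h
  exact h

@[simp] lemma extVec_self (v : TanAt n c) : extVec v c = v := extend_apply_self _ v

@[simp] lemma extCov_self (α : CotAt n c) : extCov α c = α :=
  extend_apply_self (E := fun y : M => CotAt n y) _ α

lemma extVec_sum_smul (hy : y ∈ (chartAt (Model n) c).source) {ι : Type*} (s : Finset ι)
    (r : ι → ℝ) (v : ι → TanAt n c) :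
    extVec (∑ i ∈ s, r i • v i) y = ∑ i ∈ s, r i • extVec (v i) y := by
  have hy' : y ∈ (trivializationAt (Model n) (fun x : M => TanAt n x) c).baseSet := by
    simpa using hy
  simp only [extVec, extend_eq_symmL _ hy', map_sum, map_smul]

lemma exists_extVec_eq (hy : y ∈ (chartAt (Model n) c).source) (v : TanAt n y) :
    ∃ w : TanAt n c, extVec w y = v := by
  have hy' : y ∈ (trivializationAt (Model n) (fun x : M => TanAt n x) c).baseSet := by
    simpa using hy
  have hc := FiberBundle.mem_baseSet_trivializationAt' (F := Model n)
    (E := fun x : M => TanAt n x) c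
  refine ⟨(trivializationAt (Model n) (fun x : M => TanAt n x) c).symmL ℝ c
    ((trivializationAt (Model n) (fun x : M => TanAt n x) c).continuousLinearMapAt ℝ y v), ?_⟩
  rw [extVec, extend_eq_symmL _ hy', Trivialization.continuousLinearMapAt_symmL _ hc,
    Trivialization.symmL_continuousLinearMapAt _ hy']

variable (c) in
/-- The frame `e_i` of coordinate vector fields of the chart at `c`. -/
def locFrame (i : Fin n) (y : M) : TanAt n y := extVec (frame c i) y

variable (c) in
/-- The frame `e^i` of `1`-forms dual to `locFrame`. -/
def locCoframe (i : Fin n) (y : M) : CotAt n y := extCov (coframe c i) y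

lemma locFrame_self (i : Fin n) : locFrame c i c = frame c i := extVec_self _

lemma locCoframe_self (i : Fin n) : locCoframe c i c = coframe c i := extCov_self _

lemma locCoframe_locFrame (hy : y ∈ (chartAt (Model n) c).source) (i j : Fin n) :
    locCoframe c i y (locFrame c j y) = if i = j then 1 else 0 := by
  rw [locCoframe, locFrame, extCov_extVec hy, coframe_frame]

lemma sum_locCoframe_smul (hy : y ∈ (chartAt (Model n) c).source) (v : TanAt n y) :
    ∑ i, locCoframe c i y v • locFrame c i y = v := by
  obtain ⟨w, rfl⟩ := exists_extVec_eq hy v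
  simp only [locCoframe, locFrame, extCov_extVec hy, ← extVec_sum_smul hy,
    sum_coframe_smul_frame]

lemma sum_apply_locFrame_smul (hy : y ∈ (chartAt (Model n) c).source) (α : CotAt n y) :
    ∑ i, α (locFrame c i y) • locCoframe c i y = α := by
  ext v
  conv_rhs => rw [← sum_locCoframe_smul hy v, map_sum]
  simp [mul_comm]

/-- The contraction of a tensor does not depend on the frame. -/
lemma sum_frame_coframe (hy : y ∈ (chartAt (Model n) c).source) {V : Type*} [AddCommGroup V]
    [Module ℝ V] (T : TanAt n y → CotAt n y → V) (h₁ : ∀ α, IsLinearMap ℝ (T · α))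
    (h₂ : ∀ v, IsLinearMap ℝ (T v)) :
    ∑ i, T (frame y i) (coframe y i) = ∑ i, T (locFrame c i y) (locCoframe c i y) := by
  have e1 (i : Fin n) : T (frame y i) (coframe y i)
      = ∑ j, T (coframe y i (locFrame c j y) • frame y i) (locCoframe c j y) := by
    conv_lhs => rw [← sum_apply_locFrame_smul hy (coframe y i)]
    rw [← IsLinearMap.mk'_apply (h₂ _), map_sum]
    refine Finset.sum_congr rfl fun j _ => ?_
    rw [map_smul, IsLinearMap.mk'_apply, (h₁ _).map_smul]
  simp only [e1]
  rw [Finset.sum_comm]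
  refine Finset.sum_congr rfl fun j _ => ?_
  conv_rhs => rw [← sum_coframe_smul_frame y (locFrame c j y)]
  exact (map_sum (IsLinearMap.mk' _ (h₁ (locCoframe c j y))) _ _).symm

end Frames
end

/-! ### Smooth germs and coordinate derivatives -/

section

variable {n : ℕ} {M : Type*} [TopologicalSpace M] [ChartedSpace (Model n) M]

section Smooth

variable {y : M} {f g : M → ℝ}

variable (n) in
/-- The function `f` is smooth on a neighbourhood of `y`. (In Mathlib `ContMDiffAt` of order `∞`
does not give a neighbourhood on which all derivatives exist.) -/
def SmoothNear (f : M → ℝ) (y : M) : Prop := ∀ᶠ z in 𝓝 y, ContMDiffAt (𝓡 n) 𝓘(ℝ, ℝ) ∞ f z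

lemma SmoothNear.contMDiffAt (h : SmoothNear n f y) : ContMDiffAt (𝓡 n) 𝓘(ℝ, ℝ) ∞ f y :=
  h.self_of_nhds

lemma SmoothNear.mdifferentiableAt (h : SmoothNear n f y) :
    MDifferentiableAt (𝓡 n) 𝓘(ℝ, ℝ) f y := h.contMDiffAt.mdifferentiableAt (by simp)

lemma SmoothNear.eventually (h : SmoothNear n f y) : ∀ᶠ z in 𝓝 y, SmoothNear n f z :=
  eventually_eventually_nhds.2 h

lemma SmoothNear.congr (h : SmoothNear n f y) (hg : g =ᶠ[𝓝 y] f) : SmoothNear n g y := by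
  filter_upwards [h, eventually_eventually_nhds.2 hg] with z hz hz'
  exact hz.congr_of_eventuallyEq hz'

lemma SmoothNear.add (hf : SmoothNear n f y) (hg : SmoothNear n g y) :
    SmoothNear n (fun z => f z + g z) y := by
  filter_upwards [hf, hg] with z h₁ h₂ using h₁.add h₂

lemma SmoothNear.mul (hf : SmoothNear n f y) (hg : SmoothNear n g y) :
    SmoothNear n (fun z => f z * g z) y := by
  filter_upwards [hf, hg] with z h₁ h₂ using h₁.mul h₂

lemma smoothNear_const (r : ℝ) : SmoothNear n (fun _ : M => r) y :=
  Eventually.of_forall fun _ => contMDiffAt_const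

lemma SmoothNear.sum {ι : Type*} {s : Finset ι} {f : ι → M → ℝ}
    (h : ∀ i ∈ s, SmoothNear n (f i) y) : SmoothNear n (fun z => ∑ i ∈ s, f i z) y := by
  classical
  induction s using Finset.induction_on with
  | empty => simpa using smoothNear_const 0
  | insert a s ha ih =>
    simp only [Finset.sum_insert ha]
    exact (h a (by simp)).add (ih fun i hi => h i (by simp [hi]))

lemma dir_congr (h : f =ᶠ[𝓝 y] g) (u : TanAt n y) : dir f y u = dir g y u := by
  simp only [dir, mvfderiv, h.mfderiv_eq]
  rfl

lemma dir_const (r : ℝ) (u : TanAt n y) : dir (fun _ : M => r) y u = 0 := by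
  rw [dir, mvfderiv_const]
  rfl

lemma dir_fun_add (hf : MDifferentiableAt (𝓡 n) 𝓘(ℝ, ℝ) f y)
    (hg : MDifferentiableAt (𝓡 n) 𝓘(ℝ, ℝ) g y) (u : TanAt n y) :
    dir (fun z => f z + g z) y u = dir f y u + dir g y u := by
  simp [dir, mvfderiv_fun_add hf hg]

lemma dir_fun_mul (hf : MDifferentiableAt (𝓡 n) 𝓘(ℝ, ℝ) f y)
    (hg : MDifferentiableAt (𝓡 n) 𝓘(ℝ, ℝ) g y) (u : TanAt n y) :
    dir (fun z => f z * g z) y u = f y * dir g y u + g y * dir f y u := by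
  simp [dir, mvfderiv_fun_mul hf hg]

lemma mdifferentiableAt_sum' {ι : Type*} {s : Finset ι} {f : ι → M → ℝ}
    (h : ∀ i ∈ s, MDifferentiableAt (𝓡 n) 𝓘(ℝ, ℝ) (f i) y) :
    MDifferentiableAt (𝓡 n) 𝓘(ℝ, ℝ) (fun z => ∑ i ∈ s, f i z) y := by
  classical
  induction s using Finset.induction_on with
  | empty => simpa using mdifferentiableAt_const
  | insert a s ha ih =>
    simp only [Finset.sum_insert ha]
    exact (h a (by simp)).add (ih fun i hi => h i (by simp [hi]))

lemma dir_sum_smul (f : M → ℝ) {ι : Type*} (s : Finset ι) (r : ι → ℝ) (u : ι → TanAt n y) :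
    dir f y (∑ i ∈ s, r i • u i) = ∑ i ∈ s, r i * dir f y (u i) := by
  simp [dir]

end Smooth

section Chart

variable [IsManifold (𝓡 n) ∞ M] {c y : M} {f g : M → ℝ}

variable (c) in
/-- The partial derivative `∂_a f` in the chart at `c`. -/
def pd (a : Fin n) (f : M → ℝ) (y : M) : ℝ := dir f y (locFrame c a y)

omit [IsManifold (𝓡 n) ∞ M] in
lemma extChartAt_left_inv_of_mem (hy : y ∈ (chartAt (Model n) c).source) :
    (extChartAt (𝓡 n) c).symm (extChartAt (𝓡 n) c y) = y :=
  (extChartAt (𝓡 n) c).left_inv (by simpa using hy)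

lemma contMDiffAt_extChartAt_symm_of_mem (hy : y ∈ (chartAt (Model n) c).source) :
    ContMDiffAt 𝓘(ℝ, Model n) (𝓡 n) ∞ (extChartAt (𝓡 n) c).symm (extChartAt (𝓡 n) c y) :=
  (contMDiffOn_extChartAt_symm c).contMDiffAt
    (extChartAt_target_mem_nhds' ((extChartAt (𝓡 n) c).map_source (by simpa using hy)))

/-- The frame `locFrame` consists of the coordinate vector fields. -/
lemma locFrame_eq_mfderiv (hy : y ∈ (chartAt (Model n) c).source) (a : Fin n) :
    locFrame c a y = mfderiv 𝓘(ℝ, Model n) (𝓡 n) (extChartAt (𝓡 n) c).symm (extChartAt (𝓡 n) c y)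
      (EuclideanSpace.single a (1 : ℝ) : Model n) := by
  have hy' : y ∈ (trivializationAt (Model n) (fun x : M => TanAt n x) c).baseSet := by
    simpa using hy
  have : IsManifold (𝓡 n) 1 M := .of_le (n := ∞) (by simp)
  rw [locFrame, extVec, extend_eq_symmL _ hy', TangentBundle.symmL_trivializationAt hy,
    TangentBundle.continuousLinearMapAt_trivializationAt_eq_core (by simp)]
  simp only [modelWithCornersSelf_coe, Set.range_id, mfderivWithin_univ]
  congr 1
  exact (tangentBundleCore (𝓡 n) M).coordChange_self (achart (Model n) c) c (by simp) _

omit [IsManifold (𝓡 n) ∞ M] in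
lemma dir_mfderiv_apply {ψ : Model n → M} {p : Model n}
    (hψ : MDifferentiableAt 𝓘(ℝ, Model n) (𝓡 n) ψ p) (hy : ψ p = y)
    (hf : MDifferentiableAt (𝓡 n) 𝓘(ℝ, ℝ) f y) (v : Model n) :
    dir f y (mfderiv 𝓘(ℝ, Model n) (𝓡 n) ψ p v) = fderiv ℝ (f ∘ ψ) p v := by
  subst hy
  rw [← mfderiv_eq_fderiv, mfderiv_comp _ hf hψ]
  rfl

lemma pd_eq_fderiv (hy : y ∈ (chartAt (Model n) c).source)
    (hf : MDifferentiableAt (𝓡 n) 𝓘(ℝ, ℝ) f y) (a : Fin n) :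
    pd c a f y = fderiv ℝ (f ∘ (extChartAt (𝓡 n) c).symm) (extChartAt (𝓡 n) c y)
      (EuclideanSpace.single a (1 : ℝ)) := by
  have hs : MDifferentiableAt 𝓘(ℝ, Model n) (𝓡 n) (extChartAt (𝓡 n) c).symm
      (extChartAt (𝓡 n) c y) :=
    (contMDiffAt_extChartAt_symm_of_mem hy).mdifferentiableAt (by simp)
  rw [pd, locFrame_eq_mfderiv hy]
  exact dir_mfderiv_apply hs (extChartAt_left_inv_of_mem hy) hf _

/-- Read in the chart, a smooth germ is a smooth germ on the model space. -/
lemma SmoothNear.contDiffAt_chart (hy : y ∈ (chartAt (Model n) c).source)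
    (hf : SmoothNear n f y) :
    ContDiffAt ℝ ∞ (f ∘ (extChartAt (𝓡 n) c).symm) (extChartAt (𝓡 n) c y) := by
  rw [← contMDiffAt_iff_contDiffAt]
  refine ContMDiffAt.comp_of_eq ?_ (contMDiffAt_extChartAt_symm_of_mem hy)
    (extChartAt_left_inv_of_mem hy)
  exact hf.contMDiffAt

omit [IsManifold (𝓡 n) ∞ M] in
lemma eventually_mem_source (hy : y ∈ (chartAt (Model n) c).source) :
    ∀ᶠ z in 𝓝 y, z ∈ (chartAt (Model n) c).source :=
  (chartAt (Model n) c).open_source.mem_nhds hy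

lemma smoothNear_pd (hy : y ∈ (chartAt (Model n) c).source) (hf : SmoothNear n f y) (a : Fin n) :
    SmoothNear n (pd c a f) y := by
  filter_upwards [hf.eventually, eventually_mem_source hy] with z hz hzc
  have h1 : ContMDiffAt (𝓡 n) 𝓘(ℝ, ℝ) ∞
      (fun w => fderiv ℝ (f ∘ (extChartAt (𝓡 n) c).symm) (extChartAt (𝓡 n) c w)
        (EuclideanSpace.single a (1 : ℝ))) z := by
    have h2 : ContDiffAt ℝ ∞ (fun p => fderiv ℝ (f ∘ (extChartAt (𝓡 n) c).symm) p
        (EuclideanSpace.single a (1 : ℝ))) (extChartAt (𝓡 n) c z) :=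
      ((hz.contDiffAt_chart hzc).fderiv_right (m := ∞) (by simp)).clm_apply contDiffAt_const
    exact h2.contMDiffAt.comp z (contMDiffAt_extChartAt' hzc)
  refine h1.congr_of_eventuallyEq ?_
  filter_upwards [hz, eventually_mem_source hzc] with w hw hwc
  exact pd_eq_fderiv hwc (hw.mdifferentiableAt (by simp)) a

/-- Partial derivatives commute. -/
lemma pd_comm (hy : y ∈ (chartAt (Model n) c).source) (hf : SmoothNear n f y) (a b : Fin n) :
    pd c a (pd c b f) y
      = pd c b (pd c a f) y := by
  set φ := extChartAt (𝓡 n) c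
  have key (a b : Fin n) : pd c a (pd c b f) y =
      fderiv ℝ (fderiv ℝ (f ∘ φ.symm)) (φ y) (EuclideanSpace.single a (1 : ℝ))
        (EuclideanSpace.single b (1 : ℝ)) := by
    rw [pd_eq_fderiv hy (smoothNear_pd hy hf b).mdifferentiableAt]
    have h1 : (pd c b f ∘ φ.symm) =ᶠ[𝓝 (φ y)]
        fun p => fderiv ℝ (f ∘ φ.symm) p (EuclideanSpace.single b (1 : ℝ)) := by
      have hc : Tendsto φ.symm (𝓝 (φ y)) (𝓝 y) := by
        have := (contMDiffAt_extChartAt_symm_of_mem hy).continuousAt.tendsto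
        rwa [extChartAt_left_inv_of_mem hy] at this
      filter_upwards [hc.eventually hf, hc.eventually (eventually_mem_source hy),
        extChartAt_target_mem_nhds' (φ.map_source (by simpa [φ] using hy))] with p h1 h2 h3
      have := pd_eq_fderiv h2 (h1.mdifferentiableAt (by simp)) b
      rw [φ.right_inv h3] at this
      exact this
    rw [h1.fderiv_eq]
    have h2 : DifferentiableAt ℝ (fderiv ℝ (f ∘ φ.symm)) (φ y) :=
      ((hf.contDiffAt_chart hy).fderiv_right (m := 1) (by norm_cast)).differentiableAt (by simp)
    rw [fderiv_clm_apply h2 (differentiableAt_const _)]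
    simp
  rw [key, key]
  exact ((hf.contDiffAt_chart hy).isSymmSndFDerivAt (by simp; norm_cast)).eq _ _

end Chart
end

/-! ### The differential ring of smooth functions on a chart domain -/

section

variable {n : ℕ} {M : Type*} [TopologicalSpace M] [ChartedSpace (Model n) M]

section ChartRing

variable {c : M}

open Classical in
/-- Extension by zero of a function on the domain of the chart at `c`. -/
def extZero (f : (chartAt (Model n) c).source → ℝ) (z : M) : ℝ :=
  if h : z ∈ (chartAt (Model n) c).source then f ⟨z, h⟩ else 0

lemma extZero_of_mem (f : (chartAt (Model n) c).source → ℝ) {z : M}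
    (h : z ∈ (chartAt (Model n) c).source) : extZero f z = f ⟨z, h⟩ := dif_pos h

lemma extZero_eventuallyEq {f : (chartAt (Model n) c).source → ℝ} {F : M → ℝ} {y : M}
    (hy : y ∈ (chartAt (Model n) c).source)
    (h : ∀ z (hz : z ∈ (chartAt (Model n) c).source), f ⟨z, hz⟩ = F z) :
    extZero f =ᶠ[𝓝 y] F := by
  filter_upwards [eventually_mem_source hy] with z hz
  rw [extZero_of_mem f hz, h]

variable (n c) in
/-- The subalgebra of smooth functions on the domain of the chart at `c`. -/
def chartSubalgebra : Subalgebra ℝ ((chartAt (Model n) c).source → ℝ) where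
  carrier := {f | ∀ y ∈ (chartAt (Model n) c).source, SmoothNear n (extZero f) y}
  mul_mem' {f g} hf hg y hy := ((hf y hy).mul (hg y hy)).congr
    (extZero_eventuallyEq hy fun z hz => by simp [extZero_of_mem _ hz])
  add_mem' {f g} hf hg y hy := ((hf y hy).add (hg y hy)).congr
    (extZero_eventuallyEq hy fun z hz => by simp [extZero_of_mem _ hz])
  algebraMap_mem' r y hy := (smoothNear_const r).congr
    (extZero_eventuallyEq hy fun z hz => by simp)

variable (n c) in
/-- The algebra of smooth functions on the domain of the chart at `c`, as a type of its own. -/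
def chartRing : Type _ := chartSubalgebra n c

instance : CommRing (chartRing n c) := inferInstanceAs (CommRing (chartSubalgebra n c))

instance : Algebra ℝ (chartRing n c) := inferInstanceAs (Algebra ℝ (chartSubalgebra n c))

/-- The element of `chartRing` given by a function smooth on the domain of the chart. -/
def toChartRing (F : M → ℝ) (h : ∀ y ∈ (chartAt (Model n) c).source, SmoothNear n F y) :
    chartRing n c :=
  ⟨fun y => F y, fun y hy => (h y hy).congr (extZero_eventuallyEq hy fun _ _ => rfl)⟩

lemma smoothNear_extZero (f : chartRing n c) {y : M} (hy : y ∈ (chartAt (Model n) c).source) :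
    SmoothNear n (extZero f.1) y := f.2 y hy

/-- Evaluation at a point of the chart domain. -/
def evalAt {y : M} (hy : y ∈ (chartAt (Model n) c).source) : chartRing n c →ₐ[ℝ] ℝ :=
  (Pi.evalAlgHom ℝ (fun _ : (chartAt (Model n) c).source => ℝ) ⟨y, hy⟩).comp
    (chartSubalgebra n c).val

lemma chartRing_ext {f g : chartRing n c}
    (h : ∀ y (hy : y ∈ (chartAt (Model n) c).source), evalAt hy f = evalAt hy g) : f = g :=
  Subtype.ext (funext fun y => h y.1 y.2)

lemma evalAt_toChartRing {F : M → ℝ}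
    (h : ∀ y ∈ (chartAt (Model n) c).source, SmoothNear n F y) {y : M}
    (hy : y ∈ (chartAt (Model n) c).source) : evalAt hy (toChartRing F h) = F y := rfl

lemma extZero_eq_evalAt (f : chartRing n c) {y : M} (hy : y ∈ (chartAt (Model n) c).source) :
    extZero f.1 y = evalAt hy f := extZero_of_mem _ hy

lemma extZero_toChartRing {F : M → ℝ}
    (h : ∀ y ∈ (chartAt (Model n) c).source, SmoothNear n F y) {y : M}
    (hy : y ∈ (chartAt (Model n) c).source) : extZero (toChartRing F h).1 =ᶠ[𝓝 y] F :=
  extZero_eventuallyEq hy fun _ _ => rfl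

variable [IsManifold (𝓡 n) ∞ M]

variable (c) in
/-- The partial derivative, as a derivation of the algebra of smooth functions on the chart
domain. -/
def pdDer (a : Fin n) : Derivation ℝ (chartRing n c) (chartRing n c) :=
  Derivation.mk'
    { toFun := fun f => toChartRing (pd c a (extZero f.1)) fun _ hy =>
        smoothNear_pd hy (smoothNear_extZero f hy) a
      map_add' := fun f g => chartRing_ext fun y hy => by
        have h : extZero (f + g).1 =ᶠ[𝓝 y] fun z => extZero f.1 z + extZero g.1 z :=
          extZero_eventuallyEq hy fun z hz => by simp only [extZero_of_mem _ hz]; rfl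
        rw [map_add, evalAt_toChartRing, evalAt_toChartRing, evalAt_toChartRing, pd, dir_congr h,
          dir_fun_add (smoothNear_extZero f hy).mdifferentiableAt
            (smoothNear_extZero g hy).mdifferentiableAt]
        rfl
      map_smul' := fun r f => chartRing_ext fun y hy => by
        have h : extZero (r • f).1 =ᶠ[𝓝 y] fun z => r * extZero f.1 z :=
          extZero_eventuallyEq hy fun z hz => by simp only [extZero_of_mem _ hz]; rfl
        rw [map_smul, evalAt_toChartRing, evalAt_toChartRing, pd, dir_congr h,
          dir_fun_mul mdifferentiableAt_const (smoothNear_extZero f hy).mdifferentiableAt,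
          dir_const]
        simp [pd] }
    fun f g => chartRing_ext fun y hy => by
      have h : extZero (f * g).1 =ᶠ[𝓝 y] fun z => extZero f.1 z * extZero g.1 z :=
        extZero_eventuallyEq hy fun z hz => by simp only [extZero_of_mem _ hz]; rfl
      simp only [LinearMap.coe_mk, AddHom.coe_mk, smul_eq_mul, map_add, map_mul,
        evalAt_toChartRing]
      rw [pd, dir_congr h,
        dir_fun_mul (smoothNear_extZero f hy).mdifferentiableAt
            (smoothNear_extZero g hy).mdifferentiableAt, extZero_eq_evalAt f hy,
            extZero_eq_evalAt g hy]
      rfl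

lemma evalAt_pdDer_toChartRing (a : Fin n) {F : M → ℝ}
    (h : ∀ y ∈ (chartAt (Model n) c).source, SmoothNear n F y) {y : M}
    (hy : y ∈ (chartAt (Model n) c).source) :
    evalAt hy (pdDer c a (toChartRing F h)) = dir F y (locFrame c a y) :=
  dir_congr (extZero_toChartRing h hy) _

lemma pdDer_comm (a b : Fin n) (f : chartRing n c) :
    pdDer c a (pdDer c b f) = pdDer c b (pdDer c a f) := by
  refine chartRing_ext fun y hy => ?_
  have key (a b : Fin n) : evalAt hy (pdDer c a (pdDer c b f)) = pd c a (pd c b (extZero f.1)) y :=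
    dir_congr (extZero_eventuallyEq hy fun _ _ => rfl) _
  rw [key, key, pd_comm hy (smoothNear_extZero f hy)]

lemma dir_eq_sum_locFrame (f : M → ℝ) {y : M} (hy : y ∈ (chartAt (Model n) c).source)
    (u : TanAt n y) : dir f y u = ∑ a, locCoframe c a y u * dir f y (locFrame c a y) := by
  conv_lhs => rw [← sum_locCoframe_smul hy u, dir_sum_smul]

end ChartRing
end

/-! ### Christoffel symbols -/

section

variable {n : ℕ} {M : Type*} [TopologicalSpace M] [ChartedSpace (Model n) M]
  [IsManifold (𝓡 n) ∞ M] {c y : M}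

/-- The vector field `X` is smooth at `y`. -/
abbrev VecSmoothAt (X : ∀ z : M, TanAt n z) (y : M) : Prop :=
  ContMDiffAt (𝓡 n) ((𝓡 n).prod 𝓘(ℝ, Model n)) ∞ (fun z => TotalSpace.mk' (Model n) z (X z)) y

/-- The vector field `X` is differentiable at `y`. -/
abbrev VecDiffAt (X : ∀ z : M, TanAt n z) (y : M) : Prop :=
  MDifferentiableAt (𝓡 n) ((𝓡 n).prod 𝓘(ℝ, Model n)) (fun z => TotalSpace.mk' (Model n) z (X z)) y

/-- The `1`-form `α` is smooth at `y`. -/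
abbrev CovSmoothAt (α : ∀ z : M, CotAt n z) (y : M) : Prop :=
  ContMDiffAt (𝓡 n) ((𝓡 n).prod 𝓘(ℝ, Model n →L[ℝ] ℝ)) ∞
    (fun z => TotalSpace.mk' (Model n →L[ℝ] ℝ) (E := fun z : M => CotAt n z) z (α z)) y

/-- The `1`-form `α` is differentiable at `y`. -/
abbrev CovDiffAt (α : ∀ z : M, CotAt n z) (y : M) : Prop :=
  MDifferentiableAt (𝓡 n) ((𝓡 n).prod 𝓘(ℝ, Model n →L[ℝ] ℝ))
    (fun z => TotalSpace.mk' (Model n →L[ℝ] ℝ) (E := fun z : M => CotAt n z) z (α z)) y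

lemma VecSmoothAt.diff {X : ∀ z : M, TanAt n z} (h : VecSmoothAt X y) : VecDiffAt X y :=
  h.mdifferentiableAt (by simp)

lemma CovSmoothAt.diff {α : ∀ z : M, CotAt n z} (h : CovSmoothAt α y) : CovDiffAt α y :=
  h.mdifferentiableAt (by simp)

lemma vecSmoothAt_extVec (hy : y ∈ (chartAt (Model n) c).source) (v : TanAt n c) :
    VecSmoothAt (extVec v) y :=
  contMDiffAt_extend_of_mem (V := fun z : M => TanAt n z) v (by simpa using hy)

lemma covSmoothAt_extCov (hy : y ∈ (chartAt (Model n) c).source) (α : CotAt n c) :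
    CovSmoothAt (extCov α) y :=
  contMDiffAt_extend_of_mem (V := fun z : M => CotAt n z) α (by
    have : y ∈ (trivializationAt (Model n) (fun x : M => TanAt n x) c).baseSet := by simpa using hy
    exact ⟨this, Set.mem_univ _⟩)

lemma vecDiffAt_extVec (v : TanAt n y) : VecDiffAt (extVec v) y :=
  (vecSmoothAt_extVec (mem_chart_source _ _) v).diff

lemma covDiffAt_extCov (α : CotAt n y) : CovDiffAt (extCov α) y :=
  (covSmoothAt_extCov (mem_chart_source _ _) α).diff

lemma CovSmoothAt.apply {α : ∀ z : M, CotAt n z} {X : ∀ z : M, TanAt n z} (hα : CovSmoothAt α y)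
    (hX : VecSmoothAt X y) : ContMDiffAt (𝓡 n) 𝓘(ℝ, ℝ) ∞ (fun z => α z (X z)) y := by
  have h := ContMDiffAt.clm_bundle_apply (E₂ := Bundle.Trivial M ℝ) (ϕ := α) hα hX
  rw [contMDiffAt_section] at h
  simpa using h

lemma CovDiffAt.apply {α : ∀ z : M, CotAt n z} {X : ∀ z : M, TanAt n z} (hα : CovDiffAt α y)
    (hX : VecDiffAt X y) : MDifferentiableAt (𝓡 n) 𝓘(ℝ, ℝ) (fun z => α z (X z)) y := by
  have h := MDifferentiableAt.clm_bundle_apply (E₂ := Bundle.Trivial M ℝ) (ϕ := α) hα hX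
  rw [mdifferentiableAt_section] at h
  simpa using h

/-- A vector field which is smooth near `y` agrees near `y` with a global smooth vector field. -/
lemma exists_vectorField_eventuallyEq [T2Space M] {X : ∀ z : M, TanAt n z}
    (hX : ∀ᶠ z in 𝓝 y, VecSmoothAt X z) : ∃ Y : VectorField n M, ∀ᶠ z in 𝓝 y, Y z = X z := by
  obtain ⟨O, hO, hOo, hyO⟩ := eventually_nhds_iff.1 hX
  obtain ⟨f, -, hf⟩ := (SmoothBumpFunction.nhds_basis_tsupport (I := 𝓡 n) y).mem_iff.1
    (hOo.mem_nhds hyO)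
  refine ⟨⟨fun z => f z • X z, ?_⟩, ?_⟩
  · exact ContMDiffOn.smul_section_of_tsupport (f.contMDiff.contMDiffOn (s := O)) hOo hf
      fun z hz => (hO z hz).contMDiffWithinAt
  · filter_upwards [f.eventuallyEq_one] with z hz
    change f z • X z = X z
    rw [hz]
    simp

/-- Coordinate vector fields commute. -/
lemma mlieBracket_locFrame (hy : y ∈ (chartAt (Model n) c).source) (a b : Fin n) :
    VectorField.mlieBracket (𝓡 n) (locFrame c a) (locFrame c b) y = 0 := by
  have : IsManifold (𝓡 n) 1 M := .of_le (n := ∞) (by simp)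
  have hm : minSmoothness ℝ 2 ≤ ∞ := by
    rw [minSmoothness_of_isRCLikeNormedField]
    exact WithTop.coe_le_coe.2 (le_top (a := (2 : ℕ∞)))
  have : IsManifold (𝓡 n) (minSmoothness ℝ 2) M := .of_le (n := ∞) hm
  let V (i : Fin n) (p : Model n) : TangentSpace 𝓘(ℝ, Model n) p :=
    (EuclideanSpace.single i (1 : ℝ) : Model n)
  -- the coordinate fields are the pullbacks of the constant fields on the model space
  have hpull (i : Fin n) :
      locFrame c i =ᶠ[𝓝 y] VectorField.mpullback (𝓡 n) 𝓘(ℝ, Model n)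
        (extChartAt (𝓡 n) c) (V i) := by
    filter_upwards [eventually_mem_source hy] with z hz
    have hz' : z ∈ (extChartAt (𝓡 n) c).source := by simpa using hz
    rw [locFrame_eq_mfderiv hz, VectorField.mpullback_apply]
    have h1 := mfderiv_extChartAt_comp_mfderivWithin_extChartAt_symm' hz'
    have h2 := mfderivWithin_extChartAt_symm_comp_mfderiv_extChartAt' hz'
    rw [ContinuousLinearMap.inverse_eq h1 h2]
    simp only [modelWithCornersSelf_coe, Set.range_id, mfderivWithin_univ, V]
    rfl
  have hV (i : Fin n) (p : Model n) : MDifferentiableAt 𝓘(ℝ, Model n) (𝓘(ℝ, Model n).tangent)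
      (fun q => (⟨q, V i q⟩ : TangentBundle 𝓘(ℝ, Model n) (Model n))) p := by
    have h : ContMDiffAt 𝓘(ℝ, Model n) (𝓘(ℝ, Model n).tangent) 1
        (fun q => (⟨q, V i q⟩ : TangentBundle 𝓘(ℝ, Model n) (Model n))) p := by
      rw [contMDiffAt_vectorSpace_iff_contDiffAt]
      exact contDiffAt_const
    exact h.mdifferentiableAt (by simp)
  rw [(hpull a).mlieBracket_vectorField_eq (hpull b),
    ← VectorField.mpullback_mlieBracket (n := ∞) (hV a _) (hV b _) (contMDiffAt_extChartAt' hy)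
      hm]
  have : VectorField.mlieBracket 𝓘(ℝ, Model n) (V a) (V b) (extChartAt (𝓡 n) c y) = 0 := by
    rw [← VectorField.mlieBracketWithin_univ, VectorField.mlieBracketWithin_eq_lieBracketWithin,
      VectorField.lieBracketWithin_univ]
    simp only [VectorField.lieBracket, fderiv_fun_const]
    simp
    rfl
  rw [VectorField.mpullback_apply, this, map_zero]

variable (D : Connection n M)

lemma VecDiffAt.sum_smul {ι : Type*} {s : Finset ι} {f : ι → M → ℝ}
    {X : ι → ∀ z : M, TanAt n z} (hf : ∀ i ∈ s, MDifferentiableAt (𝓡 n) 𝓘(ℝ, ℝ) (f i) y)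
    (hX : ∀ i ∈ s, VecDiffAt (X i) y) : VecDiffAt (fun z => ∑ i ∈ s, f i z • X i z) y :=
  .sum_section fun i hi => (hf i hi).smul_section (hX i hi)

lemma connection_sum_smul {ι : Type*} {s : Finset ι} {f : ι → M → ℝ}
    {X : ι → ∀ z : M, TanAt n z} (hf : ∀ i ∈ s, MDifferentiableAt (𝓡 n) 𝓘(ℝ, ℝ) (f i) y)
    (hX : ∀ i ∈ s, VecDiffAt (X i) y) (u : TanAt n y) :
    D (fun z => ∑ i ∈ s, f i z • X i z) y u
      = ∑ i ∈ s, (f i y • D (X i) y u + dir (f i) y u • X i y) := by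
  classical
  induction s using Finset.induction_on with
  | empty =>
    simp only [Finset.sum_empty]
    have := D.isCovariantDerivativeOnUniv.zero (x := y)
    exact congrArg (fun L => L u) this
  | insert a s ha ih =>
    simp only [Finset.sum_insert ha]
    rw [← ih (fun i hi => hf i (by simp [hi])) (fun i hi => hX i (by simp [hi]))]
    have h1 := D.isCovariantDerivativeOnUniv.add (x := y)
      ((hf a (by simp)).smul_section (hX a (by simp)))
      (VecDiffAt.sum_smul (s := s) (fun i hi => hf i (by simp [hi]))
        (fun i hi => hX i (by simp [hi])))
    have h2 := D.isCovariantDerivativeOnUniv.leibniz (x := y) (hX a (by simp)) (hf a (by simp))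
    have h1 := congrArg (fun L => L u) h1
    refine h1.trans ?_
    rw [add_apply]
    congr 1
    exact congrArg (fun L => L u) h2

lemma connection_congr {X Y : ∀ z : M, TanAt n z} (hX : VecDiffAt X y) (hY : VecDiffAt Y y)
    (h : ∀ᶠ z in 𝓝 y, X z = Y z) : D X y = D Y y :=
  D.isCovariantDerivativeOnUniv.congr_of_eventuallyEq hX hY univ_mem h

lemma vecSmoothAt_locFrame (hy : y ∈ (chartAt (Model n) c).source) (i : Fin n) :
    VecSmoothAt (locFrame c i) y := vecSmoothAt_extVec hy _

lemma covSmoothAt_locCoframe (hy : y ∈ (chartAt (Model n) c).source) (i : Fin n) :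
    CovSmoothAt (locCoframe c i) y := covSmoothAt_extCov hy _

/-- The derivative of a vector field in terms of the derivatives of its components. -/
lemma connection_eq_sum (hy : y ∈ (chartAt (Model n) c).source) {X : ∀ z : M, TanAt n z}
    (hX : VecDiffAt X y) (u : TanAt n y) :
    D X y u = ∑ b, (locCoframe c b y (X y) • D (locFrame c b) y u
      + dir (fun z => locCoframe c b z (X z)) y u • locFrame c b y) := by
  have hf (i : Fin n) := (covSmoothAt_locCoframe hy i).diff.apply hX
  have he (i : Fin n) := (vecSmoothAt_locFrame hy i).diff
  rw [← connection_sum_smul D (fun i _ => hf i) (fun i _ => he i)]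
  rw [connection_congr D hX (VecDiffAt.sum_smul (fun i _ => hf i) (fun i _ => he i))]
  filter_upwards [eventually_mem_source hy] with z hz
  rw [sum_locCoframe_smul hz]

variable (c) in
/-- The Christoffel symbols `Γ^k_{ab}` in the chart at `c`. -/
def chris (a k b : Fin n) (y : M) : ℝ :=
  locCoframe c k y (D (locFrame c b) y (locFrame c a y))

variable {D}

/-- A smooth connection sends fields smooth near a point to fields smooth near that point. -/
lemma contMDiffAt_connection [T2Space M] (hD : D.ContMDiffCovariantDerivative ∞)
    {X : ∀ z : M, TanAt n z} (hX : ∀ᶠ z in 𝓝 y, VecSmoothAt X z) :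
    ContMDiffAt (𝓡 n) ((𝓡 n).prod 𝓘(ℝ, Model n →L[ℝ] Model n)) ∞
      (fun z => TotalSpace.mk' (Model n →L[ℝ] Model n) (E := fun z : M => TanAt n z →L[ℝ] TanAt n z)
        z (D X z)) y := by
  obtain ⟨Y, hY⟩ := exists_vectorField_eventuallyEq hX
  have h1 := hD.contMDiff.contMDiff (σ := fun z => Y z)
    (by simpa using! Y.contMDiff.contMDiffOn (s := Set.univ))
  have h2 := (h1 y (Set.mem_univ _)).contMDiffAt univ_mem
  refine h2.congr_of_eventuallyEq ?_
  filter_upwards [hX, eventually_eventually_nhds.2 hY] with z hz hz'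
  rw [connection_congr D hz.diff Y.mdifferentiableAt (hz'.mono fun _ h => h.symm)]

lemma smoothNear_chris [T2Space M] (hD : D.ContMDiffCovariantDerivative ∞)
    (hy : y ∈ (chartAt (Model n) c).source) (a k b : Fin n) :
    SmoothNear n (chris c D a k b) y := by
  filter_upwards [eventually_mem_source hy] with z hz
  refine (covSmoothAt_locCoframe hz k).apply ?_
  refine ContMDiffAt.clm_bundle_apply (contMDiffAt_connection hD ?_) (vecSmoothAt_locFrame hz a)
  filter_upwards [eventually_mem_source hz] with w hw using vecSmoothAt_locFrame hw b

/-- Torsion-freeness for coordinate vector fields. -/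
lemma connection_locFrame_symm (hT : D.torsion = 0) (hy : y ∈ (chartAt (Model n) c).source)
    (a b : Fin n) :
    D (locFrame c b) y (locFrame c a y) = D (locFrame c a) y (locFrame c b y) := by
  have := D.torsion_eq_zero_iff.1 hT (vecSmoothAt_locFrame hy a).diff
    (vecSmoothAt_locFrame hy b).diff
  rw [mlieBracket_locFrame hy] at this
  exact sub_eq_zero.1 this

lemma chris_symm (hT : D.torsion = 0) (hy : y ∈ (chartAt (Model n) c).source) (a k b : Fin n) :
    chris c D a k b y = chris c D b k a y := by
  rw [chris, connection_locFrame_symm hT hy, chris]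

lemma connection_locFrame (hy : y ∈ (chartAt (Model n) c).source) (a b : Fin n) :
    D (locFrame c b) y (locFrame c a y) = ∑ k, chris c D a k b y • locFrame c k y :=
  (sum_locCoframe_smul hy _).symm

end

/-! ### Covariant derivatives of covectors and contravariant 2-tensors in components -/

section

variable {n : ℕ} {M : Type*} [TopologicalSpace M] [ChartedSpace (Model n) M]
  [IsManifold (𝓡 n) ∞ M] {c y : M}

section Tensorial

variable {A : Type*} [AddCommGroup A] [Module ℝ A]

/-- An operation on vector fields which is tensorial at `y` is determined by its values on a
frame. -/
lemma tensorialAt_eq_sum_locFrame (hy : y ∈ (chartAt (Model n) c).source)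
    {Φ : (∀ z : M, TanAt n z) → A} (hΦ : TensorialAt (𝓡 n) (Model n) Φ y)
    {X : ∀ z : M, TanAt n z} (hX : VecDiffAt X y) :
    Φ X = ∑ a, locCoframe c a y (X y) • Φ (locFrame c a) := by
  have : IsManifold (𝓡 n) 1 M := .of_le (n := ∞) (by simp)
  have hf (a : Fin n) := (covSmoothAt_locCoframe hy a).diff.apply hX
  have he (a : Fin n) := (vecSmoothAt_locFrame hy a).diff
  rw [hΦ.pointwise hX (VecDiffAt.sum_smul (s := Finset.univ) (fun a _ => hf a) (fun a _ => he a))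
    (sum_locCoframe_smul hy _).symm, hΦ.sum]
  · exact Finset.sum_congr rfl fun a _ => hΦ.smul (hf a) (he a)
  · exact fun a _ => (hf a).smul_section (he a)

/-- An operation on `1`-forms which is tensorial at `y` is determined by its values on a
coframe. -/
lemma tensorialAt_eq_sum_locCoframe (hy : y ∈ (chartAt (Model n) c).source)
    {Φ : (∀ z : M, CotAt n z) → A}
    (hΦ : TensorialAt (𝓡 n) (Model n →L[ℝ] ℝ) (V := fun z : M => CotAt n z) Φ y)
    {α : ∀ z : M, CotAt n z} (hα : CovDiffAt α y) :
    Φ α = ∑ a, α y (locFrame c a y) • Φ (locCoframe c a) := by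
  have : IsManifold (𝓡 n) 1 M := .of_le (n := ∞) (by simp)
  have hf (a : Fin n) := hα.apply (vecSmoothAt_locFrame hy a).diff
  have he (a : Fin n) := (covSmoothAt_locCoframe hy a).diff
  rw [hΦ.pointwise hα (.sum_section (s := Finset.univ) fun a _ => (hf a).smul_section (he a))
    (sum_apply_locFrame_smul hy _).symm, hΦ.sum]
  · exact Finset.sum_congr rfl fun a _ => hΦ.smul (hf a) (he a)
  · exact fun a _ => (hf a).smul_section (he a)

end Tensorial

variable (D : Connection n M)

lemma connection_add {X Y : ∀ z : M, TanAt n z} (hX : VecDiffAt X y) (hY : VecDiffAt Y y)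
    (u : TanAt n y) : D (X + Y) y u = D X y u + D Y y u :=
  congrArg (fun L => L u) (D.isCovariantDerivativeOnUniv.add (x := y) hX hY)

lemma connection_smul {f : M → ℝ} {X : ∀ z : M, TanAt n z}
    (hf : MDifferentiableAt (𝓡 n) 𝓘(ℝ, ℝ) f y) (hX : VecDiffAt X y) (u : TanAt n y) :
    D (f • X) y u = f y • D X y u + dir f y u • X y :=
  congrArg (fun L => L u) (D.isCovariantDerivativeOnUniv.leibniz (x := y) hX hf)

/-- The defining property of the derivative of a `1`-form, for an arbitrary vector field `X`. -/
lemma covectorDeriv_apply {α : ∀ z : M, CotAt n z} (hα : CovDiffAt α y) {X : ∀ z : M, TanAt n z}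
    (hX : VecDiffAt X y) (u : TanAt n y) :
    covectorDeriv D α y u (X y) = dir (fun z => α z (X z)) y u - α y (D X y u) := by
  have hΦ : TensorialAt (𝓡 n) (Model n)
      (fun X : ∀ z : M, TanAt n z => dir (fun z => α z (X z)) y u - α y (D X y u)) y := by
    constructor
    · intro f X hf hX
      have : (fun z => α z ((f • X) z)) = fun z => f z * α z (X z) := by
        ext z; simp
      rw [this, dir_fun_mul hf (hα.apply hX), connection_smul D hf hX]
      simp
      ring
    · intro X Y hX hY
      have : (fun z => α z ((X + Y) z)) = fun z => α z (X z) + α z (Y z) := by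
        ext z; simp
      rw [this, dir_fun_add (hα.apply hX) (hα.apply hY), connection_add D hX hY]
      simp
      ring
  have h1 := tensorialAt_eq_sum_locFrame (mem_chart_source (Model n) y) hΦ hX
  simp only [locCoframe_self] at h1
  rw [h1, covectorDeriv]
  simp only [sum_apply, smul_apply, smul_eq_mul]
  exact Finset.sum_congr rfl fun i _ => mul_comm _ _

lemma covectorDeriv_add {α β : ∀ z : M, CotAt n z} (hα : CovDiffAt α y) (hβ : CovDiffAt β y)
    (u : TanAt n y) :
    covectorDeriv D (α + β) y u = covectorDeriv D α y u + covectorDeriv D β y u := by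
  simp only [covectorDeriv, ← Finset.sum_add_distrib, ← add_smul]
  refine Finset.sum_congr rfl fun i _ => ?_
  congr 1
  have : (fun z => (α + β) z (extVec (frame y i) z))
      = fun z => α z (extVec (frame y i) z) + β z (extVec (frame y i) z) := by ext z; simp
  rw [this, dir_fun_add (hα.apply (vecDiffAt_extVec _)) (hβ.apply (vecDiffAt_extVec _))]
  simp
  ring

lemma covectorDeriv_smul {f : M → ℝ} {α : ∀ z : M, CotAt n z}
    (hf : MDifferentiableAt (𝓡 n) 𝓘(ℝ, ℝ) f y) (hα : CovDiffAt α y) (u : TanAt n y) :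
    covectorDeriv D (f • α) y u = f y • covectorDeriv D α y u + dir f y u • α y := by
  have h : dir f y u • α y = ∑ i, (dir f y u * α y (frame y i)) • coframe y i := by
    conv_lhs => rw [← sum_apply_locFrame_smul (mem_chart_source (Model n) y) (α y),
      Finset.smul_sum]
    simp only [locFrame_self, locCoframe_self, smul_smul]
  rw [h]
  simp only [covectorDeriv, Finset.smul_sum, ← Finset.sum_add_distrib, smul_smul, ← add_smul]
  refine Finset.sum_congr rfl fun i _ => ?_
  congr 1
  have : (fun z => (f • α) z (extVec (frame y i) z))
      = fun z => f z * α z (extVec (frame y i) z) := by ext z; simp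
  rw [this, dir_fun_mul hf (hα.apply (vecDiffAt_extVec _))]
  simp
  ring

/-- The dual frame satisfies `∇_u e^k = -Γ^k_{ab} u^a e^b`. -/
lemma covectorDeriv_locCoframe (hy : y ∈ (chartAt (Model n) c).source) (k : Fin n)
    (u : TanAt n y) :
    covectorDeriv D (locCoframe c k) y u
      = -∑ b, (∑ a, locCoframe c a y u * chris c D a k b y) • locCoframe c b y := by
  conv_lhs => rw [← sum_apply_locFrame_smul hy (covectorDeriv D (locCoframe c k) y u)]
  rw [← Finset.sum_neg_distrib]
  refine Finset.sum_congr rfl fun b _ => ?_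
  rw [← neg_smul]
  congr 1
  rw [covectorDeriv_apply D (covSmoothAt_locCoframe hy k).diff (vecSmoothAt_locFrame hy b).diff]
  have h : dir (fun z => locCoframe c k z (locFrame c b z)) y u = 0 := by
    rw [dir_congr (g := fun _ => if k = b then 1 else 0), dir_const]
    filter_upwards [eventually_mem_source hy] with z hz using locCoframe_locFrame hz k b
  rw [h, zero_sub]
  congr 1
  conv_lhs => rw [← sum_locCoframe_smul hy u]
  simp [chris]

/-- The contravariant `2`-tensor field `σ` is smooth at `y`. -/
abbrev BivSmoothAt (σ : ∀ z : M, BivAt n z) (y : M) : Prop :=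
  ContMDiffAt (𝓡 n) ((𝓡 n).prod 𝓘(ℝ, (Model n →L[ℝ] ℝ) →L[ℝ] (Model n →L[ℝ] ℝ) →L[ℝ] ℝ)) ∞
    (fun z => TotalSpace.mk' ((Model n →L[ℝ] ℝ) →L[ℝ] (Model n →L[ℝ] ℝ) →L[ℝ] ℝ)
      (E := fun z : M => BivAt n z) z (σ z)) y

/-- The contravariant `2`-tensor field `σ` is differentiable at `y`. -/
abbrev BivDiffAt (σ : ∀ z : M, BivAt n z) (y : M) : Prop :=
  MDifferentiableAt (𝓡 n)
    ((𝓡 n).prod 𝓘(ℝ, (Model n →L[ℝ] ℝ) →L[ℝ] (Model n →L[ℝ] ℝ) →L[ℝ] ℝ))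
    (fun z => TotalSpace.mk' ((Model n →L[ℝ] ℝ) →L[ℝ] (Model n →L[ℝ] ℝ) →L[ℝ] ℝ)
      (E := fun z : M => BivAt n z) z (σ z)) y

lemma BivSmoothAt.diff {σ : ∀ z : M, BivAt n z} (h : BivSmoothAt σ y) : BivDiffAt σ y :=
  h.mdifferentiableAt (by simp)

lemma BivSmoothAt.apply {σ : ∀ z : M, BivAt n z} (hσ : BivSmoothAt σ y)
    {α β : ∀ z : M, CotAt n z} (hα : CovSmoothAt α y) (hβ : CovSmoothAt β y) :
    ContMDiffAt (𝓡 n) 𝓘(ℝ, ℝ) ∞ (fun z => σ z (α z) (β z)) y := by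
  have h := ContMDiffAt.clm_bundle_apply₂ (E₃ := Bundle.Trivial M ℝ)
    (E₁ := fun z : M => CotAt n z) (E₂ := fun z : M => CotAt n z) (ψ := σ) hσ hα hβ
  rw [contMDiffAt_section] at h
  simpa using h

lemma BivDiffAt.apply {σ : ∀ z : M, BivAt n z} (hσ : BivDiffAt σ y)
    {α β : ∀ z : M, CotAt n z} (hα : CovDiffAt α y) (hβ : CovDiffAt β y) :
    MDifferentiableAt (𝓡 n) 𝓘(ℝ, ℝ) (fun z => σ z (α z) (β z)) y := by
  have h := MDifferentiableAt.clm_bundle_apply₂ (E₃ := Bundle.Trivial M ℝ)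
    (E₁ := fun z : M => CotAt n z) (E₂ := fun z : M => CotAt n z) (ψ := σ) hσ hα hβ
  rw [mdifferentiableAt_section] at h
  simpa using h

variable (c) in
/-- The components `σ^{bc}` in the chart at `c`. -/
def bivComp (σ : ∀ z : M, BivAt n z) (i j : Fin n) (y : M) : ℝ :=
  σ y (locCoframe c i y) (locCoframe c j y)

lemma biv_eq_sum (hy : y ∈ (chartAt (Model n) c).source) (σ : ∀ z : M, BivAt n z)
    (α β : CotAt n y) :
    σ y α β = ∑ i, ∑ j, α (locFrame c i y) * β (locFrame c j y) * bivComp c σ i j y := by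
  conv_lhs => rw [← sum_apply_locFrame_smul hy α, ← sum_apply_locFrame_smul hy β]
  simp only [map_sum, map_smul, sum_apply, smul_apply,
    smul_eq_mul, Finset.mul_sum, bivComp]
  rw [Finset.sum_comm]
  exact Finset.sum_congr rfl fun i _ => Finset.sum_congr rfl fun j _ => by ring

/-- The derivative of a contravariant `2`-tensor in components:
`∇_a σ^{ij} = ∂_a σ^{ij} + Γ^i_{ae} σ^{ej} + Γ^j_{ae} σ^{ie}`. -/
lemma bivectorDeriv_eq_sum (hy : y ∈ (chartAt (Model n) c).source) {σ : ∀ z : M, BivAt n z}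
    (hσ : BivDiffAt σ y) (u : TanAt n y) (α β : CotAt n y) :
    bivectorDeriv D σ y u α β = ∑ i, ∑ j, α (locFrame c i y) * (β (locFrame c j y) *
      ∑ a, locCoframe c a y u * (dir (bivComp c σ i j) y (locFrame c a y)
        + ∑ e, chris c D a i e y * bivComp c σ e j y
        + ∑ e, chris c D a j e y * bivComp c σ i e y)) := by
  let Ψ (α β : ∀ z : M, CotAt n z) : ℝ := dir (fun z => σ z (α z) (β z)) y u
    - σ y (covectorDeriv D α y u) (β y) - σ y (α y) (covectorDeriv D β y u)
  have h₁ (β : ∀ z : M, CotAt n z) (hβ : CovDiffAt β y) :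
      TensorialAt (𝓡 n) (Model n →L[ℝ] ℝ) (V := fun z : M => CotAt n z) (Ψ · β) y := by
    constructor
    · intro f α hf hα
      have : (fun z => σ z ((f • α) z) (β z)) = fun z => f z * σ z (α z) (β z) := by
        ext z; simp
      simp only [Ψ]
      rw [this, dir_fun_mul hf (hσ.apply hα hβ), covectorDeriv_smul D hf hα]
      simp
      ring
    · intro α α' hα hα'
      have : (fun z => σ z ((α + α') z) (β z)) = fun z => σ z (α z) (β z) + σ z (α' z) (β z) := by
        ext z; simp
      simp only [Ψ]
      rw [this, dir_fun_add (hσ.apply hα hβ) (hσ.apply hα' hβ), covectorDeriv_add D hα hα']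
      simp
      ring
  have h₂ (α : ∀ z : M, CotAt n z) (hα : CovDiffAt α y) :
      TensorialAt (𝓡 n) (Model n →L[ℝ] ℝ) (V := fun z : M => CotAt n z) (Ψ α ·) y := by
    constructor
    · intro f β hf hβ
      have : (fun z => σ z (α z) ((f • β) z)) = fun z => f z * σ z (α z) (β z) := by
        ext z; simp
      simp only [Ψ]
      rw [this, dir_fun_mul hf (hσ.apply hα hβ), covectorDeriv_smul D hf hβ]
      simp
      ring
    · intro β β' hβ hβ'
      have : (fun z => σ z (α z) ((β + β') z)) = fun z => σ z (α z) (β z) + σ z (α z) (β' z) := by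
        ext z; simp
      simp only [Ψ]
      rw [this, dir_fun_add (hσ.apply hα hβ) (hσ.apply hα hβ'), covectorDeriv_add D hβ hβ']
      simp
      ring
  have h3 : bivectorDeriv D σ y u α β = Ψ (extCov α) (extCov β) := by
    simp [bivectorDeriv, Ψ]
  rw [h3, tensorialAt_eq_sum_locCoframe hy (h₁ _ (covDiffAt_extCov β)) (covDiffAt_extCov α)]
  simp only [extCov_self, smul_eq_mul]
  refine Finset.sum_congr rfl fun i _ => ?_
  rw [tensorialAt_eq_sum_locCoframe hy (h₂ _ (covSmoothAt_locCoframe hy i).diff)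
    (covDiffAt_extCov β), Finset.mul_sum]
  refine Finset.sum_congr rfl fun j _ => ?_
  rw [extCov_self, smul_eq_mul]
  congr 2
  simp only [Ψ, covectorDeriv_locCoframe D hy]
  rw [show (fun z => σ z (locCoframe c i z) (locCoframe c j z)) = bivComp c σ i j from rfl,
    dir_eq_sum_locFrame _ hy]
  simp only [map_neg, map_sum, map_smul, neg_apply,
    sum_apply, smul_apply, smul_eq_mul, sub_neg_eq_add,
    mul_add, Finset.sum_add_distrib, Finset.sum_mul, Finset.mul_sum]
  congr 1
  · congr 1
    rw [Finset.sum_comm]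
    exact Finset.sum_congr rfl fun a _ => Finset.sum_congr rfl fun e _ => mul_assoc _ _ _
  · rw [Finset.sum_comm]
    exact Finset.sum_congr rfl fun a _ => Finset.sum_congr rfl fun e _ => mul_assoc _ _ _

end

/-! ### The curvature in components -/

section

variable {n : ℕ} {M : Type*} [TopologicalSpace M] [ChartedSpace (Model n) M]
  [IsManifold (𝓡 n) ∞ M] {c y : M} {D : Connection n M}

lemma vecDiffAt_connection_apply [T2Space M] (hD : D.ContMDiffCovariantDerivative ∞)
    {W X : ∀ z : M, TanAt n z} (hW : ∀ᶠ z in 𝓝 y, VecSmoothAt W z) (hX : VecDiffAt X y) :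
    VecDiffAt (fun z => D W z (X z)) y :=
  MDifferentiableAt.clm_bundle_apply (E₁ := fun z : M => TanAt n z)
    (E₂ := fun z : M => TanAt n z) (ϕ := fun z => D W z)
    ((contMDiffAt_connection hD hW).mdifferentiableAt (by simp)) hX

variable (D) in
/-- The curvature `∇_U ∇_V W - ∇_V ∇_U W - ∇_{[U,V]} W` at `y`. -/
def curvOp (y : M) (U V W : ∀ z : M, TanAt n z) : TanAt n y :=
  D (fun z => D W z (V z)) y (U y) - D (fun z => D W z (U z)) y (V y)
    - D W y (VectorField.mlieBracket (𝓡 n) U V y)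

lemma curvOp_swap (U V W : ∀ z : M, TanAt n z) : curvOp D y U V W = -curvOp D y V U W := by
  rw [curvOp, curvOp, VectorField.mlieBracket_swap_apply, map_neg]
  abel

lemma tensorialAt_curvOp [T2Space M] (hD : D.ContMDiffCovariantDerivative ∞)
    {V W : ∀ z : M, TanAt n z} (hW : ∀ᶠ z in 𝓝 y, VecSmoothAt W z) :
    TensorialAt (𝓡 n) (Model n) (curvOp D y · V W) y := by
  have : IsManifold (𝓡 n) (minSmoothness ℝ 2) M := by
    rw [minSmoothness_of_isRCLikeNormedField]
    exact .of_le (n := ∞) (WithTop.coe_le_coe.2 (le_top (a := (2 : ℕ∞))))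
  constructor
  · intro f U hf hU
    have h1 : (fun z => D W z ((f • U) z)) = f • fun z => D W z (U z) := by
      ext1 z
      simp
    have h2 := VectorField.mlieBracket_smul_left (I := 𝓡 n) (W := V) hf hU
    simp only [curvOp]
    rw [h1, connection_smul D hf (vecDiffAt_connection_apply hD hW hU), h2]
    simp only [Pi.smul_apply', map_smul, map_add, map_neg, neg_smul, dir]
    module
  · intro U U' hU hU'
    have h1 : (fun z => D W z ((U + U') z)) = (fun z => D W z (U z)) + fun z => D W z (U' z) := by
      ext1 z
      simp
    have h2 := VectorField.mlieBracket_add_left (I := 𝓡 n) (W := V) hU hU'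
    simp only [curvOp]
    rw [h1, connection_add D (vecDiffAt_connection_apply hD hW hU)
      (vecDiffAt_connection_apply hD hW hU'), h2]
    simp only [Pi.add_apply, map_add]
    module

lemma curvOp_eq_sum [T2Space M] (hD : D.ContMDiffCovariantDerivative ∞)
    (hy : y ∈ (chartAt (Model n) c).source)
    {U V W : ∀ z : M, TanAt n z} (hU : VecDiffAt U y) (hV : VecDiffAt V y)
    (hW : ∀ᶠ z in 𝓝 y, VecSmoothAt W z) :
    curvOp D y U V W = ∑ a, ∑ b, (locCoframe c a y (U y) * locCoframe c b y (V y)) •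
      curvOp D y (locFrame c a) (locFrame c b) W := by
  rw [tensorialAt_eq_sum_locFrame hy (tensorialAt_curvOp hD hW) hU]
  refine Finset.sum_congr rfl fun a _ => ?_
  rw [curvOp_swap, tensorialAt_eq_sum_locFrame hy
    (tensorialAt_curvOp hD hW) hV, ← Finset.sum_neg_distrib,
    Finset.smul_sum]
  refine Finset.sum_congr rfl fun b _ => ?_
  rw [mul_smul, ← smul_neg, ← curvOp_swap]

lemma curvOp_locFrame (hy : y ∈ (chartAt (Model n) c).source) (a b : Fin n)
    (W : ∀ z : M, TanAt n z) :
    curvOp D y (locFrame c a) (locFrame c b) W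
      = D (fun z => D W z (locFrame c b z)) y (locFrame c a y)
        - D (fun z => D W z (locFrame c a z)) y (locFrame c b y) := by
  rw [curvOp, mlieBracket_locFrame hy, map_zero, sub_zero]

/-- The curvature is tensorial in the differentiated vector field, for coordinate directions. -/
lemma curvOp_locFrame_eq_sum [T2Space M] (hD : D.ContMDiffCovariantDerivative ∞)
    (hy : y ∈ (chartAt (Model n) c).source) (a b : Fin n) {W : ∀ z : M, TanAt n z}
    (hW : ∀ᶠ z in 𝓝 y, VecSmoothAt W z) :
    curvOp D y (locFrame c a) (locFrame c b) W = ∑ e, locCoframe c e y (W y) •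
      curvOp D y (locFrame c a) (locFrame c b) (locFrame c e) := by
  simp only [curvOp_locFrame hy]
  have hf {z : M} (hz : ∀ᶠ w in 𝓝 z, VecSmoothAt W w) (hzc : z ∈ (chartAt (Model n) c).source)
      (e : Fin n) : SmoothNear n (fun z => locCoframe c e z (W z)) z := by
    filter_upwards [hz, eventually_mem_source hzc] with w h1 h2
    exact (covSmoothAt_locCoframe h2 e).apply h1
  have he (e : Fin n) : ∀ᶠ z in 𝓝 y, VecSmoothAt (locFrame c e) z := by
    filter_upwards [eventually_mem_source hy] with w hw using vecSmoothAt_locFrame hw e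
  have key (a b : Fin n) : D (fun z => D W z (locFrame c b z)) y (locFrame c a y)
      = ∑ e, (locCoframe c e y (W y) • D (fun z => D (locFrame c e) z (locFrame c b z)) y
          (locFrame c a y)
        + pd c a (fun z => locCoframe c e z (W z)) y • D (locFrame c e) y (locFrame c b y))
      + ∑ e, (pd c b (fun z => locCoframe c e z (W z)) y • D (locFrame c e) y (locFrame c a y)
        + pd c a (pd c b (fun z => locCoframe c e z (W z))) y • locFrame c e y) := by
    have h1 (e : Fin n) : VecDiffAt (fun z => D (locFrame c e) z (locFrame c b z)) y :=
      vecDiffAt_connection_apply hD (he e) (he b).self_of_nhds.diff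
    have h2 (e : Fin n) : VecDiffAt (locFrame c e) y := (he e).self_of_nhds.diff
    have h3 (e : Fin n) := (hf hW hy e).mdifferentiableAt
    have h4 (e : Fin n) := (smoothNear_pd hy (hf hW hy e) b).mdifferentiableAt
    have h8 := connection_sum_smul D (s := Finset.univ) (fun e _ => h3 e) (fun e _ => h1 e)
      (locFrame c a y)
    have h5 := connection_sum_smul D (s := Finset.univ) (fun e _ => h4 e) (fun e _ => h2 e)
      (locFrame c a y)
    refine Eq.trans ?_ (congrArg₂ (· + ·) h8 h5)
    have h6 := VecDiffAt.sum_smul (s := Finset.univ) (fun e _ => h3 e) (fun e _ => h1 e)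
    have h7 := VecDiffAt.sum_smul (s := Finset.univ) (fun e _ => h4 e) (fun e _ => h2 e)
    refine Eq.trans ?_ (connection_add D h6 h7 _)
    refine congrArg (fun L => L (locFrame c a y)) (connection_congr D
      (vecDiffAt_connection_apply hD hW (he b).self_of_nhds.diff)
      (mdifferentiableAt_add_section h6 h7) ?_)
    filter_upwards [eventually_mem_source hy, hW] with z hz hz'
    rw [connection_eq_sum D hz hz'.diff, Finset.sum_add_distrib]
    rfl
  -- the first order terms are symmetric in `a` and `b`, and second derivatives commute
  rw [key, key]
  simp only [pd_comm hy (hf hW hy _) b a, Finset.sum_add_distrib, smul_sub,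
    Finset.sum_sub_distrib]
  abel

/-- The Christoffel symbols as matrices over the algebra of smooth functions on the chart
domain. -/
def chrisRing [T2Space M] (hD : D.ContMDiffCovariantDerivative ∞) (c : M) (a : Fin n) :
    Matrix (Fin n) (Fin n) (chartRing n c) :=
  Matrix.of fun k b => toChartRing (chris c D a k b) fun _ hy => smoothNear_chris hD hy a k b

lemma evalAt_chrisRing [T2Space M] (hD : D.ContMDiffCovariantDerivative ∞)
    (hy : y ∈ (chartAt (Model n) c).source) (a k b : Fin n) :
    evalAt hy (chrisRing hD c a k b) = chris c D a k b y := rfl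

lemma evalAt_pdDer_chrisRing [T2Space M] (hD : D.ContMDiffCovariantDerivative ∞)
    (hy : y ∈ (chartAt (Model n) c).source) (e a k b : Fin n) :
    evalAt hy (pdDer c e (chrisRing hD c a k b)) = pd c e (chris c D a k b) y :=
  evalAt_pdDer_toChartRing e (fun _ hz => smoothNear_chris hD hz a k b) hy

lemma chrisRing_symm [T2Space M] (hD : D.ContMDiffCovariantDerivative ∞) (hT : D.torsion = 0)
    (a k b : Fin n) : chrisRing hD c a k b = chrisRing hD c b k a :=
  chartRing_ext fun _ hy => chris_symm hT hy a k b

lemma connection_connection_locFrame [T2Space M] (hD : D.ContMDiffCovariantDerivative ∞)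
    (hy : y ∈ (chartAt (Model n) c).source) (a b e : Fin n) :
    D (fun z => D (locFrame c e) z (locFrame c b z)) y (locFrame c a y)
      = ∑ k, (pd c a (chris c D b k e) y + ∑ f, chris c D a k f y * chris c D b f e y) •
        locFrame c k y := by
  have h1 (k : Fin n) := (smoothNear_chris hD hy b k e).mdifferentiableAt
  have h2 (k : Fin n) := (vecSmoothAt_locFrame hy k).diff
  have h3 := connection_sum_smul D (s := Finset.univ) (fun k _ => h1 k) (fun k _ => h2 k)
    (locFrame c a y)
  refine Eq.trans (congrArg (fun L => L (locFrame c a y)) (connection_congr D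
    (vecDiffAt_connection_apply hD ?_ (h2 b))
    (VecDiffAt.sum_smul (s := Finset.univ) (fun k _ => h1 k) (fun k _ => h2 k)) ?_)) (h3.trans ?_)
  · filter_upwards [eventually_mem_source hy] with z hz using vecSmoothAt_locFrame hz e
  · filter_upwards [eventually_mem_source hy] with z hz using connection_locFrame hz b e
  · simp only [connection_locFrame hy, add_smul, Finset.sum_add_distrib, Finset.smul_sum,
      Finset.sum_smul, smul_smul]
    rw [add_comm]
    congr 1
    rw [Finset.sum_comm]
    simp only [mul_comm]

/-- The components `R_{ab}{}^k{}_e` of the curvature. -/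
lemma curvature_eq_sum [T2Space M] (hD : D.ContMDiffCovariantDerivative ∞)
    (hy : y ∈ (chartAt (Model n) c).source) (u v w : TanAt n y) :
    curvature D y u v w = ∑ a, ∑ b, ∑ e, ∑ k,
      (locCoframe c a y u * locCoframe c b y v * locCoframe c e y w *
        evalAt hy (riem (pdDer c) (chrisRing hD c) a b k e)) • locFrame c k y := by
  have hW : ∀ᶠ z in 𝓝 y, VecSmoothAt (extVec w) z := by
    filter_upwards [eventually_mem_source (mem_chart_source (Model n) y)] with z hz
      using vecSmoothAt_extVec hz w
  have h1 : curvature D y u v w = curvOp D y (extVec u) (extVec v) (extVec w) := by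
    simp [curvature, curvOp]
  rw [h1, curvOp_eq_sum hD hy (vecDiffAt_extVec u) (vecDiffAt_extVec v) hW]
  simp only [extVec_self, curvOp_locFrame_eq_sum hD hy _ _ hW, Finset.smul_sum, smul_smul]
  refine Finset.sum_congr rfl fun a _ => Finset.sum_congr rfl fun b _ =>
    Finset.sum_congr rfl fun e _ => ?_
  rw [curvOp_locFrame hy, connection_connection_locFrame hD hy,
    connection_connection_locFrame hD hy, ← Finset.sum_sub_distrib, Finset.smul_sum]
  refine Finset.sum_congr rfl fun k _ => ?_
  rw [← sub_smul, smul_smul]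
  congr 2
  rw [riem_apply]
  simp only [map_add, map_sub, map_sum, map_mul, evalAt_pdDer_chrisRing, evalAt_chrisRing]
  ring

end

/-! ### Special connections have trace-free curvature -/

section

variable {n : ℕ} {M : Type*} [TopologicalSpace M] [ChartedSpace (Model n) M]

lemma dir_comp_hasFDerivAt {F : Type*} [NormedAddCommGroup F] [NormedSpace ℝ F] {y : M}
    {A : M → F} (hA : MDifferentiableAt (𝓡 n) 𝓘(ℝ, F) A y) {Φ : F → ℝ} {Φ' : F →L[ℝ] ℝ}
    (hΦ : HasFDerivAt Φ Φ' (A y)) (u : TanAt n y) :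
    dir (fun z => Φ (A z)) y u = Φ' (mfderiv (𝓡 n) 𝓘(ℝ, F) A y u) := by
  have h := (hΦ.hasMFDerivAt.comp y hA.hasMFDerivAt).mfderiv
  have h2 : dir (fun z => Φ (A z)) y u
      = mfderiv (𝓡 n) 𝓘(ℝ, ℝ) (Φ ∘ A) y u := rfl
  rw [h2, h]
  rfl

/-- The derivative of the determinant at a point where the matrix is the identity is the trace. -/
lemma dir_det_of_eq_one {y : M} {A : M → Matrix (Fin n) (Fin n) ℝ}
    (hA : ∀ i j, ContMDiffAt (𝓡 n) 𝓘(ℝ, ℝ) ∞ (fun z => A z i j) y) (h1 : A y = 1)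
    (u : TanAt n y) :
    MDifferentiableAt (𝓡 n) 𝓘(ℝ, ℝ) (fun z => (A z).det) y ∧
    dir (fun z => (A z).det) y u = ∑ i, dir (fun z => A z i i) y u := by
  let B : M → (Fin n → Fin n → ℝ) := A
  have hB : MDifferentiableAt (𝓡 n) 𝓘(ℝ, Fin n → Fin n → ℝ) B y := by
    have : ContMDiffAt (𝓡 n) 𝓘(ℝ, Fin n → Fin n → ℝ) ∞ B y :=
      contMDiffAt_pi_space.2 fun i => contMDiffAt_pi_space.2 fun j => hA i j
    exact this.mdifferentiableAt (by simp)
  let Φ : ContinuousMultilinearMap ℝ (fun _ : Fin n => Fin n → ℝ) ℝ :=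
    ⟨(Matrix.detRowAlternating (R := ℝ) (n := Fin n)).toMultilinearMap,
      Continuous.matrix_det (A := fun X : Matrix (Fin n) (Fin n) ℝ => X) continuous_id⟩
  have hΦ (X : Fin n → Fin n → ℝ) : Φ X = (Matrix.of X).det := rfl
  constructor
  · exact (Φ.hasFDerivAt (B y)).hasMFDerivAt.mdifferentiableAt.comp y hB
  · have h2 := dir_comp_hasFDerivAt hB (Φ.hasFDerivAt (B y)) u
    have h3 (i : Fin n) : dir (fun z => A z i i) y u
        = (mfderiv (𝓡 n) 𝓘(ℝ, Fin n → Fin n → ℝ) B y u : Fin n → Fin n → ℝ) i i :=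
      dir_comp_hasFDerivAt (Φ := fun X : Fin n → Fin n → ℝ => X i i) hB
        (((ContinuousLinearMap.proj (R := ℝ) (φ := fun _ : Fin n => ℝ) i).comp
          (ContinuousLinearMap.proj (R := ℝ) (φ := fun _ : Fin n => Fin n → ℝ) i)).hasFDerivAt) u
    set X : Fin n → Fin n → ℝ := mfderiv (𝓡 n) 𝓘(ℝ, Fin n → Fin n → ℝ) B y u
    have h4 : B y = (1 : Matrix (Fin n) (Fin n) ℝ) := h1
    rw [Finset.sum_congr rfl fun i _ => h3 i]
    refine h2.trans ((Φ.linearDeriv_apply (B y) X).trans (Finset.sum_congr rfl fun i _ => ?_))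
    have h5 : Matrix.of (Function.update (B y) i (X i))
        = Matrix.updateRow (1 : Matrix (Fin n) (Fin n) ℝ) i (X i) := by
      rw [h4]; rfl
    refine (congrArg Matrix.det h5).trans ?_
    have h6 : X i = ∑ j, X i j • (1 : Matrix (Fin n) (Fin n) ℝ) j := by
      ext k
      simp [Matrix.one_apply]
    conv_lhs => rw [h6]
    rw [Matrix.det_updateRow_sum]
    simp

variable [IsManifold (𝓡 n) ∞ M] {c y : M}

/-- The coordinate vector fields as a basis of the tangent space. -/
def locBasis (hy : y ∈ (chartAt (Model n) c).source) : Module.Basis (Fin n) ℝ (TanAt n y) :=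
  .ofEquivFun
    { toFun := fun v i => locCoframe c i y v
      invFun := fun f => ∑ i, f i • locFrame c i y
      map_add' := fun v w => by ext i; simp
      map_smul' := fun r v => by ext i; simp
      left_inv := fun v => sum_locCoframe_smul hy v
      right_inv := fun f => by ext i; simp [locCoframe_locFrame hy] }

lemma locBasis_repr (hy : y ∈ (chartAt (Model n) c).source) (v : TanAt n y) (i : Fin n) :
    (locBasis hy).repr v i = locCoframe c i y v := rfl

lemma locBasis_apply (hy : y ∈ (chartAt (Model n) c).source) (i : Fin n) :
    locBasis hy i = locFrame c i y := by
  refine (locBasis hy).repr.injective (Finsupp.ext fun j => ?_)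
  rw [Module.Basis.repr_self, locBasis_repr, locCoframe_locFrame hy, Finsupp.single_apply]
  simp only [eq_comm]

/-- A top degree form is evaluated by a determinant of components. -/
lemma alternating_eq_det (hy : y ∈ (chartAt (Model n) c).source)
    (ε : TanAt n y [⋀^Fin n]→ₗ[ℝ] ℝ) (v : Fin n → TanAt n y) :
    ε v = (Matrix.of fun i j => locCoframe c j y (v i)).det * ε (locFrame c · y) := by
  conv_lhs => rw [ε.eq_smul_basis_det (locBasis hy)]
  rw [AlternatingMap.smul_apply, Module.Basis.det_apply, ← Matrix.det_transpose, smul_eq_mul,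
    mul_comm]
  congr 2
  ext i
  rw [locBasis_apply]

lemma alternating_update (hy : y ∈ (chartAt (Model n) c).source)
    (ε : TanAt n y [⋀^Fin n]→ₗ[ℝ] ℝ) (i : Fin n) (v : TanAt n y) :
    ε (Function.update (locFrame c · y) i v) = locCoframe c i y v * ε (locFrame c · y) := by
  conv_lhs => rw [← sum_locCoframe_smul hy v]
  rw [ε.map_update_sum]
  simp only [ε.map_update_smul, smul_eq_mul]
  rw [Finset.sum_eq_single i]
  · simp
  · intro j _ hj
    rw [ε.map_update_self (v := (locFrame c · y)) hj.symm, mul_zero]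
  · simp

/-- A nowhere vanishing parallel volume form has logarithmic derivative `Γ^k_{ak}` in
coordinates. -/
lemma exists_volume_density [T2Space M] {D : Connection n M} (hs : IsSpecial D) (c : M) :
    ∃ f : M → ℝ, ∀ y ∈ (chartAt (Model n) c).source, SmoothNear n f y ∧ f y ≠ 0 ∧
      ∀ a, dir f y (locFrame c a y) = (∑ k, chris c D a k k y) * f y := by
  obtain ⟨ε, hsm, hne, hpar⟩ := hs
  refine ⟨fun z => ε z (locFrame c · z), fun y hy => ?_⟩
  have hf : SmoothNear n (fun z => ε z (locFrame c · z)) y := by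
    have (i : Fin n) : ∃ Y : VectorField n M, ∀ᶠ z in 𝓝 y, Y z = locFrame c i z := by
      refine exists_vectorField_eventuallyEq ?_
      filter_upwards [eventually_mem_source hy] with z hz using vecSmoothAt_locFrame hz i
    choose Y hY using this
    have h : SmoothNear n (fun z => ε z (fun i => Y i z)) y :=
      .of_forall fun z => hsm Y z
    refine h.congr ?_
    filter_upwards [eventually_all.2 hY] with z hz
    exact congrArg _ (funext fun i => (hz i).symm)
  refine ⟨hf, ?_, fun a => ?_⟩
  · intro h0
    refine hne y (AlternatingMap.ext fun v => ?_)
    have h0' : ε y (locFrame c · y) = 0 := h0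
    rw [alternating_eq_det hy, h0', mul_zero]
    rfl
  · have hyy := mem_chart_source (Model n) y
    -- the fields in the parallelism condition are built from the chart at `y`; passing to the
    -- frame of the chart at `c` introduces a determinant
    let A (z : M) : Matrix (Fin n) (Fin n) ℝ :=
      Matrix.of fun i j => locCoframe c j z (extVec (locFrame c i y) z)
    have hA (i j : Fin n) : ContMDiffAt (𝓡 n) 𝓘(ℝ, ℝ) ∞ (fun z => A z i j) y :=
      (covSmoothAt_locCoframe hy j).apply (vecSmoothAt_extVec hyy _)
    have hA1 : A y = 1 := by
      ext i j
      simp [A, locCoframe_locFrame hy, Matrix.one_apply, eq_comm]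
    obtain ⟨hd1, hd2⟩ := dir_det_of_eq_one hA hA1 (locFrame c a y)
    have h1 := hpar y (locFrame c a y) (locFrame c · y)
    rw [dir_congr (g := fun z => (A z).det * ε z (locFrame c · z)), dir_fun_mul hd1
      hf.mdifferentiableAt, hA1, Matrix.det_one, one_mul, hd2] at h1
    · simp only [alternating_update hy] at h1
      have h2 (i : Fin n) : locCoframe c i y (D (extVec (locFrame c i y)) y (locFrame c a y))
          = chris c D a i i y + dir (fun z => A z i i) y (locFrame c a y) := by
        rw [connection_eq_sum D hy (vecDiffAt_extVec _)]
        simp only [map_sum, map_add, map_smul, smul_eq_mul, extVec_self, locCoframe_locFrame hy,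
          Finset.sum_add_distrib]
        simp [chris, A]
      simp only [h2, ← Finset.sum_mul, Finset.sum_add_distrib] at h1
      linarith
    · filter_upwards [eventually_mem_source hy] with z hz
      exact alternating_eq_det hz _ _

/-- The trace `R_{ab}{}^k{}_k` is the exterior derivative of `Γ^k_{ak}`, which is closed as the
logarithmic derivative of a function. -/
lemma trace_riem_eq_zero [T2Space M] {D : Connection n M}
    (hD : D.ContMDiffCovariantDerivative ∞) (hs : IsSpecial D) (c : M) (a b : Fin n) :
    ∑ k, riem (pdDer c) (chrisRing hD c) a b k k = 0 := by
  obtain ⟨f, hf⟩ := exists_volume_density hs c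
  let F : chartRing n c := toChartRing f fun y hy => (hf y hy).1
  have hF (a : Fin n) : pdDer c a F = (∑ k, chrisRing hD c a k k) * F :=
    chartRing_ext fun y hy => by
      rw [map_mul, map_sum, evalAt_pdDer_toChartRing, (hf y hy).2.2 a]
      rfl
  have h1 := pdDer_comm a b F
  have h2 : (pdDer c a (∑ k, chrisRing hD c b k k) - pdDer c b (∑ k, chrisRing hD c a k k)) * F
      = 0 := by
    rw [hF a, hF b] at h1
    simp only [Derivation.leibniz, hF, smul_eq_mul] at h1
    linear_combination h1
  have h3 : ∑ k, riem (pdDer c) (chrisRing hD c) a b k k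
      = pdDer c a (∑ k, chrisRing hD c b k k) - pdDer c b (∑ k, chrisRing hD c a k k) := by
    simp only [riem_apply, Finset.sum_add_distrib, Finset.sum_sub_distrib, map_sum]
    rw [Finset.sum_comm (f := fun k f => chrisRing hD c a k f * chrisRing hD c b f k)]
    simp only [mul_comm (chrisRing hD c b _ _)]
    ring
  rw [h3]
  refine chartRing_ext fun y hy => ?_
  have h4 := congrArg (evalAt hy) h2
  rw [map_mul, map_zero] at h4
  rw [map_zero]
  exact (mul_eq_zero.1 h4).resolve_right (hf y hy).2.1

end

/-! ### The Schouten, Weyl and Cotton-York tensors in components -/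

section

variable {n : ℕ} {M : Type*} [TopologicalSpace M] [ChartedSpace (Model n) M]
  [IsManifold (𝓡 n) ∞ M] {c y : M} {D : Connection n M}

/-- The contraction of a tensor with a contravariant `2`-tensor does not depend on the frame. -/
lemma sum_frame_bivector (hy : y ∈ (chartAt (Model n) c).source) {V : Type*} [AddCommGroup V]
    [Module ℝ V] (T : TanAt n y → TanAt n y → V) (h₁ : ∀ w, IsLinearMap ℝ (T · w))
    (h₂ : ∀ v, IsLinearMap ℝ (T v)) (σ : ∀ z : M, BivAt n z) :
    ∑ i, ∑ j, σ y (coframe y i) (coframe y j) • T (frame y i) (frame y j)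
      = ∑ i, ∑ j, bivComp c σ i j y • T (locFrame c i y) (locFrame c j y) := by
  have h (i : Fin n) : ∑ j, σ y (coframe y i) (coframe y j) • T (frame y i) (frame y j)
      = ∑ j, σ y (coframe y i) (locCoframe c j y) • T (frame y i) (locFrame c j y) :=
    sum_frame_coframe hy (fun v α => σ y (coframe y i) α • T (frame y i) v)
      (fun α => ⟨fun v w => by rw [(h₂ _).map_add, smul_add],
        fun r v => by rw [(h₂ _).map_smul, smul_comm]⟩)
      (fun v => ⟨fun α β => by rw [map_add, add_smul],
        fun r α => by rw [map_smul, smul_assoc]⟩)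
  simp only [h]
  rw [Finset.sum_comm, Finset.sum_comm (f := fun i j => bivComp c σ i j y •
    T (locFrame c i y) (locFrame c j y))]
  refine Finset.sum_congr rfl fun j _ => ?_
  exact sum_frame_coframe hy (fun v α => σ y α (locCoframe c j y) • T v (locFrame c j y))
      (fun α => ⟨fun v w => by rw [(h₁ _).map_add, smul_add],
        fun r v => by rw [(h₁ _).map_smul, smul_comm]⟩)
      (fun v => ⟨fun α β => by rw [map_add, add_apply, add_smul],
        fun r α => by rw [map_smul, smul_apply, smul_assoc]⟩)

lemma tanAt_ext (hy : y ∈ (chartAt (Model n) c).source) {v w : TanAt n y}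
    (h : ∀ k, locCoframe c k y v = locCoframe c k y w) : v = w := by
  rw [← sum_locCoframe_smul hy v, ← sum_locCoframe_smul hy w]
  simp only [h]

variable [T2Space M] (hD : D.ContMDiffCovariantDerivative ∞)
include hD

lemma locCoframe_curvature (hy : y ∈ (chartAt (Model n) c).source) (u v w : TanAt n y)
    (k : Fin n) :
    locCoframe c k y (curvature D y u v w) = ∑ a, ∑ b, ∑ e,
      locCoframe c a y u * locCoframe c b y v * locCoframe c e y w *
        evalAt hy (riem (pdDer c) (chrisRing hD c) a b k e) := by
  rw [curvature_eq_sum hD hy]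
  simp [locCoframe_locFrame hy]

lemma ricci_eq_sum (hy : y ∈ (chartAt (Model n) c).source) (v w : TanAt n y) :
    ricci D y v w = ∑ b, ∑ e, locCoframe c b y v * locCoframe c e y w *
      evalAt hy (ric (pdDer c) (chrisRing hD c) b e) := by
  have h := sum_frame_coframe hy (fun u α => α (curvature D y u v w))
    (fun α => by
      constructor
      · intro u u'
        simp only [curvature_eq_sum hD hy, map_add, add_mul, add_smul, Finset.sum_add_distrib]
      · intro r u
        simp only [curvature_eq_sum hD hy, map_smul, smul_eq_mul, mul_assoc, mul_smul,
          ← Finset.smul_sum])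
    (fun u => ⟨fun _ _ => rfl, fun _ _ => rfl⟩)
  refine h.trans ?_
  simp only [locCoframe_curvature hD hy, locCoframe_locFrame hy, ric, map_sum, Finset.mul_sum]
  simp only [ite_mul, one_mul, zero_mul]
  rw [Finset.sum_congr rfl fun a _ => Finset.sum_eq_single a (by
    intro b _ hb
    simp [hb]) (by simp)]
  rw [Finset.sum_comm]
  refine Finset.sum_congr rfl fun b _ => ?_
  rw [Finset.sum_comm]
  simp

lemma schouten_eq_sum (hy : y ∈ (chartAt (Model n) c).source) (v w : TanAt n y) :
    schouten D y v w = ∑ b, ∑ e, locCoframe c b y v * locCoframe c e y w *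
      evalAt hy (schou (pdDer c) (chrisRing hD c) b e) := by
  rw [schouten, ricci_eq_sum hD hy, div_eq_mul_one_div, mul_comm, Finset.mul_sum]
  refine Finset.sum_congr rfl fun b _ => ?_
  rw [Finset.mul_sum]
  refine Finset.sum_congr rfl fun e _ => ?_
  simp only [schou, map_mul, AlgHom.commutes, Algebra.algebraMap_self, RingHom.id_apply]
  ring

lemma isLinearMap_schouten_left (w : TanAt n y) : IsLinearMap ℝ (schouten D y · w) := by
  have hy := mem_chart_source (Model n) y
  constructor
  · intro u u'
    simp only [schouten_eq_sum hD hy, map_add, add_mul, Finset.sum_add_distrib]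
  · intro r u
    simp only [schouten_eq_sum hD hy, map_smul, smul_eq_mul, mul_assoc, ← Finset.mul_sum]

lemma isLinearMap_schouten_right (v : TanAt n y) : IsLinearMap ℝ (schouten D y v) := by
  have hy := mem_chart_source (Model n) y
  constructor
  · intro u u'
    simp only [schouten_eq_sum hD hy, map_add, add_mul, mul_add, Finset.sum_add_distrib]
  · intro r u
    simp only [schouten_eq_sum hD hy, map_smul, smul_eq_mul, Finset.mul_sum]
    exact Finset.sum_congr rfl fun b _ => Finset.sum_congr rfl fun e _ => by ring

lemma schouten_sum_left {ι : Type*} (s : Finset ι) (r : ι → ℝ) (v : ι → TanAt n y)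
    (w : TanAt n y) :
    schouten D y (∑ i ∈ s, r i • v i) w = ∑ i ∈ s, r i * schouten D y (v i) w := by
  have := map_sum (IsLinearMap.mk' _ (isLinearMap_schouten_left hD w)) (fun i => r i • v i) s
  simpa only [map_smul, IsLinearMap.mk'_apply, smul_eq_mul] using this

lemma schouten_sum_right {ι : Type*} (s : Finset ι) (r : ι → ℝ) (v : TanAt n y)
    (w : ι → TanAt n y) :
    schouten D y v (∑ i ∈ s, r i • w i) = ∑ i ∈ s, r i * schouten D y v (w i) := by
  have := map_sum (IsLinearMap.mk' _ (isLinearMap_schouten_right hD v)) (fun i => r i • w i) s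
  simpa only [map_smul, IsLinearMap.mk'_apply, smul_eq_mul] using this

lemma schouten_locFrame (hy : y ∈ (chartAt (Model n) c).source) (b e : Fin n) :
    schouten D y (locFrame c b y) (locFrame c e y)
      = evalAt hy (schou (pdDer c) (chrisRing hD c) b e) := by
  rw [schouten_eq_sum hD hy]
  simp [locCoframe_locFrame hy]

/-- The components `W_{ab}{}^k{}_e` of the Weyl tensor. -/
lemma locCoframe_weyl (hy : y ∈ (chartAt (Model n) c).source) (u v w : TanAt n y)
    (k : Fin n) :
    locCoframe c k y (weyl D y u v w) = ∑ a, ∑ b, ∑ e,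
      locCoframe c a y u * locCoframe c b y v * locCoframe c e y w *
        evalAt hy (wey (pdDer c) (chrisRing hD c) a b k e) := by
  rw [weyl, map_add, map_sub, map_smul, map_smul, smul_eq_mul, smul_eq_mul,
    locCoframe_curvature hD hy, schouten_eq_sum hD hy, schouten_eq_sum hD hy]
  simp only [wey, map_sub, map_add, apply_ite (evalAt hy), map_zero, mul_sub, mul_add,
    Finset.sum_add_distrib, Finset.sum_sub_distrib]
  congr 1
  · congr 1
    conv_rhs => rw [Finset.sum_eq_single k (by intro b _ hb; simp [hb]) (by simp)]
    rw [Finset.sum_mul]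
    refine Finset.sum_congr rfl fun b _ => ?_
    rw [Finset.sum_mul]
    refine Finset.sum_congr rfl fun e _ => ?_
    rw [if_pos rfl]
    ring
  · rw [Finset.sum_mul]
    refine Finset.sum_congr rfl fun a _ => ?_
    conv_rhs => rw [Finset.sum_eq_single k (by intro b _ hb; simp [hb]) (by simp)]
    rw [Finset.sum_mul]
    refine Finset.sum_congr rfl fun e _ => ?_
    rw [if_pos rfl]
    ring

lemma mdifferentiableAt_schouten {X Y : ∀ z : M, TanAt n z} (hX : VecDiffAt X y)
    (hY : VecDiffAt Y y) :
    MDifferentiableAt (𝓡 n) 𝓘(ℝ, ℝ) (fun z => schouten D z (X z) (Y z)) y := by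
  have hy := mem_chart_source (Model n) y
  have h : MDifferentiableAt (𝓡 n) 𝓘(ℝ, ℝ) (fun z => ∑ b, ∑ e,
      locCoframe y b z (X z) * locCoframe y e z (Y z) *
      extZero (schou (pdDer y) (chrisRing hD y) b e).1 z) y :=
    mdifferentiableAt_sum' fun b _ => mdifferentiableAt_sum' fun e _ =>
      (((covSmoothAt_locCoframe hy b).diff.apply hX).mul
        ((covSmoothAt_locCoframe hy e).diff.apply hY)).mul
        (smoothNear_extZero _ hy).mdifferentiableAt
  refine h.congr_of_eventuallyEq ?_
  filter_upwards [eventually_mem_source hy] with z hz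
  rw [schouten_eq_sum hD hz]
  simp only [extZero_eq_evalAt _ hz]

/-- The components `∇_a P_{bc}` of the derivative of the Schouten tensor. -/
lemma schoutenDeriv_eq_sum (hy : y ∈ (chartAt (Model n) c).source) (u v w : TanAt n y) :
    schoutenDeriv D y u v w = ∑ b, ∑ e, locCoframe c b y v * (locCoframe c e y w *
      ∑ a, locCoframe c a y u * evalAt hy (dschou (pdDer c) (chrisRing hD c) a b e)) := by
  let Ψ (X Y : ∀ z : M, TanAt n z) : ℝ := dir (fun z => schouten D z (X z) (Y z)) y u
    - schouten D y (D X y u) (Y y) - schouten D y (X y) (D Y y u)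
  have h₁ (Y : ∀ z : M, TanAt n z) (hY : VecDiffAt Y y) :
      TensorialAt (𝓡 n) (Model n) (Ψ · Y) y := by
    constructor
    · intro f X hf hX
      have : (fun z => schouten D z ((f • X) z) (Y z))
          = fun z => f z * schouten D z (X z) (Y z) :=
        funext fun z => (isLinearMap_schouten_left hD _).map_smul _ _
      simp only [Ψ]
      rw [this, dir_fun_mul hf (mdifferentiableAt_schouten hD hX hY), connection_smul D hf hX,
        (isLinearMap_schouten_left hD _).map_add, (isLinearMap_schouten_left hD _).map_smul,
        (isLinearMap_schouten_left hD _).map_smul, Pi.smul_apply',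
        (isLinearMap_schouten_left hD _).map_smul]
      simp only [smul_eq_mul]
      ring
    · intro X X' hX hX'
      have : (fun z => schouten D z ((X + X') z) (Y z))
          = fun z => schouten D z (X z) (Y z) + schouten D z (X' z) (Y z) :=
        funext fun z => (isLinearMap_schouten_left hD _).map_add _ _
      simp only [Ψ]
      rw [this, dir_fun_add (mdifferentiableAt_schouten hD hX hY)
        (mdifferentiableAt_schouten hD hX' hY), connection_add D hX hX',
        (isLinearMap_schouten_left hD _).map_add, Pi.add_apply,
        (isLinearMap_schouten_left hD _).map_add]
      ring
  have h₂ (X : ∀ z : M, TanAt n z) (hX : VecDiffAt X y) :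
      TensorialAt (𝓡 n) (Model n) (Ψ X ·) y := by
    constructor
    · intro f Y hf hY
      have : (fun z => schouten D z (X z) ((f • Y) z))
          = fun z => f z * schouten D z (X z) (Y z) :=
        funext fun z => (isLinearMap_schouten_right hD _).map_smul _ _
      simp only [Ψ]
      rw [this, dir_fun_mul hf (mdifferentiableAt_schouten hD hX hY), connection_smul D hf hY,
        (isLinearMap_schouten_right hD _).map_add, (isLinearMap_schouten_right hD _).map_smul,
        (isLinearMap_schouten_right hD _).map_smul, Pi.smul_apply',
        (isLinearMap_schouten_right hD _).map_smul]
      simp only [smul_eq_mul]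
      ring
    · intro Y Y' hY hY'
      have : (fun z => schouten D z (X z) ((Y + Y') z))
          = fun z => schouten D z (X z) (Y z) + schouten D z (X z) (Y' z) :=
        funext fun z => (isLinearMap_schouten_right hD _).map_add _ _
      simp only [Ψ]
      rw [this, dir_fun_add (mdifferentiableAt_schouten hD hX hY)
        (mdifferentiableAt_schouten hD hX hY'), connection_add D hY hY',
        (isLinearMap_schouten_right hD _).map_add, Pi.add_apply,
        (isLinearMap_schouten_right hD _).map_add]
      ring
  have h3 : schoutenDeriv D y u v w = Ψ (extVec v) (extVec w) := by
    simp [schoutenDeriv, Ψ]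
  rw [h3, tensorialAt_eq_sum_locFrame hy (h₁ _ (vecDiffAt_extVec w)) (vecDiffAt_extVec v)]
  simp only [extVec_self, smul_eq_mul]
  refine Finset.sum_congr rfl fun b _ => ?_
  rw [tensorialAt_eq_sum_locFrame hy (h₂ _ (vecSmoothAt_locFrame hy b).diff)
    (vecDiffAt_extVec w), Finset.mul_sum]
  refine Finset.sum_congr rfl fun e _ => ?_
  rw [extVec_self, smul_eq_mul]
  congr 2
  have hdir : dir (fun z => schouten D z (locFrame c b z) (locFrame c e z)) y u
      = ∑ a, locCoframe c a y u *
        evalAt hy (pdDer c a (schou (pdDer c) (chrisRing hD c) b e)) := by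
    rw [dir_eq_sum_locFrame _ hy]
    refine Finset.sum_congr rfl fun a _ => ?_
    congr 1
    refine dir_congr ?_ _
    filter_upwards [eventually_mem_source hy] with z hz
    rw [schouten_locFrame hD hz, extZero_eq_evalAt _ hz]
  have hconn (b : Fin n) : D (locFrame c b) y u
      = ∑ k, (∑ a, locCoframe c a y u * chris c D a k b y) • locFrame c k y := by
    conv_lhs => rw [← sum_locCoframe_smul hy u]
    simp only [map_sum, map_smul, connection_locFrame hy, Finset.smul_sum, smul_smul,
      Finset.sum_smul]
    exact Finset.sum_comm
  simp only [Ψ]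
  rw [hdir, hconn, hconn, schouten_sum_left hD, schouten_sum_right hD]
  simp only [schouten_locFrame hD hy, dschou, map_sub, map_sum,
    map_mul, evalAt_chrisRing, mul_sub, Finset.sum_sub_distrib, Finset.mul_sum, Finset.sum_mul,
    mul_assoc]
  rw [Finset.sum_comm (f := fun k a => locCoframe c a y u * (chris c D a k b y *
      evalAt hy (schou (pdDer c) (chrisRing hD c) k e))),
    Finset.sum_comm (f := fun k a => locCoframe c a y u * (chris c D a k e y *
      evalAt hy (schou (pdDer c) (chrisRing hD c) b k)))]

/-- The components `Y_{abc}` of the Cotton-York tensor. -/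
lemma cottonYork_eq_sum (hy : y ∈ (chartAt (Model n) c).source) (u v w : TanAt n y) :
    cottonYork D y u v w = ∑ a, ∑ b, ∑ e,
      locCoframe c a y u * locCoframe c b y v * locCoframe c e y w *
        evalAt hy (cott (pdDer c) (chrisRing hD c) a b e) := by
  have h (u v : TanAt n y) : schoutenDeriv D y u v w = ∑ a, ∑ b, ∑ e,
      locCoframe c a y u * locCoframe c b y v * locCoframe c e y w *
        evalAt hy (dschou (pdDer c) (chrisRing hD c) a b e) := by
    rw [schoutenDeriv_eq_sum hD hy]
    simp only [Finset.mul_sum]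
    conv_rhs => rw [Finset.sum_comm]
    refine Finset.sum_congr rfl fun b _ => ?_
    conv_rhs => rw [Finset.sum_comm]
    exact Finset.sum_congr rfl fun e _ => Finset.sum_congr rfl fun a _ => by ring
  rw [cottonYork, h u v, h v u]
  conv_lhs => rw [Finset.sum_comm (γ := Fin n) (f := fun a b => ∑ e,
    locCoframe c a y v * locCoframe c b y u * locCoframe c e y w *
        evalAt hy (dschou (pdDer c) (chrisRing hD c) a b e))]
  simp only [← Finset.sum_sub_distrib, Finset.sum_div]
  refine Finset.sum_congr rfl fun a _ => Finset.sum_congr rfl fun b _ =>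
    Finset.sum_congr rfl fun e _ => ?_
  simp only [cott, map_mul, map_sub, AlgHom.commutes, Algebra.algebraMap_self, RingHom.id_apply]
  ring

end

/-! ### The prolonged connection in components -/

section

section ProlongedAlgebra

variable {n : ℕ} {A : Type*} [CommRing A] [Algebra ℝ A]
  (d : Fin n → Derivation ℝ A A) (G : Fin n → Matrix (Fin n) (Fin n) A)
  (s : Fin n → Fin n → A) (mu : Fin n → A) (rho : A)

/-- Components of `∇_a σ^{bc} - δ_a{}^b μ^c - δ_a{}^c μ^b`. -/
def prolSigma (a b c : Fin n) : A :=
  dbiv d G s a b c - (if a = b then mu c else 0) - if a = c then mu b else 0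

/-- Components of `∇_a μ^b - δ_a{}^b ρ + P_{ac} σ^{bc} - (1/n) W_{ac}{}^b{}_e σ^{ce}`. -/
def prolMu (a b : Fin n) : A :=
  dvec d G mu a b - (if a = b then rho else 0) + ∑ c, schou d G a c * s b c
    - algebraMap ℝ A (1 / (n : ℝ)) * ∑ c, ∑ e, wey d G a c b e * s c e

/-- Components of `∇_a ρ + 2 P_{ab} μ^b - (4/n) Y_{abc} σ^{bc}`. -/
def prolRho (a : Fin n) : A :=
  d a rho + 2 * ∑ b, schou d G a b * mu b
    - 4 * algebraMap ℝ A (1 / (n : ℝ)) * ∑ b, ∑ c, cott d G a b c * s b c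

end ProlongedAlgebra

variable {n : ℕ} {M : Type*} [TopologicalSpace M] [ChartedSpace (Model n) M]
  [IsManifold (𝓡 n) ∞ M] {c y : M}

variable (c) in
/-- The components of a contravariant `2`-tensor field in the chart at `c`. -/
def bivRing (σ : BivectorField n M) (i j : Fin n) : chartRing n c :=
  toChartRing (bivComp c σ i j) fun _ hy => by
    filter_upwards [eventually_mem_source hy] with z hz
    exact BivSmoothAt.apply σ.contMDiff.contMDiffAt (covSmoothAt_locCoframe hz i)
      (covSmoothAt_locCoframe hz j)

variable (c) in
/-- The components of a vector field in the chart at `c`. -/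
def vecRing (X : VectorField n M) (i : Fin n) : chartRing n c :=
  toChartRing (fun z => locCoframe c i z (X z)) fun _ hy => by
    filter_upwards [eventually_mem_source hy] with z hz
    exact (covSmoothAt_locCoframe hz i).apply X.contMDiff.contMDiffAt

variable (c) in
/-- The restriction of a smooth function to the domain of the chart at `c`. -/
def funRing (f : ContMDiffMap (𝓡 n) 𝓘(ℝ, ℝ) M ℝ ∞) : chartRing n c :=
  toChartRing f fun _ _ => .of_forall fun _ => f.contMDiff.contMDiffAt

lemma bivRing_symm (σ : SymBivectorField n M) (i j : Fin n) :
    bivRing c σ.1 i j = bivRing c σ.1 j i :=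
  chartRing_ext fun y _ => σ.2 y _ _

lemma evalAt_bivRing (hy : y ∈ (chartAt (Model n) c).source) (σ : BivectorField n M)
    (i j : Fin n) : evalAt hy (bivRing c σ i j) = bivComp c σ i j y := rfl

lemma evalAt_vecRing (hy : y ∈ (chartAt (Model n) c).source) (X : VectorField n M) (i : Fin n) :
    evalAt hy (vecRing c X i) = locCoframe c i y (X y) := rfl

omit [IsManifold (𝓡 n) ∞ M] in
lemma evalAt_algebraMap_mul (hy : y ∈ (chartAt (Model n) c).source) (r : ℝ)
    (f : chartRing n c) : evalAt hy (algebraMap ℝ (chartRing n c) r * f) = r * evalAt hy f := by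
  rw [map_mul]
  rfl

omit [IsManifold (𝓡 n) ∞ M] in
lemma evalAt_funRing (hy : y ∈ (chartAt (Model n) c).source)
    (f : ContMDiffMap (𝓡 n) 𝓘(ℝ, ℝ) M ℝ ∞) : evalAt hy (funRing c f) = f y := rfl

lemma evalAt_pdDer_bivRing (hy : y ∈ (chartAt (Model n) c).source) (σ : BivectorField n M)
    (a i j : Fin n) : evalAt hy (pdDer c a (bivRing c σ i j))
      = dir (bivComp c σ i j) y (locFrame c a y) := evalAt_pdDer_toChartRing a _ hy

lemma evalAt_pdDer_vecRing (hy : y ∈ (chartAt (Model n) c).source) (X : VectorField n M)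
    (a i : Fin n) : evalAt hy (pdDer c a (vecRing c X i))
      = dir (fun z => locCoframe c i z (X z)) y (locFrame c a y) := evalAt_pdDer_toChartRing a _ hy

lemma evalAt_pdDer_funRing (hy : y ∈ (chartAt (Model n) c).source)
    (f : ContMDiffMap (𝓡 n) 𝓘(ℝ, ℝ) M ℝ ∞) (a : Fin n) :
    evalAt hy (pdDer c a (funRing c f)) = dir f y (locFrame c a y) :=
  evalAt_pdDer_toChartRing a _ hy

variable {D : Connection n M} [T2Space M] (hD : D.ContMDiffCovariantDerivative ∞)
include hD

lemma locCoframe_weyl_locFrame (hy : y ∈ (chartAt (Model n) c).source) (u : TanAt n y)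
    (i j k : Fin n) : locCoframe c k y (weyl D y u (locFrame c i y) (locFrame c j y))
      = ∑ a, locCoframe c a y u * evalAt hy (wey (pdDer c) (chrisRing hD c) a i k j) := by
  rw [locCoframe_weyl hD hy]
  refine Finset.sum_congr rfl fun a _ => ?_
  rw [Finset.sum_eq_single i (by intro b _ hb; simp [locCoframe_locFrame hy, hb]) (by simp),
    Finset.sum_eq_single j (by intro b _ hb; simp [locCoframe_locFrame hy, hb]) (by simp)]
  simp [locCoframe_locFrame hy]

lemma cottonYork_locFrame (hy : y ∈ (chartAt (Model n) c).source) (u : TanAt n y)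
    (i j : Fin n) : cottonYork D y u (locFrame c i y) (locFrame c j y)
      = ∑ a, locCoframe c a y u * evalAt hy (cott (pdDer c) (chrisRing hD c) a i j) := by
  rw [cottonYork_eq_sum hD hy]
  refine Finset.sum_congr rfl fun a _ => ?_
  rw [Finset.sum_eq_single i (by intro b _ hb; simp [locCoframe_locFrame hy, hb]) (by simp),
    Finset.sum_eq_single j (by intro b _ hb; simp [locCoframe_locFrame hy, hb]) (by simp)]
  simp [locCoframe_locFrame hy]

lemma bivectorDeriv_eq_evalAt (hy : y ∈ (chartAt (Model n) c).source) (σ : BivectorField n M)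
    (u : TanAt n y) (α β : CotAt n y) :
    bivectorDeriv D σ y u α β = ∑ i, ∑ j, α (locFrame c i y) * (β (locFrame c j y) *
      ∑ a, locCoframe c a y u *
        evalAt hy (dbiv (pdDer c) (chrisRing hD c) (bivRing c σ) a i j)) := by
  rw [bivectorDeriv_eq_sum D hy (BivSmoothAt.diff σ.contMDiff.contMDiffAt)]
  refine Finset.sum_congr rfl fun i _ => Finset.sum_congr rfl fun j _ => ?_
  congr 2
  refine Finset.sum_congr rfl fun a _ => ?_
  congr 1
  simp only [dbiv, map_add, map_sum, map_mul, evalAt_pdDer_bivRing, evalAt_bivRing,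
    evalAt_chrisRing]

lemma locCoframe_connection (hy : y ∈ (chartAt (Model n) c).source) (X : VectorField n M)
    (u : TanAt n y) (k : Fin n) :
    locCoframe c k y (D X y u) = ∑ a, locCoframe c a y u *
      evalAt hy (dvec (pdDer c) (chrisRing hD c) (vecRing c X) a k) := by
  conv_lhs => rw [← sum_locCoframe_smul hy u]
  rw [map_sum, map_sum]
  refine Finset.sum_congr rfl fun a _ => ?_
  rw [map_smul, map_smul, smul_eq_mul]
  congr 1
  rw [connection_eq_sum D hy (VecSmoothAt.diff X.contMDiff.contMDiffAt)]
  simp only [map_sum, map_add, map_smul, smul_eq_mul, locCoframe_locFrame hy, dvec, map_mul,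
    evalAt_pdDer_vecRing, evalAt_vecRing, Finset.sum_add_distrib, evalAt_chrisRing, mul_ite,
    mul_one, mul_zero, Finset.sum_ite_eq, Finset.mem_univ, if_true]
  rw [add_comm]
  congr 1
  exact Finset.sum_congr rfl fun b _ => by rw [mul_comm]; rfl

lemma isLinearMap_weyl_middle (u w : TanAt n y) : IsLinearMap ℝ (weyl D y u · w) := by
  have hy := mem_chart_source (Model n) y
  constructor
  · intro v v'
    refine tanAt_ext hy fun k => ?_
    simp only [map_add, locCoframe_weyl hD hy, add_mul, mul_add, Finset.sum_add_distrib]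
  · intro r v
    refine tanAt_ext hy fun k => ?_
    simp only [map_smul, smul_eq_mul, locCoframe_weyl hD hy, Finset.mul_sum]
    exact Finset.sum_congr rfl fun a _ => Finset.sum_congr rfl fun b _ =>
      Finset.sum_congr rfl fun e _ => by ring

lemma isLinearMap_weyl_right (u v : TanAt n y) : IsLinearMap ℝ (weyl D y u v) := by
  have hy := mem_chart_source (Model n) y
  constructor
  · intro w w'
    refine tanAt_ext hy fun k => ?_
    simp only [map_add, locCoframe_weyl hD hy, add_mul, mul_add, Finset.sum_add_distrib]
  · intro r w
    refine tanAt_ext hy fun k => ?_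
    simp only [map_smul, smul_eq_mul, locCoframe_weyl hD hy, Finset.mul_sum]
    exact Finset.sum_congr rfl fun a _ => Finset.sum_congr rfl fun b _ =>
      Finset.sum_congr rfl fun e _ => by ring

lemma isLinearMap_cottonYork_middle (u w : TanAt n y) : IsLinearMap ℝ (cottonYork D y u · w) := by
  have hy := mem_chart_source (Model n) y
  constructor
  · intro v v'
    simp only [map_add, cottonYork_eq_sum hD hy, add_mul, mul_add, Finset.sum_add_distrib]
  · intro r v
    simp only [map_smul, smul_eq_mul, cottonYork_eq_sum hD hy, Finset.mul_sum]
    exact Finset.sum_congr rfl fun a _ => Finset.sum_congr rfl fun b _ =>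
      Finset.sum_congr rfl fun e _ => by ring

lemma isLinearMap_cottonYork_right (u v : TanAt n y) : IsLinearMap ℝ (cottonYork D y u v) := by
  have hy := mem_chart_source (Model n) y
  constructor
  · intro w w'
    simp only [map_add, cottonYork_eq_sum hD hy, add_mul, mul_add, Finset.sum_add_distrib]
  · intro r w
    simp only [map_smul, smul_eq_mul, cottonYork_eq_sum hD hy, Finset.mul_sum]
    exact Finset.sum_congr rfl fun a _ => Finset.sum_congr rfl fun b _ =>
      Finset.sum_congr rfl fun e _ => by ring

/-- The `⊙²TM`-component of the prolonged connection in coordinates. -/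
lemma prolongedDeriv_fst (hy : y ∈ (chartAt (Model n) c).source) (s : ProlongedSection n M)
    (u : TanAt n y) (α β : CotAt n y) :
    (prolongedDeriv D s y u).1 α β = ∑ i, ∑ j, α (locFrame c i y) * (β (locFrame c j y) *
      ∑ a, locCoframe c a y u * evalAt hy (prolSigma (pdDer c) (chrisRing hD c)
        (bivRing c s.sigma.1) (vecRing c s.mu) a i j)) := by
  have h1 : (prolongedDeriv D s y u).1 α β = bivectorDeriv D s.sigma.1 y u α β
    - α u * β (s.mu y) - β u * α (s.mu y) := rfl
  have h2 (α β : CotAt n y) : α u * β (s.mu y) = ∑ i, ∑ j, α (locFrame c i y) *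
      (β (locFrame c j y) * (locCoframe c i y u * locCoframe c j y (s.mu y))) := by
    conv_lhs => rw [← sum_locCoframe_smul hy u, ← sum_locCoframe_smul hy (s.mu y)]
    simp only [map_sum, map_smul, smul_eq_mul, Finset.sum_mul_sum]
    exact Finset.sum_congr rfl fun i _ => Finset.sum_congr rfl fun j _ => by ring
  rw [h1, bivectorDeriv_eq_evalAt hD hy, h2 α β, h2 β α]
  conv_lhs => rw [Finset.sum_comm (f := fun i j => β (locFrame c i y) *
    (α (locFrame c j y) * (locCoframe c i y u * locCoframe c j y (s.mu y))))]
  simp only [← Finset.sum_sub_distrib]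
  refine Finset.sum_congr rfl fun i _ => Finset.sum_congr rfl fun j _ => ?_
  simp only [prolSigma, map_sub, apply_ite (evalAt hy), map_zero, mul_sub,
    Finset.sum_sub_distrib, mul_ite, mul_zero, Finset.sum_ite_eq', Finset.mem_univ, if_true]
  simp only [evalAt_vecRing]
  ring

lemma locCoframe_schouten_contraction (hy : y ∈ (chartAt (Model n) c).source)
    (σ : BivectorField n M) (u : TanAt n y) (k : Fin n) :
    locCoframe c k y (∑ i, ∑ j, bivComp c σ i j y •
      (schouten D y u (locFrame c j y) • locFrame c i y)) = ∑ a, locCoframe c a y u *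
      evalAt hy (∑ e, schou (pdDer c) (chrisRing hD c) a e * bivRing c σ k e) := by
    simp only [map_sum, map_smul, smul_eq_mul, locCoframe_locFrame hy, schouten_eq_sum hD hy,
      mul_ite, mul_one, mul_zero, ite_mul, zero_mul, Finset.sum_ite_eq',
      Finset.mem_univ, if_true, map_mul, evalAt_bivRing, Finset.mul_sum]
    rw [Finset.sum_comm]
    simp only [Finset.sum_ite_eq, Finset.mem_univ, if_true]
    rw [Finset.sum_comm]
    exact Finset.sum_congr rfl fun a _ => Finset.sum_congr rfl fun e _ => by ring

lemma locCoframe_weyl_contraction (hy : y ∈ (chartAt (Model n) c).source) (σ : BivectorField n M)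
    (u : TanAt n y) (k : Fin n) :
    locCoframe c k y ((1 / (n : ℝ)) • ∑ i, ∑ j, bivComp c σ i j y •
      weyl D y u (locFrame c i y) (locFrame c j y)) = ∑ a, locCoframe c a y u *
      evalAt hy (algebraMap ℝ (chartRing n c) (1 / (n : ℝ)) * ∑ i, ∑ j,
        wey (pdDer c) (chrisRing hD c) a i k j * bivRing c σ i j) := by
    have h (a : Fin n) : evalAt hy (algebraMap ℝ (chartRing n c) (1 / (n : ℝ)) * ∑ i, ∑ j,
        wey (pdDer c) (chrisRing hD c) a i k j * bivRing c σ i j)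
        = 1 / (n : ℝ) * ∑ i, ∑ j, evalAt hy (wey (pdDer c) (chrisRing hD c) a i k j) *
          bivComp c σ i j y := by
      rw [evalAt_algebraMap_mul]
      simp only [map_sum, map_mul, evalAt_bivRing]
    simp only [h]
    simp only [map_sum, map_smul, smul_eq_mul, locCoframe_weyl_locFrame hD hy, Finset.mul_sum]
    conv_rhs => rw [Finset.sum_comm]
    refine Finset.sum_congr rfl fun i _ => ?_
    conv_rhs => rw [Finset.sum_comm]
    exact Finset.sum_congr rfl fun j _ => Finset.sum_congr rfl fun a _ => by ring

/-- The `TM`-component of the prolonged connection in coordinates. -/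
lemma prolongedDeriv_snd_fst (hy : y ∈ (chartAt (Model n) c).source) (s : ProlongedSection n M)
    (u : TanAt n y) (k : Fin n) :
    locCoframe c k y (prolongedDeriv D s y u).2.1 = ∑ a, locCoframe c a y u *
      evalAt hy (prolMu (pdDer c) (chrisRing hD c)
        (bivRing c s.sigma.1) (vecRing c s.mu) (funRing c s.rho) a k) := by
  have h1 : (prolongedDeriv D s y u).2.1 = D s.mu y u - s.rho y • u
     + ∑ b, ∑ c, (s.sigma.1 y (coframe y b) (coframe y c)) •
         (schouten D y u (frame y c) • frame y b)
     - (1 / (n : ℝ)) • ∑ c, ∑ d, s.sigma.1 y (coframe y c) (coframe y d) •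
         weyl D y u (frame y c) (frame y d) := by
    simp only [smul_smul, mul_comm (s.sigma.1 y _ _)]
    rfl
  rw [h1, sum_frame_bivector hy (fun v w => schouten D y u w • v)
    (fun w => ⟨fun v v' => smul_add _ _ _, fun r v => smul_comm _ _ _⟩)
    (fun v => ⟨fun w w' => by rw [(isLinearMap_schouten_right hD u).map_add, add_smul],
      fun r w => by rw [(isLinearMap_schouten_right hD u).map_smul, smul_assoc]⟩),
    sum_frame_bivector hy (fun v w => weyl D y u v w) (isLinearMap_weyl_middle hD u)
      (isLinearMap_weyl_right hD u)]
  have hρ : locCoframe c k y (s.rho y • u) = ∑ a, locCoframe c a y u *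
      evalAt hy (if a = k then funRing c s.rho else 0) := by
    simp [apply_ite (evalAt hy), evalAt_funRing, mul_comm]
  rw [map_sub, map_add, map_sub, locCoframe_connection hD hy, hρ,
    locCoframe_schouten_contraction hD hy, locCoframe_weyl_contraction hD hy]
  simp only [prolMu, map_sub, map_add, mul_sub, mul_add, Finset.sum_sub_distrib,
    Finset.sum_add_distrib]

lemma cottonYork_contraction (hy : y ∈ (chartAt (Model n) c).source) (σ : BivectorField n M)
    (u : TanAt n y) :
    ∑ i, ∑ j, bivComp c σ i j y •
      cottonYork D y u (locFrame c i y) (locFrame c j y) = ∑ a, locCoframe c a y u *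
      evalAt hy (∑ i, ∑ j, cott (pdDer c) (chrisRing hD c) a i j * bivRing c σ i j) := by
    simp only [map_sum, smul_eq_mul, cottonYork_locFrame hD hy, map_mul, evalAt_bivRing,
      Finset.mul_sum]
    conv_rhs => rw [Finset.sum_comm]
    refine Finset.sum_congr rfl fun i _ => ?_
    conv_rhs => rw [Finset.sum_comm]
    exact Finset.sum_congr rfl fun j _ => Finset.sum_congr rfl fun a _ => by ring

lemma schouten_contraction (hy : y ∈ (chartAt (Model n) c).source) (X : VectorField n M)
    (u : TanAt n y) (a : Fin n) :
    ∑ e, locCoframe c a y u * locCoframe c e y (X y) *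
      evalAt hy (schou (pdDer c) (chrisRing hD c) a e) = locCoframe c a y u *
      evalAt hy (∑ b, schou (pdDer c) (chrisRing hD c) a b * vecRing c X b) := by
    simp only [map_sum, map_mul, evalAt_vecRing, Finset.mul_sum]
    exact Finset.sum_congr rfl fun e _ => by ring

/-- The scalar component of the prolonged connection in coordinates. -/
lemma prolongedDeriv_snd_snd (hy : y ∈ (chartAt (Model n) c).source) (s : ProlongedSection n M)
    (u : TanAt n y) :
    (prolongedDeriv D s y u).2.2 = ∑ a, locCoframe c a y u *
      evalAt hy (prolRho (pdDer c) (chrisRing hD c)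
        (bivRing c s.sigma.1) (vecRing c s.mu) (funRing c s.rho) a) := by
  have h1 : (prolongedDeriv D s y u).2.2 = dir s.rho y u + 2 * schouten D y u (s.mu y)
     - (4 / (n : ℝ)) * ∑ b, ∑ c, s.sigma.1 y (coframe y b) (coframe y c) •
        cottonYork D y u (frame y b) (frame y c) := by
    simp only [smul_eq_mul, mul_comm (s.sigma.1 y _ _)]
    rfl
  rw [h1, sum_frame_bivector hy (fun v w => cottonYork D y u v w)
    (isLinearMap_cottonYork_middle hD u) (isLinearMap_cottonYork_right hD u),
    dir_eq_sum_locFrame _ hy, schouten_eq_sum hD hy]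
  rw [cottonYork_contraction hD hy, Finset.mul_sum, Finset.mul_sum,
    ← Finset.sum_add_distrib, ← Finset.sum_sub_distrib]
  refine Finset.sum_congr rfl fun a _ => ?_
  rw [prolRho, map_sub, map_add, map_mul, mul_assoc, map_mul, map_ofNat, map_ofNat,
    evalAt_algebraMap_mul, evalAt_pdDer_funRing]
  rw [schouten_contraction hD hy]
  ring

end

/-! ### Smooth tensor fields from smooth components -/

section

variable {n : ℕ} {M : Type*} [TopologicalSpace M] [ChartedSpace (Model n) M]
  [IsManifold (𝓡 n) ∞ M] {c y : M}

lemma exists_vectorField_of_components (X : ∀ z : M, TanAt n z)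
    (h : ∀ (c : M) (k : Fin n),
      ContMDiffAt (𝓡 n) 𝓘(ℝ, ℝ) ∞ (fun z => locCoframe c k z (X z)) c) :
    ∃ Y : VectorField n M, ∀ z, Y z = X z := by
  refine ⟨⟨X, fun c => ?_⟩, fun _ => rfl⟩
  have hc := mem_chart_source (Model n) c
  have h1 : VecSmoothAt (fun z => ∑ k, locCoframe c k z (X z) • locFrame c k z) c :=
    .sum_section fun k _ => (h c k).smul_section (vecSmoothAt_locFrame hc k)
  refine h1.congr_of_eventuallyEq ?_
  filter_upwards [eventually_mem_source hc] with z hz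
  rw [sum_locCoframe_smul hz]

omit [IsManifold (𝓡 n) ∞ M] in
variable (n) in
/-- The contravariant `2`-tensor `v ⊗ w`. -/
def tensorAt {x : M} (v w : TanAt n x) : BivAt n x :=
  let v' : Model n := v
  let w' : Model n := w
  ((ContinuousLinearMap.apply ℝ ℝ v').smulRight (ContinuousLinearMap.apply ℝ ℝ w') :
    (Model n →L[ℝ] ℝ) →L[ℝ] (Model n →L[ℝ] ℝ) →L[ℝ] ℝ)

omit [IsManifold (𝓡 n) ∞ M] in
lemma tensorAt_apply {x : M} (v w : TanAt n x) (α β : CotAt n x) :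
    tensorAt n v w α β = α v * β w := rfl

/-- Extension of contravariant `2`-tensors is compatible with extension of covectors. -/
lemma extend_biv_apply (hy : y ∈ (chartAt (Model n) c).source) (S : BivAt n c)
    (α β : CotAt n c) :
    extend ((Model n →L[ℝ] ℝ) →L[ℝ] (Model n →L[ℝ] ℝ) →L[ℝ] ℝ) (E := fun z : M => BivAt n z) S y
      (extCov α y) (extCov β y) = S α β := by
  have hT : y ∈ (trivializationAt (Model n) (fun x : M => TanAt n x) c).baseSet := by simpa using hy
  have hC : y ∈ (trivializationAt (Model n →L[ℝ] ℝ) (fun x : M => CotAt n x) c).baseSet :=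
    ⟨hT, Set.mem_univ _⟩
  have hCC : y ∈ (trivializationAt ((Model n →L[ℝ] ℝ) →L[ℝ] ℝ)
      (fun x : M => CotAt n x →L[ℝ] ℝ) c).baseSet := ⟨hC, Set.mem_univ _⟩
  have h1 := extend_clm_apply (F₁ := Model n →L[ℝ] ℝ) (F₂ := (Model n →L[ℝ] ℝ) →L[ℝ] ℝ)
    (E₁ := fun x : M => CotAt n x) (E₂ := fun x : M => CotAt n x →L[ℝ] ℝ) S α hC hCC
  have h2 := extend_clm_apply (F₁ := Model n →L[ℝ] ℝ) (F₂ := ℝ)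
    (E₁ := fun x : M => CotAt n x) (E₂ := Bundle.Trivial M ℝ) (S α) β hC (by simp)
  rw [extend_trivial] at h2
  rw [extCov, h1]
  exact h2

set_option synthInstance.maxHeartbeats 100000 in
/-- A symmetric bilinear family of forms on the cotangent spaces is a smooth tensor field if its
components in each chart are smooth at the centre of the chart. -/
lemma exists_symBivectorField_of_components (N : ∀ z : M, CotAt n z → CotAt n z → ℝ)
    (h₁ : ∀ z β, IsLinearMap ℝ (N z · β)) (hsymm : ∀ z α β, N z α β = N z β α)
    (h : ∀ (c : M) (i j : Fin n), ContMDiffAt (𝓡 n) 𝓘(ℝ, ℝ) ∞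
      (fun z => N z (locCoframe c i z) (locCoframe c j z)) c) :
    ∃ σ : SymBivectorField n M, ∀ z α β, σ.1 z α β = N z α β := by
  have h₂ (z : M) (α : CotAt n z) : IsLinearMap ℝ (N z α) := by
    constructor
    · intro β β'
      rw [hsymm, (h₁ z α).map_add, hsymm z β, hsymm z β']
    · intro r β
      rw [hsymm, (h₁ z α).map_smul, hsymm z β]
  have hN {c z : M} (hz : z ∈ (chartAt (Model n) c).source) (α β : CotAt n z) :
      N z α β = ∑ i, ∑ j, α (locFrame c i z) * (β (locFrame c j z) *
        N z (locCoframe c i z) (locCoframe c j z)) := by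
    have e1 := map_sum (IsLinearMap.mk' _ (h₁ z β))
      (fun i => α (locFrame c i z) • locCoframe c i z) Finset.univ
    rw [sum_apply_locFrame_smul hz] at e1
    refine e1.trans (Finset.sum_congr rfl fun i _ => ?_)
    rw [map_smul, IsLinearMap.mk'_apply, smul_eq_mul, ← Finset.mul_sum]
    congr 1
    have e2 := map_sum (IsLinearMap.mk' _ (h₂ z (locCoframe c i z)))
      (fun j => β (locFrame c j z) • locCoframe c j z) Finset.univ
    rw [sum_apply_locFrame_smul hz] at e2
    refine e2.trans (Finset.sum_congr rfl fun j _ => ?_)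
    rw [map_smul, IsLinearMap.mk'_apply, smul_eq_mul]
  let S (z : M) : BivAt n z := ∑ i, ∑ j, N z (coframe z i) (coframe z j) •
    tensorAt n (frame z i) (frame z j)
  have hS (z : M) (α β : CotAt n z) : S z α β = N z α β := by
    rw [hN (mem_chart_source (Model n) z)]
    simp only [S, sum_apply, smul_apply, tensorAt_apply, smul_eq_mul, locFrame_self,
      locCoframe_self]
    exact Finset.sum_congr rfl fun i _ => Finset.sum_congr rfl fun j _ => by ring
  have hsm : ContMDiff (𝓡 n)
      ((𝓡 n).prod 𝓘(ℝ, (Model n →L[ℝ] ℝ) →L[ℝ] (Model n →L[ℝ] ℝ) →L[ℝ] ℝ)) ∞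
      (fun z => TotalSpace.mk' ((Model n →L[ℝ] ℝ) →L[ℝ] (Model n →L[ℝ] ℝ) →L[ℝ] ℝ)
        (E := fun z : M => BivAt n z) z (S z)) := by
    intro c
    have hc := mem_chart_source (Model n) c
    -- the tensors `e_i ⊗ e_j`, extended from `c`, form a smooth local frame
    let E (i j : Fin n) (z : M) : BivAt n z :=
      extend ((Model n →L[ℝ] ℝ) →L[ℝ] (Model n →L[ℝ] ℝ) →L[ℝ] ℝ) (E := fun z : M => BivAt n z)
        (tensorAt n (frame c i) (frame c j)) z
    have hE (i j : Fin n) : BivSmoothAt (E i j) c :=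
      contMDiffAt_extend_of_mem (V := fun z : M => BivAt n z) _
        (FiberBundle.mem_baseSet_trivializationAt'
          (F := (Model n →L[ℝ] ℝ) →L[ℝ] (Model n →L[ℝ] ℝ) →L[ℝ] ℝ)
          (E := fun z : M => BivAt n z) c)
    have h1 : BivSmoothAt (fun z => ∑ i, ∑ j,
        N z (locCoframe c i z) (locCoframe c j z) • E i j z) c :=
      .sum_section fun i _ => .sum_section fun j _ => (h c i j).smul_section (hE i j)
    refine h1.congr_of_eventuallyEq ?_
    filter_upwards [eventually_mem_source hc] with z hz
    congr 1
    ext α β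
    rw [hS, hN hz]
    simp only [sum_apply, smul_apply, smul_eq_mul]
    refine Finset.sum_congr rfl fun i _ => Finset.sum_congr rfl fun j _ => ?_
    have h2 : E i j z α β = α (locFrame c i z) * β (locFrame c j z) := by
      conv_lhs => rw [← sum_apply_locFrame_smul hz α, ← sum_apply_locFrame_smul hz β]
      simp only [map_sum, map_smul, sum_apply, smul_apply, smul_eq_mul, locCoframe, E,
        extend_biv_apply hz, tensorAt_apply, coframe_frame]
      simp [mul_comm]
    rw [h2]
    ring
  exact ⟨⟨⟨S, hsm⟩, fun z α β => by
    change S z α β = S z β α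
    rw [hS, hS, hsymm]⟩, fun z α β => hS z α β⟩

end

/-! ### The prolonged connection is a connection -/

section

section ProlongedAlgebra

variable {n : ℕ} {A : Type*} [CommRing A] [Algebra ℝ A]
  (d : Fin n → Derivation ℝ A A) (G : Fin n → Matrix (Fin n) (Fin n) A)
  (s s' : Fin n → Fin n → A) (mu mu' : Fin n → A) (rho rho' f : A)

lemma prolSigma_add (a b c : Fin n) :
    prolSigma d G (s + s') (mu + mu') a b c = prolSigma d G s mu a b c
      + prolSigma d G s' mu' a b c := by
  simp only [prolSigma, dbiv, Pi.add_apply, map_add, mul_add, Finset.sum_add_distrib]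
  split_ifs <;> ring

lemma prolMu_add (a b : Fin n) :
    prolMu d G (s + s') (mu + mu') (rho + rho') a b = prolMu d G s mu rho a b
      + prolMu d G s' mu' rho' a b := by
  simp only [prolMu, dvec, Pi.add_apply, map_add, mul_add, Finset.sum_add_distrib]
  split_ifs <;> ring

lemma prolRho_add (a : Fin n) :
    prolRho d G (s + s') (mu + mu') (rho + rho') a = prolRho d G s mu rho a
      + prolRho d G s' mu' rho' a := by
  simp only [prolRho, Pi.add_apply, map_add, mul_add, Finset.sum_add_distrib]
  ring

lemma prolSigma_smul (a b c : Fin n) :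
    prolSigma d G (f • s) (f • mu) a b c = f * prolSigma d G s mu a b c + d a f * s b c := by
  simp only [prolSigma, dbiv, Pi.smul_apply, smul_eq_mul, Derivation.leibniz,
    mul_left_comm _ f, ← Finset.mul_sum]
  split_ifs <;> ring

lemma prolMu_smul (a b : Fin n) :
    prolMu d G (f • s) (f • mu) (f * rho) a b = f * prolMu d G s mu rho a b + d a f * mu b := by
  simp only [prolMu, dvec, Pi.smul_apply, smul_eq_mul, Derivation.leibniz,
    mul_left_comm _ f, ← Finset.mul_sum]
  split_ifs <;> ring

lemma prolRho_smul (a : Fin n) :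
    prolRho d G (f • s) (f • mu) (f * rho) a = f * prolRho d G s mu rho a + d a f * rho := by
  simp only [prolRho, Pi.smul_apply, smul_eq_mul, Derivation.leibniz,
    mul_left_comm _ f, ← Finset.mul_sum]
  ring

lemma prolSigma_symm {s : Fin n → Fin n → A} (hs : ∀ b c, s b c = s c b) (a b c : Fin n) :
    prolSigma d G s mu a b c = prolSigma d G s mu a c b := by
  simp only [prolSigma, dbiv, hs b c, hs _ c, hs b _]
  ring

end ProlongedAlgebra

variable {n : ℕ} {M : Type*} [TopologicalSpace M] [ChartedSpace (Model n) M]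
  [IsManifold (𝓡 n) ∞ M] {c y : M}

lemma preFibre_ext (hy : y ∈ (chartAt (Model n) c).source) {p q : PreFibre n y}
    (h₁ : ∀ α β, p.1 α β = q.1 α β) (h₂ : ∀ k, locCoframe c k y p.2.1 = locCoframe c k y q.2.1)
    (h₃ : p.2.2 = q.2.2) : p = q :=
  Prod.ext (funext fun α => funext fun β => h₁ α β) (Prod.ext (tanAt_ext hy h₂) h₃)

lemma bivRing_eq_add (s t r : ProlongedSection n M) (h : ∀ x, r.val x = s.val x + t.val x) :
    bivRing c r.sigma.1 = bivRing c s.sigma.1 + bivRing c t.sigma.1 ∧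
    vecRing c r.mu = vecRing c s.mu + vecRing c t.mu ∧
    funRing c r.rho = funRing c s.rho + funRing c t.rho := by
  refine ⟨?_, ?_, ?_⟩
  · ext i j
    refine chartRing_ext fun y hy => ?_
    exact congrFun (congrFun (congrArg Prod.fst (h y)) _) _
  · ext i
    refine chartRing_ext fun y hy => ?_
    have h1 : r.mu y = s.mu y + t.mu y := congrArg (fun p => p.2.1) (h y)
    rw [Pi.add_apply, map_add, evalAt_vecRing, evalAt_vecRing, evalAt_vecRing, h1, map_add]
  · refine chartRing_ext fun y hy => ?_
    exact congrArg (fun p => p.2.2) (h y)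

lemma bivRing_eq_smul (f : ContMDiffMap (𝓡 n) 𝓘(ℝ, ℝ) M ℝ ∞) (s r : ProlongedSection n M)
    (h : ∀ x, r.val x = f x • s.val x) :
    bivRing c r.sigma.1 = funRing c f • bivRing c s.sigma.1 ∧
    vecRing c r.mu = funRing c f • vecRing c s.mu ∧
    funRing c r.rho = funRing c f * funRing c s.rho := by
  refine ⟨?_, ?_, ?_⟩
  · ext i j
    refine chartRing_ext fun y hy => ?_
    exact congrFun (congrFun (congrArg Prod.fst (h y)) _) _
  · ext i
    refine chartRing_ext fun y hy => ?_
    have h1 : r.mu y = f y • s.mu y := congrArg (fun p => p.2.1) (h y)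
    rw [Pi.smul_apply, smul_eq_mul, map_mul, evalAt_vecRing, evalAt_vecRing, evalAt_funRing, h1,
      map_smul, smul_eq_mul]
  · refine chartRing_ext fun y hy => ?_
    exact congrArg (fun p => p.2.2) (h y)

variable {D : Connection n M} [T2Space M] (hD : D.ContMDiffCovariantDerivative ∞)
include hD

lemma isLinearMap_prolongedDeriv (s : ProlongedSection n M) (x : M) :
    IsLinearMap ℝ (prolongedDeriv D s x) := by
  have hx := mem_chart_source (Model n) x
  constructor
  · intro u v
    refine preFibre_ext hx (fun α β => ?_) (fun k => ?_) ?_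
    · rw [Prod.fst_add, Pi.add_apply, Pi.add_apply]
      simp only [prolongedDeriv_fst hD hx, map_add, add_mul, mul_add, Finset.sum_add_distrib]
    · rw [Prod.snd_add, Prod.fst_add, map_add]
      simp only [prolongedDeriv_snd_fst hD hx, map_add, add_mul, Finset.sum_add_distrib]
    · rw [Prod.snd_add, Prod.snd_add]
      simp only [prolongedDeriv_snd_snd hD hx, map_add, add_mul, Finset.sum_add_distrib]
  · intro r u
    refine preFibre_ext hx (fun α β => ?_) (fun k => ?_) ?_
    · rw [Prod.smul_fst, Pi.smul_apply, Pi.smul_apply]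
      simp only [prolongedDeriv_fst hD hx, map_smul, smul_eq_mul, Finset.mul_sum]
      exact Finset.sum_congr rfl fun i _ => Finset.sum_congr rfl fun j _ =>
        Finset.sum_congr rfl fun a _ => by ring
    · rw [Prod.smul_snd, Prod.smul_fst, map_smul]
      simp only [prolongedDeriv_snd_fst hD hx, map_smul, smul_eq_mul, Finset.mul_sum, mul_assoc]
    · rw [Prod.smul_snd, Prod.smul_snd]
      simp only [prolongedDeriv_snd_snd hD hx, map_smul, smul_eq_mul, Finset.mul_sum, mul_assoc]

lemma prolongedDeriv_eq_add (s t r : ProlongedSection n M)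
    (h : ∀ x, r.val x = s.val x + t.val x) (x : M) (u : TanAt n x) :
    prolongedDeriv D r x u = prolongedDeriv D s x u + prolongedDeriv D t x u := by
  have hx := mem_chart_source (Model n) x
  obtain ⟨h1, h2, h3⟩ := bivRing_eq_add (c := x) s t r h
  refine preFibre_ext hx (fun α β => ?_) (fun k => ?_) ?_
  · rw [Prod.fst_add, Pi.add_apply, Pi.add_apply]
    simp only [prolongedDeriv_fst hD hx, h1, h2, prolSigma_add, map_add, mul_add,
      Finset.sum_add_distrib]
  · rw [Prod.snd_add, Prod.fst_add, map_add]
    simp only [prolongedDeriv_snd_fst hD hx, h1, h2, h3, prolMu_add, map_add, mul_add,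
      Finset.sum_add_distrib]
  · rw [Prod.snd_add, Prod.snd_add]
    simp only [prolongedDeriv_snd_snd hD hx, h1, h2, h3, prolRho_add, map_add, mul_add,
      Finset.sum_add_distrib]

lemma prolongedDeriv_leibniz (f : ContMDiffMap (𝓡 n) 𝓘(ℝ, ℝ) M ℝ ∞) (s r : ProlongedSection n M)
    (h : ∀ x, r.val x = f x • s.val x) (x : M) (u : TanAt n x) :
    prolongedDeriv D r x u = f x • prolongedDeriv D s x u + dir f x u • s.val x := by
  have hx := mem_chart_source (Model n) x
  obtain ⟨h1, h2, h3⟩ := bivRing_eq_smul (c := x) f s r h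
  have hf : dir f x u = ∑ a, locCoframe x a x u * evalAt hx (pdDer x a (funRing x f)) := by
    simp only [evalAt_pdDer_funRing]
    exact dir_eq_sum_locFrame _ hx u
  refine preFibre_ext hx (fun α β => ?_) (fun k => ?_) ?_
  · have h4 : (f x • prolongedDeriv D s x u + dir f x u • s.val x).1 α β
      = f x * (prolongedDeriv D s x u).1 α β + dir f x u * s.sigma.1 x α β := rfl
    rw [h4, biv_eq_sum hx, hf]
    simp only [prolongedDeriv_fst hD hx, h1, h2, prolSigma_smul, map_add, map_mul, mul_add,
      Finset.sum_add_distrib, evalAt_funRing, evalAt_bivRing, Finset.mul_sum]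
    congr 1
    · exact Finset.sum_congr rfl fun i _ => Finset.sum_congr rfl fun j _ =>
        Finset.sum_congr rfl fun a _ => by ring
    · refine Finset.sum_congr rfl fun i _ => Finset.sum_congr rfl fun j _ => ?_
      rw [Finset.sum_mul]
      exact Finset.sum_congr rfl fun a _ => by ring
  · have h4 : (f x • prolongedDeriv D s x u + dir f x u • s.val x).2.1
      = f x • (prolongedDeriv D s x u).2.1 + dir f x u • s.mu x := rfl
    rw [h4, map_add, map_smul, map_smul, hf]
    simp only [prolongedDeriv_snd_fst hD hx, h1, h2, h3, prolMu_smul, map_add, map_mul, mul_add,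
      Finset.sum_add_distrib, evalAt_funRing, evalAt_vecRing, Finset.mul_sum, Finset.sum_mul,
      smul_eq_mul]
    congr 1
    · exact Finset.sum_congr rfl fun a _ => by ring
    · exact Finset.sum_congr rfl fun a _ => by ring
  · have h4 : (f x • prolongedDeriv D s x u + dir f x u • s.val x).2.2
      = f x * (prolongedDeriv D s x u).2.2 + dir f x u * s.rho x := rfl
    rw [h4, hf]
    simp only [prolongedDeriv_snd_snd hD hx, h1, h2, h3, prolRho_smul, map_add, map_mul, mul_add,
      Finset.sum_add_distrib, evalAt_funRing, Finset.mul_sum, Finset.sum_mul]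
    congr 1
    · exact Finset.sum_congr rfl fun a _ => by ring
    · exact Finset.sum_congr rfl fun a _ => by ring

omit [T2Space M] hD in
/-- A function which near `c` is a combination of components of a vector field with coefficients
in the chart ring is smooth at `c`. -/
lemma contMDiffAt_of_eq_sum (X : VectorField n M) (F : Fin n → chartRing n c) {f : M → ℝ}
    (hf : ∀ z (hz : z ∈ (chartAt (Model n) c).source),
      f z = ∑ a, locCoframe c a z (X z) * evalAt hz (F a)) :
    ContMDiffAt (𝓡 n) 𝓘(ℝ, ℝ) ∞ f c := by
  have hc := mem_chart_source (Model n) c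
  have h : SmoothNear n (fun z => ∑ a, extZero (vecRing c X a).1 z * extZero (F a).1 z) c :=
    .sum fun a _ => (smoothNear_extZero _ hc).mul (smoothNear_extZero _ hc)
  refine h.contMDiffAt.congr_of_eventuallyEq ?_
  filter_upwards [eventually_mem_source hc] with z hz
  rw [hf z hz]
  simp only [extZero_eq_evalAt _ hz, evalAt_vecRing]

lemma exists_prolongedDeriv_eq_val (s : ProlongedSection n M) (X : VectorField n M) :
    ∃ t : ProlongedSection n M, ∀ x, t.val x = prolongedDeriv D s x (X x) := by
  obtain ⟨σ, hσ⟩ := exists_symBivectorField_of_components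
    (fun z α β => (prolongedDeriv D s z (X z)).1 α β)
    (fun z β => by
      have hz := mem_chart_source (Model n) z
      constructor
      · intro α α'
        simp only [prolongedDeriv_fst hD hz, add_apply, add_mul, Finset.sum_add_distrib]
      · intro r α
        simp only [prolongedDeriv_fst hD hz, smul_apply, smul_eq_mul, mul_assoc,
          ← Finset.mul_sum])
    (fun z α β => by
      have hz := mem_chart_source (Model n) z
      simp only [prolongedDeriv_fst hD hz]
      rw [Finset.sum_comm]
      refine Finset.sum_congr rfl fun i _ => Finset.sum_congr rfl fun j _ => ?_
      simp only [prolSigma_symm _ _ _ (bivRing_symm s.sigma) _ j i]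
      ring)
    (fun c i j => by
      refine contMDiffAt_of_eq_sum X (fun a => prolSigma (pdDer c) (chrisRing hD c)
        (bivRing c s.sigma.1) (vecRing c s.mu) a i j) fun z hz => ?_
      rw [prolongedDeriv_fst hD hz, Finset.sum_eq_single i
        (by intro b _ hb; simp [locCoframe_locFrame hz, hb.symm]) (by simp),
        Finset.sum_eq_single j
        (by intro b _ hb; simp [locCoframe_locFrame hz, hb.symm]) (by simp)]
      simp [locCoframe_locFrame hz])
  obtain ⟨μ, hμ⟩ := exists_vectorField_of_components
    (fun z => (prolongedDeriv D s z (X z)).2.1)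
    (fun c k => contMDiffAt_of_eq_sum X (fun a => prolMu (pdDer c) (chrisRing hD c)
        (bivRing c s.sigma.1) (vecRing c s.mu) (funRing c s.rho) a k)
        fun z hz => prolongedDeriv_snd_fst hD hz s _ k)
  refine ⟨⟨σ, μ, ⟨fun z => (prolongedDeriv D s z (X z)).2.2, fun c =>
    contMDiffAt_of_eq_sum X (fun a => prolRho (pdDer c) (chrisRing hD c)
        (bivRing c s.sigma.1) (vecRing c s.mu) (funRing c s.rho) a)
        fun z hz => prolongedDeriv_snd_snd hD hz s _⟩⟩, fun x => ?_⟩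
  exact Prod.ext (funext fun α => funext fun β => hσ x α β) (Prod.ext (hμ x) rfl)

theorem isConnection_prolongedDeriv : IsConnection (prolongedDeriv D) where
  linear := isLinearMap_prolongedDeriv hD
  smooth := exists_prolongedDeriv_eq_val hD
  add := prolongedDeriv_eq_add hD
  leibniz := prolongedDeriv_leibniz hD

end

/-! ### Parallel sections and solutions -/

section

variable {n : ℕ} {M : Type*} [TopologicalSpace M] [ChartedSpace (Model n) M]
  [IsManifold (𝓡 n) ∞ M] {c y : M} {D : Connection n M}

lemma IsCovariantConstant.isSolution {s : ProlongedSection n M}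
    (hs : IsCovariantConstant (prolongedDeriv D) s) : IsSolution D s.sigma := by
  refine ⟨s.mu, fun x u α β => ?_⟩
  have h : bivectorDeriv D s.sigma.1 x u α β - α u * β (s.mu x) - β u * α (s.mu x) = 0 :=
    congrFun (congrFun (congrArg Prod.fst (hs x u)) α) β
  linarith

/-- A parallel section is determined by its first component: `μ` is a trace of `∇σ`, and `ρ` is a
trace of the second equation. -/
lemma IsCovariantConstant.eq_of_sigma_eq (hn : 0 < n) {s t : ProlongedSection n M}
    (hs : IsCovariantConstant (prolongedDeriv D) s)
    (ht : IsCovariantConstant (prolongedDeriv D) t) (h : s.sigma = t.sigma) : s = t := by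
  obtain ⟨σ, μ, ρ⟩ := s
  obtain ⟨σ', μ', ρ'⟩ := t
  obtain rfl : σ = σ' := h
  have hμ : μ = μ' := by
    refine ContMDiffSection.ext fun x => tanAt_ext (mem_chart_source (Model n) x) fun k => ?_
    rw [locCoframe_self]
    have h1 : bivectorDeriv D σ.1 x (frame x k) (coframe x k) (coframe x k)
        - coframe x k (frame x k) * coframe x k (μ x)
        - coframe x k (frame x k) * coframe x k (μ x) = 0 :=
      congrFun (congrFun (congrArg Prod.fst (hs x (frame x k))) _) _
    have h2 : bivectorDeriv D σ.1 x (frame x k) (coframe x k) (coframe x k)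
        - coframe x k (frame x k) * coframe x k (μ' x)
        - coframe x k (frame x k) * coframe x k (μ' x) = 0 :=
      congrFun (congrFun (congrArg Prod.fst (ht x (frame x k))) _) _
    rw [coframe_frame, if_pos rfl] at h1 h2
    linarith
  subst hμ
  have hρ : ρ = ρ' := by
    refine ContMDiffMap.ext fun x => ?_
    let k : Fin n := ⟨0, hn⟩
    have h1 := congrArg (fun p => p.2.1) ((hs x (frame x k)).trans (ht x (frame x k)).symm)
    have h2 : ρ x • frame x k = ρ' x • frame x k := by
      simpa only [prolongedDeriv, sub_left_inj, add_left_inj, sub_right_inj] using h1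
    have h3 := congrArg (coframe x k) h2
    simpa [coframe_frame] using h3
  rw [hρ]

variable (D) in
/-- The function `ρ = (∇_a μ^a + P_{ab} σ^{ab}) / n`. -/
def rhoFun (σ : BivectorField n M) (μ : VectorField n M) (x : M) : ℝ :=
  (1 / (n : ℝ)) * (∑ i, coframe x i (D μ x (frame x i))
    + ∑ i, ∑ j, σ x (coframe x i) (coframe x j) • schouten D x (frame x i) (frame x j))

variable [T2Space M] (hD : D.ContMDiffCovariantDerivative ∞)
include hD

lemma rhoFun_eq_evalAt (hy : y ∈ (chartAt (Model n) c).source) (σ : BivectorField n M)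
    (μ : VectorField n M) : rhoFun D σ μ y = evalAt hy (rhoOf (pdDer c) (chrisRing hD c)
      (bivRing c σ) (vecRing c μ)) := by
  have h1 := sum_frame_coframe hy (fun u α => α (D μ y u))
    (fun α => ⟨fun u v => by rw [map_add, map_add], fun r u => by rw [map_smul, map_smul]⟩)
    (fun u => ⟨fun _ _ => rfl, fun _ _ => rfl⟩)
  have h2 (a : Fin n) : locCoframe c a y (D μ y (locFrame c a y))
      = evalAt hy (dvec (pdDer c) (chrisRing hD c) (vecRing c μ) a a) := by
    rw [locCoframe_connection hD hy]
    simp [locCoframe_locFrame hy]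
  rw [rhoFun, h1, sum_frame_bivector hy (fun v w => schouten D y v w)
    (isLinearMap_schouten_left hD) (isLinearMap_schouten_right hD), rhoOf, evalAt_algebraMap_mul,
    map_add]
  simp only [h2, schouten_locFrame hD hy, map_sum, map_mul, evalAt_bivRing, smul_eq_mul, mul_comm]

lemma contMDiff_rhoFun (σ : BivectorField n M) (μ : VectorField n M) :
    ContMDiff (𝓡 n) 𝓘(ℝ, ℝ) ∞ (rhoFun D σ μ) := by
  intro c
  have hc := mem_chart_source (Model n) c
  refine (smoothNear_extZero (rhoOf (pdDer c) (chrisRing hD c) (bivRing c σ) (vecRing c μ))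
    hc).contMDiffAt.congr_of_eventuallyEq ?_
  filter_upwards [eventually_mem_source hc] with z hz
  rw [rhoFun_eq_evalAt hD hz, extZero_eq_evalAt _ hz]

/-- The equation `∇_a σ^{bc} = δ_a{}^b μ^c + δ_a{}^c μ^b` in coordinates. -/
lemma dbiv_eq_of_solution {σ : BivectorField n M} {μ : VectorField n M}
    (h : ∀ (x : M) (u : TanAt n x) (α β : CotAt n x),
      bivectorDeriv D σ x u α β = α u * β (μ x) + β u * α (μ x)) (a i j : Fin n) :
    dbiv (pdDer c) (chrisRing hD c) (bivRing c σ) a i j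
      = (if a = i then vecRing c μ j else 0) + if a = j then vecRing c μ i else 0 := by
  refine chartRing_ext fun y hy => ?_
  have h1 := h y (locFrame c a y) (locCoframe c i y) (locCoframe c j y)
  rw [bivectorDeriv_eq_evalAt hD hy, Finset.sum_eq_single i
    (by intro b _ hb; simp [locCoframe_locFrame hy, hb.symm]) (by simp), Finset.sum_eq_single j
    (by intro b _ hb; simp [locCoframe_locFrame hy, hb.symm]) (by simp), Finset.sum_eq_single a
    (by intro b _ hb; simp [locCoframe_locFrame hy, hb]) (by simp)] at h1
  simp only [locCoframe_locFrame hy, if_true, one_mul, ite_mul, zero_mul] at h1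
  rw [h1, map_add, apply_ite (evalAt hy), apply_ite (evalAt hy), map_zero, evalAt_vecRing,
    evalAt_vecRing]
  simp only [eq_comm]

/-- Prolongation: a solution is the first component of a parallel section. -/
lemma exists_isCovariantConstant (hn : 2 ≤ n) (hT : D.torsion = 0) (hS : IsSpecial D)
    {σ : SymBivectorField n M} (hσ : IsSolution D σ) :
    ∃ s : ProlongedSection n M, IsCovariantConstant (prolongedDeriv D) s ∧ s.sigma = σ := by
  obtain ⟨μ, hμ⟩ := hσ
  let ρ : ContMDiffMap (𝓡 n) 𝓘(ℝ, ℝ) M ℝ ∞ := ⟨rhoFun D σ.1 μ, contMDiff_rhoFun hD σ.1 μ⟩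
  refine ⟨⟨σ, μ, ρ⟩, fun x u => ?_, rfl⟩
  have hx := mem_chart_source (Model n) x
  have hρ : funRing x ρ = rhoOf (pdDer x) (chrisRing hD x) (bivRing x σ.1) (vecRing x μ) :=
    chartRing_ext fun y hy => rhoFun_eq_evalAt hD hy σ.1 μ
  have hd (a b : Fin n) (f : chartRing n x) :
      pdDer x a (pdDer x b f) = pdDer x b (pdDer x a f) := pdDer_comm a b f
  have hG (a b e : Fin n) : chrisRing hD x a e b = chrisRing hD x b e a :=
    chrisRing_symm hD hT a e b
  have h := dbiv_eq_of_solution (c := x) hD hμ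
  have e₁ (a i j : Fin n) : prolSigma (pdDer x) (chrisRing hD x) (bivRing x σ.1) (vecRing x μ)
      a i j = 0 := by
    rw [prolSigma, h]
    ring
  have e₂ (a k : Fin n) : prolMu (pdDer x) (chrisRing hD x) (bivRing x σ.1) (vecRing x μ)
      (funRing x ρ) a k = 0 := by
    rw [prolMu, dvec_eq_of_dbiv_eq hn hd hG (bivRing_symm σ) h, hρ]
    ring
  have e₃ (a : Fin n) : prolRho (pdDer x) (chrisRing hD x) (bivRing x σ.1) (vecRing x μ)
      (funRing x ρ) a = 0 := by
    rw [prolRho, hρ, derivation_rhoOf hn hd hG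
      (trace_riem_eq_zero hD hS x) (bivRing_symm σ) h]
    ring
  refine preFibre_ext hx (fun α β => ?_) (fun k => ?_) ?_
  · rw [prolongedDeriv_fst hD hx]
    simp only [e₁, map_zero, mul_zero, Finset.sum_const_zero]
    rfl
  · rw [prolongedDeriv_snd_fst hD hx]
    simp only [e₂, map_zero, mul_zero, Finset.sum_const_zero]
    exact (map_zero _).symm
  · rw [prolongedDeriv_snd_snd hD hx]
    simp only [e₃, map_zero, mul_zero, Finset.sum_const_zero]
    rfl

end

end ProjectiveMetric

end

theorem mainTheorem3 {n : ℕ} (hn : 2 ≤ n) {M : Type*} [TopologicalSpace M] [T2Space M]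
    [ChartedSpace (ProjectiveMetric.Model n) M] [IsManifold (𝓡 n) ∞ M]
    (D : ProjectiveMetric.Connection n M)
    (hsmooth : CovariantDerivative.ContMDiffCovariantDerivative D ∞)
    (htorsion : CovariantDerivative.torsion D = 0)
    (hspecial : ProjectiveMetric.IsSpecial D) :
    ProjectiveMetric.IsConnection (ProjectiveMetric.prolongedDeriv D) ∧
    Set.BijOn (fun s : ProjectiveMetric.ProlongedSection n M => s.sigma)
      {s | ProjectiveMetric.IsCovariantConstant (ProjectiveMetric.prolongedDeriv D) s}
      {σ | ProjectiveMetric.IsSolution D σ} :=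
  ⟨ProjectiveMetric.isConnection_prolongedDeriv hsmooth,
    fun _ hs => hs.isSolution,
    fun _ hs _ ht h => hs.eq_of_sigma_eq (by omega) ht h,
    fun _ hσ => ProjectiveMetric.exists_isCovariantConstant hsmooth hn htorsion hspecial hσ⟩
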